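/- Let $N\ge 1$, $0<s<1$, and let $\Omega\subset\mathbb R^N$ be a bounded domain with Lipschitz boundary. Let $G:[0,\infty)\to[0,\infty)$ be an $N$-function (continuous, convex, $G(t)=0\iff t=0$, $G(t)/t\to0$ as $t\to0^+$ and $G(t)/t\to\infty$ as $t\to\infty$), $G(t)=\int_0^t g$, where $g\in C^1([0,\infty))$ is nonnegative and nondecreasing, vanishes only at $0$, and $g(t)\to\infty$ as $t\to\infty$. Assume: (H1) $g$ is locally absolutely continuous; (H2) $g'$ is nondecreasing on $(0,\infty)$; (H3) $\int_0^1 G^{-1}(\tau)\,\tau^{-\frac{N+s}{N}}\,d\tau<\infty$ and $\int_1^\infty G^{-1}(\tau)\,\tau^{-\frac{N+s}{N}}\,d\tau=\infty$; (H4) there are real constants $p^-,p^+$ with $1<p^--1\le \frac{t g'(t)}{g(t)}\le p^+-1$ for all $t>0$. Let $G_*$ be the inverse of $t\mapsto\int_0^t G^{-1}(\tau)\,\tau^{-\frac{N+s}{N}}\,d\tau$ on $[0,\infty)$. For a function $A$ on $[0,\infty)$ put $\overline A(t)=\sup_{\tau\ge0}(t\tau-A(\tau))$, and let $L^{A}(\Omega)$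 be the set of measurable $u$ with $\int_\Omega A(|u|/\lambda)\,dx<\infty$ for some $\lambda>0$. For $S\subset\mathbb R^N$, $W^{s,G}(S)$ is the set of $u\in L^G(S)$ such that $\int_S\int_S G\big(\frac{|u(x)-u(y)|}{\lambda|x-y|^s}\big)\frac{dx\,dy}{|x-y|^N}<\infty$ for some $\lambda>0$. $W^{s,G}_0(\Omega)$ is the set of $u\in W^{s,G}(\mathbb R^N)$ vanishing a.e. outside $\Omega$, $W^{s,G}_{\mathrm{loc}}(\Omega)$ is the set of functions belonging to $W^{s,G}(K)$ for every compact $K\subset\Omega$, and $L^\infty_c(\Omega)$ is the set of essentially bounded functions vanishing a.e. outside some compact subset of $\Omega$. Let $\mathbf{FC}$ be the class of strictly convex $C^1$ functions $\Psi:(0,\infty)\to(0,\infty)$ with $\Psi'$ increasing and, for some $\theta_1,\theta_2\ge0$, $\theta_1\Psi(x)/x\le\Psi'(x)\le\theta_2\Psi(x)/x$ for all $x>0$. Let $\alpha>0$, $0<\beta<p^--1$, let $f\ge0$ a.e. in $\Omega$ with $f\not\equiv0$, and let $k>0$ a.e. in $\Omega$. Consider the problem $$(-\Delta)^s_g u=f(x)u^{-\alpha}+k(x)u^{\beta},\quad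 u>0\ \text{in }\Omega,\qquad u=0\ \text{in }\mathbb R^N\setminus\Omega. \tag{P}$$ A weak super-solution of (P) is a function $u\in W^{s,G}_{\mathrm{loc}}(\Omega)$ with $u>0$ a.e. in $\Omega$ and $u=0$ a.e. in $\mathbb R^N\setminus\Omega$ such that: (i) there is $\Psi\in\mathbf{FC}$ for which $\Psi(u)$, extended by $0$ outside $\Omega$, lies in $W^{s,G}_0(\Omega)$; (ii) for every compact $K\subset\Omega$ there is $C(K)>0$ with $u\ge C(K)$ a.e. in $K$; (iii) for every $\varphi\in W^{s,G}_0(\Omega)\cap L^\infty_c(\Omega)$ with $\varphi\ge0$, $$\int_{\mathbb R^N}\int_{\mathbb R^N} g\Big(\frac{|u(x)-u(y)|}{|x-y|^s}\Big)\frac{u(x)-u(y)}{|u(x)-u(y)|}\,\frac{\varphi(x)-\varphi(y)}{|x-y|^{N+s}}\,dx\,dy\ \ge\ \int_\Omega\big(f u^{-\alpha}+k u^{\beta}\big)\varphi\,dx,$$ where both integrals converge absolutely and the integrand on the left is $0$ where $u(x)=u(y)$. A weak sub-solution is defined in the same way, with the reverse inequality in (iii). Suppose that $k\in L^{\overline K}(\Omega)$,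 where $K(t)=G_*(t^{1/(\beta+1)})$, and that one of the following holds: (A1) $\alpha>1$ and $f\in L^1(\Omega)$; (A2) $\alpha=1$ and $f\in L^{\overline{G_*}}(\Omega)$; (A3) $\alpha<1$ and $f\in L^{\overline{\mathfrak F}}(\Omega)$, where $\mathfrak F(t)=G_*(t^{1/(1-\alpha)})$. If $\underline u$ is a weak sub-solution and $\overline u$ is a weak super-solution of (P), then $\underline u\le\overline u$ a.e. in $\Omega$. -/

import Mathlib

open MeasureTheory Filter Topology Set

namespace FracOrlicz

/-- `N`-functions: real functions used on `[0, ∞)` only. -/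
structure IsNFunction (G : ℝ → ℝ) : Prop where
  continuousOn : ContinuousOn G (Ici 0)
  convexOn : ConvexOn ℝ (Ici 0) G
  nonneg : ∀ t, 0 ≤ t → 0 ≤ G t
  eq_zero_iff : ∀ t, 0 ≤ t → (G t = 0 ↔ t = 0)
  tendsto_zero : Tendsto (fun t => G t / t) (𝓝[>] 0) (𝓝 0)
  tendsto_atTop : Tendsto (fun t => G t / t) atTop atTop

/-- `g` is the density of the `N`-function `G`, that is `G(t) = ∫₀ᵗ g`, and it is of class `C¹` on
`[0, ∞)`. -/
structure IsDensity (G g : ℝ → ℝ) : Prop where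
  nonneg : ∀ t, 0 ≤ t → 0 ≤ g t
  monotoneOn : MonotoneOn g (Ici 0)
  eq_zero_iff : ∀ t, 0 ≤ t → (g t = 0 ↔ t = 0)
  tendsto_atTop : Tendsto g atTop atTop
  contDiffOn : ContDiffOn ℝ 1 g (Ici 0)
  integral_eq : ∀ t, 0 ≤ t → G t = ∫ τ in (0 : ℝ)..t, g τ

/-- The inverse of a bijection `F : [0, ∞) → [0, ∞)`. -/
noncomputable def invNonneg (F : ℝ → ℝ) : ℝ → ℝ :=
  Function.invFunOn F (Ici 0)

/-- The structural conditions on the growth function: `g` is (locally) absolutely continuous, `g'`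
is nondecreasing on `(0, ∞)`, the integral of `G⁻¹(τ) τ^{-(N+s)/N}` converges at zero and diverges
at infinity, and `1 < p⁻ - 1 ≤ t g'(t) / g(t) ≤ p⁺ - 1 < ∞` for all `t > 0`. -/
structure StructuralConditions (N : ℕ) (s : ℝ) (G g : ℝ → ℝ) (pm pp : ℝ) : Prop where
  absolutelyContinuous : ∀ a b, 0 ≤ a → a ≤ b → AbsolutelyContinuousOnInterval g a b
  deriv_monotoneOn : MonotoneOn (deriv g) (Ioi 0)
  integral_zero :
    ∫⁻ τ in Ioc (0 : ℝ) 1, ENNReal.ofReal (invNonneg G τ / τ ^ (((N : ℝ) + s) / (N : ℝ))) < ⊤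
  integral_infty :
    ∫⁻ τ in Ioi (1 : ℝ), ENNReal.ofReal (invNonneg G τ / τ ^ (((N : ℝ) + s) / (N : ℝ))) = ⊤
  one_lt : 1 < pm - 1
  index_lower : ∀ t, 0 < t → pm - 1 ≤ t * deriv g t / g t
  index_upper : ∀ t, 0 < t → t * deriv g t / g t ≤ pp - 1

/-- The Sobolev conjugate `G_*`, the inverse of `t ↦ ∫₀ᵗ G⁻¹(τ) τ^{-(N+s)/N} dτ`. -/
noncomputable def sobolevConj (N : ℕ) (s : ℝ) (G : ℝ → ℝ) : ℝ → ℝ :=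
  invNonneg fun t => ∫ τ in (0 : ℝ)..t, invNonneg G τ / τ ^ (((N : ℝ) + s) / (N : ℝ))

/-- The complementary function `t ↦ sup_{τ ≥ 0} (t τ - A(τ))`. -/
noncomputable def complementary (A : ℝ → ℝ) (t : ℝ) : ℝ :=
  sSup ((fun τ => t * τ - A τ) '' Ici 0)

section Spaces

variable {N : ℕ}

/-- A bounded domain (open, connected, nonempty) whose boundary is locally, after a rotation, the
graph of a Lipschitz function, with the domain lying on one side of that graph. -/
structure IsBoundedLipschitzDomain (Ω : Set (EuclideanSpace ℝ (Fin N))) : Prop where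
  isOpen : IsOpen Ω
  isConnected : IsConnected Ω
  isBounded : Bornology.IsBounded Ω
  lipschitz_boundary : ∀ x ∈ frontier Ω,
    ∃ e : EuclideanSpace ℝ (Fin N), ‖e‖ = 1 ∧
    ∃ L : NNReal, ∃ γ : ((ℝ ∙ e)ᗮ : Submodule ℝ (EuclideanSpace ℝ (Fin N))) → ℝ,
      LipschitzWith L γ ∧
      ∃ r : ℝ, 0 < r ∧ ∀ y ∈ Metric.ball x r,
        (y ∈ Ω ↔ γ ((ℝ ∙ e)ᗮ.orthogonalProjectionOnto y) < inner ℝ e y)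

/-- The Orlicz space `L^A(S)`. -/
def MemOrlicz (A : ℝ → ℝ) (S : Set (EuclideanSpace ℝ (Fin N)))
    (u : EuclideanSpace ℝ (Fin N) → ℝ) : Prop :=
  AEMeasurable u (volume.restrict S) ∧
    ∃ l : ℝ, 0 < l ∧ ∫⁻ x in S, ENNReal.ofReal (A (|u x| / l)) < ⊤

/-- The modular
`∫_S ∫_S G(|u(x) - u(y)| / |x - y|^s) |x - y|^{-N} dx dy`. -/
noncomputable def gagliardoModular (s : ℝ) (G : ℝ → ℝ) (S : Set (EuclideanSpace ℝ (Fin N)))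
    (u : EuclideanSpace ℝ (Fin N) → ℝ) : ENNReal :=
  ∫⁻ x in S, ∫⁻ y in S,
    ENNReal.ofReal (G (|u x - u y| / ‖x - y‖ ^ s) / ‖x - y‖ ^ N)

/-- The fractional Orlicz-Sobolev space `W^{s,G}(S)`. -/
def MemW (s : ℝ) (G : ℝ → ℝ) (S : Set (EuclideanSpace ℝ (Fin N)))
    (u : EuclideanSpace ℝ (Fin N) → ℝ) : Prop :=
  MemOrlicz G S u ∧ ∃ l : ℝ, 0 < l ∧ gagliardoModular s G S (fun x => u x / l) < ⊤

/-- The space `W^{s,G}_0(Ω)` of functions in `W^{s,G}(ℝ^N)` that vanish outside `Ω`. -/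
def MemW0 (s : ℝ) (G : ℝ → ℝ) (Ω : Set (EuclideanSpace ℝ (Fin N)))
    (u : EuclideanSpace ℝ (Fin N) → ℝ) : Prop :=
  MemW s G univ u ∧ ∀ᵐ x, x ∉ Ω → u x = 0

/-- The local space `W^{s,G}_loc(Ω)`. -/
def MemWloc (s : ℝ) (G : ℝ → ℝ) (Ω : Set (EuclideanSpace ℝ (Fin N)))
    (u : EuclideanSpace ℝ (Fin N) → ℝ) : Prop :=
  ∀ K : Set (EuclideanSpace ℝ (Fin N)), IsCompact K → K ⊆ Ω → MemW s G K u

/-- The class `FC` of functions `Ψ : (0, ∞) → (0, ∞)`. -/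
structure IsFC (Ψ : ℝ → ℝ) : Prop where
  pos : ∀ t, 0 < t → 0 < Ψ t
  contDiffOn : ContDiffOn ℝ 1 Ψ (Ioi 0)
  strictConvexOn : StrictConvexOn ℝ (Ioi 0) Ψ
  deriv_strictMonoOn : StrictMonoOn (deriv Ψ) (Ioi 0)
  bounds : ∃ θ₁ θ₂ : ℝ, 0 ≤ θ₁ ∧ 0 ≤ θ₂ ∧
    ∀ t, 0 < t → θ₁ * (Ψ t / t) ≤ deriv Ψ t ∧ deriv Ψ t ≤ θ₂ * (Ψ t / t)

/-- Nonnegative test functions in `W^{s,G}_0(Ω) ∩ L^∞_c(Ω)`. -/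
structure IsTest (s : ℝ) (G : ℝ → ℝ) (Ω : Set (EuclideanSpace ℝ (Fin N)))
    (φ : EuclideanSpace ℝ (Fin N) → ℝ) : Prop where
  memW0 : MemW0 s G Ω φ
  bounded : ∃ M : ℝ, ∀ᵐ x, |φ x| ≤ M
  compact_support : ∃ K : Set (EuclideanSpace ℝ (Fin N)),
    IsCompact K ∧ K ⊆ Ω ∧ ∀ᵐ x, x ∉ K → φ x = 0
  nonneg : ∀ᵐ x, 0 ≤ φ x

/-- The integrand of the weak form of the fractional `g`-Laplacian of `u` tested with `φ`; the
quotient `(u(x) - u(y)) / |u(x) - u(y)|` is zero when `u(x) = u(y)`. -/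
noncomputable def operatorIntegrand (s : ℝ) (g : ℝ → ℝ) (u φ : EuclideanSpace ℝ (Fin N) → ℝ)
    (z : EuclideanSpace ℝ (Fin N) × EuclideanSpace ℝ (Fin N)) : ℝ :=
  g (|u z.1 - u z.2| / ‖z.1 - z.2‖ ^ s) * ((u z.1 - u z.2) / |u z.1 - u z.2|) *
    ((φ z.1 - φ z.2) / ‖z.1 - z.2‖ ^ ((N : ℝ) + s))

/-- The integrand `(f u^{-α} + k u^β) φ` of the right-hand side of the weak form. -/
noncomputable def sourceIntegrand (f k : EuclideanSpace ℝ (Fin N) → ℝ) (α β : ℝ)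
    (u φ : EuclideanSpace ℝ (Fin N) → ℝ) (x : EuclideanSpace ℝ (Fin N)) : ℝ :=
  (f x * u x ^ (-α) + k x * u x ^ β) * φ x

/-- What weak sub-solutions and weak super-solutions have in common: `u ∈ W^{s,G}_loc(Ω)`, `u > 0`
in `Ω`, `u = 0` outside `Ω`, `Ψ(u) ∈ W^{s,G}_0(Ω)` for some `Ψ` in the class `FC` (where `Ψ(u)` is
extended by zero outside `Ω`), `u` is bounded below by a positive constant on every compact subset
of `Ω`, and the integrals in the weak formulation converge absolutely. -/
structure IsAdmissible (s : ℝ) (G g : ℝ → ℝ) (Ω : Set (EuclideanSpace ℝ (Fin N)))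
    (f k : EuclideanSpace ℝ (Fin N) → ℝ) (α β : ℝ) (u : EuclideanSpace ℝ (Fin N) → ℝ) : Prop where
  memWloc : MemWloc s G Ω u
  pos : ∀ᵐ x, x ∈ Ω → 0 < u x
  eq_zero : ∀ᵐ x, x ∉ Ω → u x = 0
  boundary : ∃ Ψ : ℝ → ℝ, IsFC Ψ ∧ MemW0 s G Ω (Ω.indicator fun x => Ψ (u x))
  lower_bound : ∀ K : Set (EuclideanSpace ℝ (Fin N)), IsCompact K → K ⊆ Ω →
    ∃ C : ℝ, 0 < C ∧ ∀ᵐ x, x ∈ K → C ≤ u x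
  integrable_operator : ∀ φ : EuclideanSpace ℝ (Fin N) → ℝ, IsTest s G Ω φ →
    Integrable (operatorIntegrand s g u φ) (volume.prod volume)
  integrable_source : ∀ φ : EuclideanSpace ℝ (Fin N) → ℝ, IsTest s G Ω φ →
    IntegrableOn (sourceIntegrand f k α β u φ) Ω

/-- Weak super-solutions of `(-Δ)^s_g u = f u^{-α} + k u^β`, `u > 0` in `Ω`, `u = 0` outside. -/
def IsWeakSupersolution (s : ℝ) (G g : ℝ → ℝ) (Ω : Set (EuclideanSpace ℝ (Fin N)))
    (f k : EuclideanSpace ℝ (Fin N) → ℝ) (α β : ℝ) (u : EuclideanSpace ℝ (Fin N) → ℝ) : Prop :=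
  IsAdmissible s G g Ω f k α β u ∧
    ∀ φ : EuclideanSpace ℝ (Fin N) → ℝ, IsTest s G Ω φ →
      ∫ x in Ω, sourceIntegrand f k α β u φ x ≤
        ∫ z, operatorIntegrand s g u φ z ∂(volume.prod volume)

/-- Weak sub-solutions of `(-Δ)^s_g u = f u^{-α} + k u^β`, `u > 0` in `Ω`, `u = 0` outside. -/
def IsWeakSubsolution (s : ℝ) (G g : ℝ → ℝ) (Ω : Set (EuclideanSpace ℝ (Fin N)))
    (f k : EuclideanSpace ℝ (Fin N) → ℝ) (α β : ℝ) (u : EuclideanSpace ℝ (Fin N) → ℝ) : Prop :=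
  IsAdmissible s G g Ω f k α β u ∧
    ∀ φ : EuclideanSpace ℝ (Fin N) → ℝ, IsTest s G Ω φ →
      ∫ z, operatorIntegrand s g u φ z ∂(volume.prod volume) ≤
        ∫ x in Ω, sourceIntegrand f k α β u φ x

end Spaces

end FracOrlicz

/-!
Comparison for a singular and sublinear problem, by the method of Brezis–Oswald and Díaz–Saá. Put
`p = pm > 2`. The index condition says that `t ↦ g(t) / t ^ (p - 1)` is nondecreasing, and since
`β < p - 1` both source terms, divided by `u ^ (p - 1)`, decrease in `u`. Formally one tests the
sub-solution `u` with `(u ^ p - v ^ p)⁺ / u ^ (p - 1)` and the super-solution `v` with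
`(u ^ p - v ^ p)⁺ / v ^ (p - 1)`. The difference of the operators is nonnegative pointwise
(`testedFlux_self_nonneg`, which rests on Picone's inequality, that is on the subadditivity of the
perspective `a ^ p / w ^ (p - 1)`), while the difference of the sources is negative where `u > v`.
So `u ≤ v`.

These functions are not admissible, because `u` and `v` have only local energy, are unbounded, and
reach the boundary. With `w = (u - e)⁺` and `m ≤ min w M` of compact support in `Ω`, the functions
`(m ^ p - v ^ p)⁺ / w ^ (p - 1)` and `(m ^ p - v ^ p)⁺ / v ^ (p - 1)` are admissible
(`isTest_excess_div_left`, `isTest_excess_div_right`). The sign of the operators is lost only at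
pairs of points where `m ≠ w`, and there the loss is at most a multiple of the energies of `w` and
`m`, whatever `v` is (`neg_le_testedFlux`). This matters as the energy of `v` is not controlled near
the boundary, where `v` may be small. For `u` the function `Ψ` of the boundary condition helps: it
is steep above each positive level, so that `u` has finite energy there
(`IsAdmissible.lintegral_energy_level_lt_top`).

Let first `m → min w M`. In a Lipschitz domain this is possible with vanishing energy on the set
where `m ≠ min w M` (`exists_compact_support_approx`, by translating localized pieces into the
domain). Then let `e → 0`; the error in the sources is dominated by a multiple of `k`, which is
integrable (`integrableOn_of_memOrlicz_complementary`). Then let `M → ∞`; the remaining energy of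
`u` above the level `M` vanishes. The result is that
`k (u ^ p - v ^ p)⁺ (v ^ (β + 1 - p) - u ^ (β + 1 - p))` has integral zero.

No Sobolev embedding is used. The term `f u ^ (-α)` has a favourable sign at every stage, and its
integrability against test functions is part of the notion of solution.
-/

namespace FracOrlicz

/-! ### Pointwise inequalities -/

/-- The perspective `(a, w) ↦ a ^ p / w ^ (p - 1)` of the power function, which is `1`-homogeneous
and convex on the quadrant; division by zero makes it `0` at `w = 0`, `p ≠ 1`. -/
noncomputable def persp (p a w : ℝ) : ℝ := a ^ p / w ^ (p - 1)

/-- The odd extension `t ↦ g(|t|) t / |t|` of `g`; division by zero makes it `0` at `t = 0`. -/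
noncomputable def flux (g : ℝ → ℝ) (t : ℝ) : ℝ := g |t| * (t / |t|)

section Persp

variable {p : ℝ}

lemma persp_nonneg {a w : ℝ} (ha : 0 ≤ a) (hw : 0 ≤ w) : 0 ≤ persp p a w := by
  unfold persp; positivity

lemma persp_zero_left (hp : 1 < p) (w : ℝ) : persp p 0 w = 0 := by
  unfold persp; rw [Real.zero_rpow (by linarith)]; simp

lemma persp_zero_right (hp : 1 < p) (a : ℝ) : persp p a 0 = 0 := by
  unfold persp; rw [Real.zero_rpow (by linarith)]; simp

lemma persp_self (hp : 1 < p) {a : ℝ} (ha : 0 ≤ a) : persp p a a = a := by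
  rcases ha.eq_or_lt with rfl | ha
  · exact persp_zero_left hp 0
  unfold persp
  rw [← Real.rpow_sub ha]; simp

/-- The supporting planes of the convex function `persp p`. -/
lemma tangent_le_persp (hp : 1 < p) {c b w : ℝ} (hc : 0 ≤ c) (hb : 0 ≤ b) (hw : 0 ≤ w)
    (h0 : w = 0 → b = 0) : p * c ^ (p - 1) * b - (p - 1) * c ^ p * w ≤ persp p b w := by
  rcases hw.eq_or_lt with rfl | hw
  · rw [h0 rfl, persp_zero_left hp]; simp
  rcases hc.eq_or_lt with rfl | hc
  · rw [Real.zero_rpow (by linarith), Real.zero_rpow (by linarith)]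
    simpa using persp_nonneg hb hw.le
  have h1 := one_add_mul_self_le_rpow_one_add (s := b / w / c - 1)
    (by have : 0 ≤ b / w / c := by positivity
        linarith) hp.le
  have h2 : (1 + (b / w / c - 1)) ^ p = b ^ p / w ^ p / c ^ p := by
    rw [add_sub_cancel, Real.div_rpow (by positivity) hc.le, Real.div_rpow hb hw.le]
  rw [h2] at h1
  have hwp : w ^ p = w ^ (p - 1) * w := by
    rw [← Real.rpow_add_one hw.ne']; simp
  have hcp : c ^ p = c ^ (p - 1) * c := by
    rw [← Real.rpow_add_one hc.ne']; simp
  have hcw : 0 < c ^ p * w := by positivity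
  have h3 := mul_le_mul_of_nonneg_left h1 hcw.le
  unfold persp
  have e1 : c ^ p * w * (b ^ p / w ^ p / c ^ p) = b ^ p / w ^ (p - 1) := by
    have : c ^ p ≠ 0 := by positivity
    rw [hwp]; field_simp
  have e2 : c ^ p * w * (1 + p * (b / w / c - 1)) =
      p * c ^ (p - 1) * b - (p - 1) * c ^ p * w := by
    rw [hcp]; field_simp; ring
  linarith

/-- Equality in `tangent_le_persp` at the slope `c = a / w`. -/
lemma persp_eq_tangent {a w : ℝ} (ha : 0 ≤ a) (hw : 0 < w) :
    persp p a w = p * (a / w) ^ (p - 1) * a - (p - 1) * (a / w) ^ p * w := by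
  rcases ha.eq_or_lt with rfl | ha
  · by_cases h : p = 0
    · simp [h, persp, hw.le, Real.rpow_neg]
    · simp [persp, Real.zero_rpow h]
  have hwp : w ^ p = w ^ (p - 1) * w := by
    rw [← Real.rpow_add_one hw.ne']; simp
  have hap : a ^ p = a ^ (p - 1) * a := by
    rw [← Real.rpow_add_one ha.ne']; simp
  unfold persp
  rw [Real.div_rpow ha.le hw.le, Real.div_rpow ha.le hw.le, hwp, hap]
  field_simp; ring

lemma persp_sub_le (hp : 1 < p) {a w a' w' : ℝ} (ha : 0 ≤ a) (hw : 0 < w) (ha' : 0 ≤ a')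
    (hw' : 0 ≤ w') (h0 : w' = 0 → a' = 0) :
    persp p a w - persp p a' w' ≤
      p * (a / w) ^ (p - 1) * (a - a') - (p - 1) * (a / w) ^ p * (w - w') := by
  have h1 := tangent_le_persp hp (c := a / w) (by positivity) ha' hw' h0
  rw [persp_eq_tangent ha hw]
  linarith

lemma persp_sub_le_of_le (hp : 1 < p) {a w a' w' : ℝ} (ha : 0 ≤ a) (haw : a ≤ w) (ha' : 0 ≤ a')
    (haw' : a' ≤ w') : persp p a w - persp p a' w' ≤ p * |a - a'| + p * |w - w'| := by
  rcases (ha.trans haw).eq_or_lt with rfl | hw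
  · rw [persp_zero_right hp]
    have := persp_nonneg (p := p) ha' (ha'.trans haw')
    have : 0 ≤ p * |a - a'| + p * |0 - w'| := by positivity
    linarith
  have h1 := persp_sub_le hp ha hw ha' (ha'.trans haw') (fun h => le_antisymm (h ▸ haw') ha')
  have hc0 : 0 ≤ a / w := by positivity
  have hc1 : a / w ≤ 1 := (div_le_one hw).2 haw
  have h2 : (a / w) ^ (p - 1) ≤ 1 := Real.rpow_le_one hc0 hc1 (by linarith)
  have h3 : (a / w) ^ p ≤ 1 := Real.rpow_le_one hc0 hc1 (by linarith)
  have h2' : 0 ≤ (a / w) ^ (p - 1) := by positivity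
  have h3' : 0 ≤ (a / w) ^ p := by positivity
  have h4 : p * (a / w) ^ (p - 1) * (a - a') ≤ p * |a - a'| := by
    rw [mul_assoc]
    refine mul_le_mul_of_nonneg_left ?_ (by linarith)
    calc (a / w) ^ (p - 1) * (a - a') ≤ (a / w) ^ (p - 1) * |a - a'| :=
          mul_le_mul_of_nonneg_left (le_abs_self _) h2'
      _ ≤ 1 * |a - a'| := mul_le_mul_of_nonneg_right h2 (abs_nonneg _)
      _ = _ := one_mul _
  have h5 : -((p - 1) * (a / w) ^ p * (w - w')) ≤ p * |w - w'| := by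
    have : -((a / w) ^ p * (w - w')) ≤ |w - w'| := by
      calc -((a / w) ^ p * (w - w')) = (a / w) ^ p * (-(w - w')) := by ring
        _ ≤ (a / w) ^ p * |w - w'| := mul_le_mul_of_nonneg_left (neg_le_abs _) h3'
        _ ≤ 1 * |w - w'| := mul_le_mul_of_nonneg_right h3 (abs_nonneg _)
        _ = _ := one_mul _
    nlinarith [abs_nonneg (w - w')]
  linarith

/-- `persp p` is Lipschitz on the cone `a ≤ w`, where the slopes of its supporting planes are
bounded. -/
lemma abs_persp_sub_le (hp : 1 < p) {a w a' w' : ℝ} (ha : 0 ≤ a) (haw : a ≤ w) (ha' : 0 ≤ a')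
    (haw' : a' ≤ w') : |persp p a w - persp p a' w'| ≤ p * |a - a'| + p * |w - w'| := by
  rw [abs_le]
  constructor
  · have := persp_sub_le_of_le hp ha' haw' ha haw
    rw [abs_sub_comm a' a, abs_sub_comm w' w] at this
    linarith
  · exact persp_sub_le_of_le hp ha haw ha' haw'

lemma persp_le_self (hp : 1 < p) {a w : ℝ} (ha : 0 ≤ a) (haw : a ≤ w) : persp p a w ≤ a := by
  rcases ha.eq_or_lt with rfl | ha
  · rw [persp_zero_left hp]
  have hw : 0 < w := ha.trans_le haw
  unfold persp
  rw [div_le_iff₀ (by positivity)]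
  calc a ^ p = a * a ^ (p - 1) := by rw [mul_comm, ← Real.rpow_add_one ha.ne']; simp
    _ ≤ _ := mul_le_mul_of_nonneg_left (Real.rpow_le_rpow ha.le haw (by linarith)) ha.le

/-- Subadditivity of `persp p`, which is the discrete Picone inequality. -/
lemma persp_sub_le_persp (hp : 1 < p) {m a n b : ℝ} (hm : 0 ≤ m) (hn : 0 ≤ n) (hb : 0 ≤ b)
    (hab : b < a) (h0 : b = 0 → n = 0) :
    persp p m a - persp p n b ≤ persp p |m - n| (a - b) := by
  have h1 := persp_sub_le hp hm (hb.trans_lt hab) hn hb h0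
  have h2 := tangent_le_persp hp (c := m / a) (b := |m - n|) (w := a - b)
    (div_nonneg hm (hb.trans hab.le)) (abs_nonneg _) (by linarith) (fun h => by linarith)
  have h3 : p * (m / a) ^ (p - 1) * (m - n) ≤ p * (m / a) ^ (p - 1) * |m - n| := by
    have := div_nonneg hm (hb.trans hab.le)
    exact mul_le_mul_of_nonneg_left (le_abs_self _) (by positivity)
  linarith

end Persp

/-- The growth condition under which the pointwise inequalities hold: `g` is nonnegative and
nondecreasing on `[0, ∞)`, and `t ↦ g(t) / t ^ (p - 1)` is nondecreasing. -/
structure IsPowerMono (p : ℝ) (g : ℝ → ℝ) : Prop where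
  nonneg : ∀ t, 0 ≤ t → 0 ≤ g t
  mono : ∀ t t', 0 ≤ t → t ≤ t' → g t ≤ g t'
  scale : ∀ l t, 0 ≤ l → l ≤ 1 → 0 ≤ t → g (l * t) ≤ l ^ (p - 1) * g t

section Pointwise

variable {p : ℝ} {g : ℝ → ℝ}

lemma flux_zero : flux g 0 = 0 := by simp [flux]

lemma flux_of_pos {t : ℝ} (ht : 0 < t) : flux g t = g t := by
  simp [flux, abs_of_pos ht, ht.ne']

lemma flux_neg (t : ℝ) : flux g (-t) = -flux g t := by
  simp [flux, neg_div]

lemma abs_flux_le (hg : IsPowerMono p g) (t : ℝ) : |flux g t| ≤ g |t| := by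
  unfold flux
  rw [abs_mul, abs_of_nonneg (hg.nonneg _ (abs_nonneg t)), abs_div, abs_abs]
  exact mul_le_of_le_one_right (hg.nonneg _ (abs_nonneg t)) (div_self_le_one _)

/-- Picone's inequality for the flux of `g`: the flux of `a` tested with `m ^ p / a ^ (p - 1)` is at
most the `p`-energy of `m` with the weight `g(t) / t ^ (p - 1)` at `t = |a - b|`. -/
lemma flux_mul_persp_sub_le (hp : 1 < p) (hg : IsPowerMono p g) {m a n b : ℝ} (hm : 0 ≤ m)
    (hn : 0 ≤ n) (ha : 0 ≤ a) (hb : 0 ≤ b) (ha0 : a = 0 → m = 0) (hb0 : b = 0 → n = 0) :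
    flux g (a - b) * (persp p m a - persp p n b) ≤ g |a - b| * persp p |m - n| |a - b| := by
  rcases lt_trichotomy a b with h | rfl | h
  · have h1 := persp_sub_le_persp hp hn hm ha h ha0
    rw [abs_sub_comm a b, abs_sub_comm m n, ← neg_sub b a, flux_neg, flux_of_pos (by linarith),
      abs_of_pos (show 0 < b - a by linarith)]
    have := mul_le_mul_of_nonneg_left h1 (hg.nonneg (b - a) (by linarith))
    linarith
  · simp [flux_zero, persp_zero_right hp]
  · have h1 := persp_sub_le_persp hp hm hn hb h hb0
    rw [flux_of_pos (by linarith), abs_of_pos (show 0 < a - b by linarith)]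
    exact mul_le_mul_of_nonneg_left h1 (hg.nonneg (a - b) (by linarith))

lemma IsPowerMono.div_mono (hg : IsPowerMono p g) {s t : ℝ} (hs : 0 < s) (hst : s ≤ t) :
    g s / s ^ (p - 1) ≤ g t / t ^ (p - 1) := by
  have ht := hs.trans_le hst
  have h1 := hg.scale (s / t) t (by positivity) ((div_le_one ht).2 hst) ht.le
  rw [div_mul_cancel₀ _ ht.ne', Real.div_rpow hs.le ht.le] at h1
  rw [div_le_iff₀ (by positivity)]
  calc g s ≤ _ := h1
    _ = _ := by ring

/-- The two energies dominate the two cross terms in the inequality of Díaz and Saá. This is a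
Chebyshev inequality: `t ↦ g(t) / t ^ (p - 1)` and `t ↦ t ^ p` increase together. -/
lemma cross_energy_le (hp : 1 < p) (hg : IsPowerMono p g) {s t : ℝ} (hs : 0 ≤ s) (ht : 0 ≤ t) :
    g s * persp p t s + g t * persp p s t ≤ g s * s + g t * t := by
  have aux : ∀ s t : ℝ, 0 ≤ s → 0 ≤ t → s ≤ t →
      g s * persp p t s + g t * persp p s t ≤ g s * s + g t * t := by
    intro s t hs ht hst
    rcases hs.eq_or_lt with rfl | hs
    · rw [persp_zero_right hp, persp_zero_left hp]
      have := mul_nonneg (hg.nonneg t ht) ht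
      linarith
    have ht := hs.trans_le hst
    have h1 := hg.div_mono hs hst
    have h2 : s ^ p ≤ t ^ p := Real.rpow_le_rpow hs.le hst (by linarith)
    have e1 : ∀ x : ℝ, 0 < x → g x / x ^ (p - 1) * x ^ p = g x * x := by
      intro x hx
      have : x ^ p = x ^ (p - 1) * x := by rw [← Real.rpow_add_one hx.ne']; simp
      rw [this]; field_simp
    have h3 : 0 ≤ (g t / t ^ (p - 1) - g s / s ^ (p - 1)) * (t ^ p - s ^ p) :=
      mul_nonneg (by linarith) (by linarith)
    have e2 := e1 s hs
    have e3 := e1 t ht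
    have e4 : g s * persp p t s = g s / s ^ (p - 1) * t ^ p := by unfold persp; ring
    have e5 : g t * persp p s t = g t / t ^ (p - 1) * s ^ p := by unfold persp; ring
    rw [e4, e5]
    nlinarith
  rcases le_total s t with h | h
  · exact aux s t hs ht h
  · have := aux t s ht hs h
    linarith

/-- The positive part of `m ^ p - v ^ p`. -/
noncomputable def excess (p m v : ℝ) : ℝ := max (m ^ p - v ^ p) 0

lemma excess_nonneg (m v : ℝ) : 0 ≤ excess p m v := le_max_right _ _

lemma excess_eq_zero (hp : 1 < p) {m v : ℝ} (hm : 0 ≤ m) (h : m ≤ v) : excess p m v = 0 := by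
  unfold excess
  rw [max_eq_right]
  have := Real.rpow_le_rpow hm h (z := p) (by linarith)
  linarith

lemma excess_of_le (hp : 1 < p) {m v : ℝ} (hv : 0 ≤ v) (h : v ≤ m) :
    excess p m v = m ^ p - v ^ p := by
  unfold excess
  rw [max_eq_left]
  have := Real.rpow_le_rpow hv h (z := p) (by linarith)
  linarith

lemma excess_div_left (hp : 1 < p) {m v : ℝ} (w : ℝ) (hm : 0 ≤ m) (hv : 0 ≤ v) :
    excess p m v / w ^ (p - 1) = persp p m w - persp p (min v m) w := by
  rcases le_total v m with h | h
  · rw [excess_of_le hp hv h, min_eq_left h]; unfold persp; ring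
  · rw [excess_eq_zero hp hm h, min_eq_right h]; simp

lemma excess_div_right (hp : 1 < p) {m v : ℝ} (hv : 0 ≤ v) :
    excess p m v / v ^ (p - 1) = max (persp p m v - v) 0 := by
  have h : max (m ^ p - v ^ p) 0 / v ^ (p - 1) =
      max ((m ^ p - v ^ p) / v ^ (p - 1)) (0 / v ^ (p - 1)) :=
    (monotone_div_right_of_nonneg (by positivity)).map_max
  unfold excess
  rw [h, zero_div, sub_div]
  congr 2
  exact persp_self hp hv

/-- The first test function is a Lipschitz function of `w`, `m`, `v`, although it is a quotient,
since `m ≤ w`. -/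
lemma abs_excess_div_sub_le (hp : 1 < p) {w m v w' m' v' : ℝ} (hm : 0 ≤ m) (hmw : m ≤ w)
    (hv : 0 ≤ v) (hm' : 0 ≤ m') (hmw' : m' ≤ w') (hv' : 0 ≤ v') :
    |excess p m v / w ^ (p - 1) - excess p m' v' / w' ^ (p - 1)| ≤
      2 * p * (|m - m'| + |w - w'| + |v - v'|) := by
  rw [excess_div_left hp w hm hv, excess_div_left hp w' hm' hv']
  have h1 := abs_persp_sub_le hp hm hmw hm' hmw'
  have h2 := abs_persp_sub_le hp (le_min hv hm) ((min_le_right _ _).trans hmw)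
    (le_min hv' hm') ((min_le_right _ _).trans hmw')
  have h3 : |min v m - min v' m'| ≤ |v - v'| + |m - m'| :=
    (abs_min_sub_min_le_max v m v' m').trans (max_le_add_of_nonneg (abs_nonneg _) (abs_nonneg _))
  have h4 : |persp p m w - persp p (min v m) w - (persp p m' w' - persp p (min v' m') w')| ≤
      |persp p m w - persp p m' w'| + |persp p (min v m) w - persp p (min v' m') w'| := by
    rw [show persp p m w - persp p (min v m) w - (persp p m' w' - persp p (min v' m') w') =
      (persp p m w - persp p m' w') - (persp p (min v m) w - persp p (min v' m') w') by ring]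
    exact abs_sub _ _
  nlinarith [abs_nonneg (v - v'), abs_nonneg (m - m'), abs_nonneg (w - w')]

/-- The integrand of the difference of the weak forms of `w` and `v`, tested with
`(m ^ p - v ^ p)⁺ / w ^ (p - 1)` and `(m ^ p - v ^ p)⁺ / v ^ (p - 1)` respectively. -/
noncomputable def testedFlux (p : ℝ) (g : ℝ → ℝ) (w m v w' m' v' : ℝ) : ℝ :=
  flux g (w - w') * (excess p m v / w ^ (p - 1) - excess p m' v' / w' ^ (p - 1)) -
    flux g (v - v') * (excess p m v / v ^ (p - 1) - excess p m' v' / v' ^ (p - 1))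

lemma testedFlux_comm (w m v w' m' v' : ℝ) :
    testedFlux p g w m v w' m' v' = testedFlux p g w' m' v' w m v := by
  unfold testedFlux
  rw [← neg_sub w' w, ← neg_sub v' v, flux_neg, flux_neg]
  ring

/-- The inequality of Díaz and Saá for the flux of `g`, on the set where `w > v` at one of the two
points only. -/
lemma testedFlux_self_nonneg_of_lt_of_le (hp : 1 < p) (hg : IsPowerMono p g) {w v w' v' : ℝ}
    (hv : 0 < v) (hw' : 0 ≤ w') (hv' : 0 ≤ v') (h : v < w) (h' : w' ≤ v') :
    0 ≤ testedFlux p g w w v w' w' v' := by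
  have hw := hv.trans h
  have hD := excess_nonneg (p := p) w v
  unfold testedFlux
  rw [excess_eq_zero hp hw' h']
  simp only [zero_div, sub_zero]
  suffices hA : flux g (v - v') / v ^ (p - 1) ≤ flux g (w - w') / w ^ (p - 1) by
    have := mul_le_mul_of_nonneg_left hA hD
    have e1 : flux g (w - w') * (excess p w v / w ^ (p - 1)) =
      excess p w v * (flux g (w - w') / w ^ (p - 1)) := by ring
    have e2 : flux g (v - v') * (excess p w v / v ^ (p - 1)) =
      excess p w v * (flux g (v - v') / v ^ (p - 1)) := by ring
    rw [e1, e2]; linarith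
  have hwp : 0 < w ^ (p - 1) := by positivity
  have hvp : 0 < v ^ (p - 1) := by positivity
  have hvw : v ^ (p - 1) ≤ w ^ (p - 1) := Real.rpow_le_rpow hv.le h.le (by linarith)
  rcases lt_trichotomy v v' with hvv | rfl | hvv
  · have e1 : flux g (v - v') = - g (v' - v) := by
      rw [← neg_sub, flux_neg, flux_of_pos (by linarith)]
    have hg1 : 0 ≤ g (v' - v) := hg.nonneg _ (by linarith)
    rw [e1, div_le_div_iff₀ hvp hwp]
    rcases lt_trichotomy w w' with hww | rfl | hww
    · rw [← neg_sub w' w, flux_neg, flux_of_pos (by linarith)]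
      have h1 : g (w' - w) ≤ g (v' - v) := hg.mono _ _ (by linarith) (by linarith)
      have h2 : 0 ≤ g (w' - w) := hg.nonneg _ (by linarith)
      nlinarith
    · rw [sub_self, flux_zero]; nlinarith
    · rw [flux_of_pos (by linarith)]
      have h2 : 0 ≤ g (w - w') := hg.nonneg _ (by linarith)
      nlinarith
  · rw [sub_self, flux_zero, zero_div]
    rw [flux_of_pos (by linarith)]
    have h2 : 0 ≤ g (w - w') := hg.nonneg _ (by linarith)
    positivity
  · rw [flux_of_pos (by linarith), flux_of_pos (by linarith)]
    have h1 : g (v - v') ≤ g (v / w * (w - w')) := by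
      refine hg.mono _ _ (by linarith) ?_
      have e : v / w * (w - w') = v - v / w * w' := by field_simp
      have : v / w * w' ≤ 1 * w' :=
        mul_le_mul_of_nonneg_right ((div_le_one hw).2 h.le) hw'
      rw [e]; linarith
    have h2 := hg.scale (v / w) (w - w') (by positivity) ((div_le_one hw).2 h.le) (by linarith)
    rw [Real.div_rpow hv.le hw.le] at h2
    rw [div_le_iff₀ hvp]
    calc g (v - v') ≤ _ := h1.trans h2
      _ = _ := by ring

/-- The inequality of Díaz and Saá for the flux of `g`. -/
lemma testedFlux_self_nonneg (hp : 1 < p) (hg : IsPowerMono p g) {w v w' v' : ℝ} (hw : 0 ≤ w)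
    (hv : 0 ≤ v) (h0 : v = 0 → w = 0) (hw' : 0 ≤ w') (hv' : 0 ≤ v') (h0' : v' = 0 → w' = 0) :
    0 ≤ testedFlux p g w w v w' w' v' := by
  rcases lt_or_ge v w with h | h
  · have hv1 : 0 < v := hv.lt_of_ne (fun e => by linarith [h0 e.symm])
    rcases lt_or_ge v' w' with h' | h'
    · have hv1' : 0 < v' := hv'.lt_of_ne (fun e => by linarith [h0' e.symm])
      unfold testedFlux
      rw [excess_div_left hp w hw hv, excess_div_left hp w' hw' hv', excess_div_right hp hv,
        excess_div_right hp hv', min_eq_left h.le, min_eq_left h'.le, persp_self hp hw,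
        persp_self hp hw']
      have key : ∀ a b : ℝ, 0 < b → b < a → b ≤ persp p a b := by
        intro a b hb hab
        unfold persp
        rw [le_div_iff₀ (by positivity)]
        calc b * b ^ (p - 1) = b ^ p := by
              rw [mul_comm, ← Real.rpow_add_one hb.ne']; simp
          _ ≤ a ^ p := Real.rpow_le_rpow hb.le hab.le (by linarith)
      rw [max_eq_left (sub_nonneg.2 (key w v hv1 h)), max_eq_left (sub_nonneg.2 (key w' v' hv1' h'))]
      have h1 := flux_mul_persp_sub_le hp hg hv hv' hw hw' (fun e => by linarith)
        (fun e => by linarith)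
      have h2 := flux_mul_persp_sub_le hp hg hw hw' hv hv' h0 h0'
      have h3 := cross_energy_le hp hg (abs_nonneg (w - w')) (abs_nonneg (v - v'))
      have h4 : ∀ t : ℝ, flux g t * t = g |t| * |t| := by
        intro t
        unfold flux
        rcases eq_or_ne t 0 with rfl | ht
        · simp
        have : |t| ≠ 0 := abs_ne_zero.2 ht
        rw [mul_assoc]; congr 1
        field_simp
        rw [sq_abs]
      have h5 := h4 (w - w')
      have h6 := h4 (v - v')
      linarith
    · exact testedFlux_self_nonneg_of_lt_of_le hp hg hv1 hw' hv' h h'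
  · rcases lt_or_ge v' w' with h' | h'
    · have hv1' : 0 < v' := hv'.lt_of_ne (fun e => by linarith [h0' e.symm])
      rw [testedFlux_comm]
      exact testedFlux_self_nonneg_of_lt_of_le hp hg hv1' hw hv h' h
    · unfold testedFlux
      rw [excess_eq_zero hp hw h, excess_eq_zero hp hw' h']
      simp

/-- The part of the weak form of `v` with the larger oscillation of `v`: there the second test
function decreases in `v` fast enough to absorb the flux of `w`. -/
lemma testedFlux_nonneg_of_oscillation (hp : 2 ≤ p) (hg : IsPowerMono p g)
    {w m v w' m' v' : ℝ} (hm : 0 ≤ m) (hmw : m ≤ w) (hv : 0 ≤ v)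
    (hm' : 0 ≤ m') (hmw' : m' ≤ w') (hv' : 0 ≤ v') (h0' : v' = 0 → m' = 0)
    (h : 4 * p * (|w - w'| + |m - m'|) < v - v') :
    0 ≤ testedFlux p g w m v w' m' v' := by
  have hp1 : 1 < p := by linarith
  set A := |w - w'| + |m - m'| with hA
  have hA0 : 0 ≤ A := by positivity
  have hmA : |m - m'| ≤ A := by rw [hA]; linarith [abs_nonneg (w - w')]
  have hwA : |w - w'| ≤ A := by rw [hA]; linarith [abs_nonneg (m - m')]
  have hAv : 8 * A ≤ v - v' := by nlinarith
  have hvv : 0 < v - v' := by nlinarith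
  have hgv : 0 ≤ g (v - v') := hg.nonneg _ hvv.le
  have hfw := abs_flux_le hg (w - w')
  have hgw : g |w - w'| ≤ g (v - v') := hg.mono _ _ (abs_nonneg _) (by linarith)
  rcases lt_or_ge v m with hvm | hvm
  · -- The test functions are positive at both points. The second one equals `persp p m v - v`, and
    -- its first term decreases in `v` faster than the change of `m` can increase it.
    have hv1 : 0 < v := by linarith
    have hvm' : v' < m' := by linarith [le_abs_self (m - m')]
    have hv1' : 0 < v' := hv'.lt_of_ne (fun e => by linarith [h0' e.symm])
    have key : excess p m v / v ^ (p - 1) - excess p m' v' / v' ^ (p - 1) ≤ -(v - v') := by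
      have e : ∀ m v : ℝ, 0 < v → v < m →
          excess p m v / v ^ (p - 1) = persp p m v - v := by
        intro m v hv h
        rw [excess_of_le hp1 hv.le h.le, sub_div]
        congr 1
        exact persp_self hp1 hv.le
      rw [e m v hv1 hvm, e m' v' hv1' hvm']
      have h1 := persp_sub_le hp1 hm hv1 hm' hv' h0'
      set c := m / v with hc
      have hc1 : 1 ≤ c := (one_le_div hv1).2 hvm.le
      have hcp : c ^ p = c ^ (p - 1) * c := by
        rw [← Real.rpow_add_one (by linarith)]; simp
      have h2 : p * c ^ (p - 1) * (m - m') - (p - 1) * c ^ p * (v - v') ≤ 0 := by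
        have h3 : p * (m - m') - (p - 1) * c * (v - v') ≤ 0 := by
          have : m - m' ≤ A := (le_abs_self _).trans hmA
          have : (v - v') ≤ c * (v - v') := by nlinarith
          nlinarith
        have : 0 ≤ c ^ (p - 1) := by positivity
        rw [hcp]
        nlinarith
      linarith
    have h1 := abs_excess_div_sub_le hp1 hm hmw hv hm' hmw' hv'
    rw [abs_of_pos hvv] at h1
    unfold testedFlux
    rw [flux_of_pos hvv]
    -- The factor `1 / (4 p)` compensates for the Lipschitz constant `2 p` of the first test
    -- function; `p ≥ 2` is used here.
    have h2 : 4 * p * g |w - w'| ≤ g (v - v') := by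
      have h3 := hg.scale (1 / (4 * p)) (v - v') (by positivity)
        (by rw [div_le_one (by positivity)]; linarith) hvv.le
      have h4 : (1 / (4 * p)) ^ (p - 1) ≤ 1 / (4 * p) := by
        have := Real.rpow_le_rpow_of_exponent_ge (x := 1 / (4 * p)) (by positivity)
          (by rw [div_le_one (by positivity)]; linarith) (show (1 : ℝ) ≤ p - 1 by linarith)
        rwa [Real.rpow_one] at this
      have h5 : g |w - w'| ≤ g (1 / (4 * p) * (v - v')) := by
        refine hg.mono _ _ (abs_nonneg _) (hwA.trans ?_)
        rw [one_div, ← div_eq_inv_mul, le_div_iff₀ (by positivity)]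
        linarith
      have h6 : g |w - w'| ≤ 1 / (4 * p) * g (v - v') :=
        h5.trans (h3.trans (mul_le_mul_of_nonneg_right h4 hgv))
      calc 4 * p * g |w - w'| ≤ 4 * p * (1 / (4 * p) * g (v - v')) :=
            mul_le_mul_of_nonneg_left h6 (by positivity)
        _ = _ := by field_simp
    have h7 : -(flux g (w - w') *
        (excess p m v / w ^ (p - 1) - excess p m' v' / w' ^ (p - 1))) ≤
        g |w - w'| * (2 * p * (A + (v - v'))) := by
      refine (neg_le_abs _).trans ?_
      rw [abs_mul]
      refine mul_le_mul hfw (h1.trans (le_of_eq ?_)) (abs_nonneg _) (hg.nonneg _ (abs_nonneg _))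
      rw [hA]; ring
    have h8 : g |w - w'| * (2 * p * (A + (v - v'))) ≤ g (v - v') * (v - v') := by
      have : 0 ≤ g |w - w'| := hg.nonneg _ (abs_nonneg _)
      calc g |w - w'| * (2 * p * (A + (v - v'))) =
          (4 * p * g |w - w'|) * ((A + (v - v')) / 2) := by ring
        _ ≤ g (v - v') * ((A + (v - v')) / 2) :=
          mul_le_mul_of_nonneg_right h2 (by linarith)
        _ ≤ _ := mul_le_mul_of_nonneg_left (by linarith) hgv
    have h9 := mul_le_mul_of_nonneg_left key hgv
    linarith
  · rcases lt_or_ge v' m' with hvm' | hvm'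
    · -- Both test functions vanish at the first point, so only the sizes of the fluxes matter.
      have hv1' : 0 < v' := hv'.lt_of_ne (fun e => by linarith [h0' e.symm])
      have hD := excess_nonneg (p := p) m' v'
      unfold testedFlux
      rw [excess_eq_zero hp1 hm hvm, flux_of_pos hvv]
      simp only [zero_div, zero_sub, mul_neg, neg_sub_neg, sub_nonneg]
      have h1 : excess p m' v' / w' ^ (p - 1) ≤ excess p m' v' / v' ^ (p - 1) :=
        div_le_div_of_nonneg_left hD (by positivity)
          (Real.rpow_le_rpow hv' (by linarith) (by linarith))
      have hw1' : 0 < w' := by linarith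
      exact mul_le_mul ((le_abs_self _).trans (hfw.trans hgw)) h1 (by positivity) hgv
    · unfold testedFlux
      rw [excess_eq_zero hp1 hm hvm, excess_eq_zero hp1 hm' hvm']
      simp

/-- The tested difference of the fluxes of `w` and `v` is bounded below by the energies of `w`
and `m`, independently of `v`. This is what makes truncations and cut-offs of `w` harmless, as the
energy of `v` need not be finite near the boundary. -/
lemma neg_le_testedFlux (hp : 2 ≤ p) (hg : IsPowerMono p g)
    {w m v w' m' v' : ℝ} (hm : 0 ≤ m) (hmw : m ≤ w) (hv : 0 ≤ v) (h0 : v = 0 → m = 0)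
    (hm' : 0 ≤ m') (hmw' : m' ≤ w') (hv' : 0 ≤ v') (h0' : v' = 0 → m' = 0) :
    -(20 * p ^ (2 : ℕ) * (g (4 * p * (|w - w'| + |m - m'|)) * (|w - w'| + |m - m'|))) ≤
      testedFlux p g w m v w' m' v' := by
  have hp1 : 1 < p := by linarith
  set A := |w - w'| + |m - m'| with hA
  have hA0 : 0 ≤ A := by positivity
  have hgA : 0 ≤ g (4 * p * A) := hg.nonneg _ (by positivity)
  have hgAA : 0 ≤ 20 * p ^ (2 : ℕ) * (g (4 * p * A) * A) := by positivity
  -- A large oscillation of `v` has the right sign; for a small one Picone's inequality bounds the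
  -- flux of `v` from one side, which needs no lower bound on `v`.
  rcases lt_or_ge (4 * p * A) |v - v'| with h | h
  · rcases lt_abs.1 h with h | h
    · have := testedFlux_nonneg_of_oscillation hp hg hm hmw hv hm' hmw' hv' h0' h
      linarith
    · have := testedFlux_nonneg_of_oscillation hp hg hm' hmw' hv' hm hmw hv h0
        (by rw [abs_sub_comm w' w, abs_sub_comm m' m]; linarith)
      rw [testedFlux_comm] at this
      linarith
  · have h1 := abs_excess_div_sub_le hp1 hm hmw hv hm' hmw' hv'
    have h2 : -(flux g (w - w') *
        (excess p m v / w ^ (p - 1) - excess p m' v' / w' ^ (p - 1))) ≤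
        g (4 * p * A) * (2 * p * (A + 4 * p * A)) := by
      refine (neg_le_abs _).trans ?_
      rw [abs_mul]
      refine mul_le_mul ((abs_flux_le hg _).trans (hg.mono _ _ (abs_nonneg _) ?_))
        (h1.trans ?_) (abs_nonneg _) hgA
      · have : |w - w'| ≤ A := by rw [hA]; linarith [abs_nonneg (m - m')]
        nlinarith
      · refine mul_le_mul_of_nonneg_left ?_ (by linarith)
        rw [hA] at h ⊢; linarith
    have h3 : flux g (v - v') *
        (excess p m v / v ^ (p - 1) - excess p m' v' / v' ^ (p - 1)) ≤ g (4 * p * A) * A := by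
      have hq : flux g (v - v') *
          (excess p m v / v ^ (p - 1) - excess p m' v' / v' ^ (p - 1)) ≤
          g |v - v'| * persp p |m - m'| |v - v'| := by
        have aux : ∀ m v m' v' : ℝ, 0 ≤ m → 0 ≤ v → (v = 0 → m = 0) → 0 ≤ m' → 0 ≤ v' →
            (v' = 0 → m' = 0) → v' < v → flux g (v - v') *
            (excess p m v / v ^ (p - 1) - excess p m' v' / v' ^ (p - 1)) ≤
            g |v - v'| * persp p |m - m'| |v - v'| := by
          intro m v m' v' hm hv h0 hm' hv' h0' hlt
          rw [flux_of_pos (by linarith), abs_of_pos (show 0 < v - v' by linarith)]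
          refine mul_le_mul_of_nonneg_left ?_ (hg.nonneg _ (by linarith))
          have h1 := persp_sub_le_persp hp1 hm hm' hv' hlt h0'
          have h2 := persp_nonneg (p := p) (abs_nonneg (m - m')) (show 0 ≤ v - v' by linarith)
          rw [excess_div_right hp1 hv, excess_div_right hp1 hv', sub_le_iff_le_add]
          refine max_le ?_ ?_
          · have := le_max_left (persp p m' v' - v') 0
            linarith
          · have := le_max_right (persp p m' v' - v') 0
            linarith
        rcases lt_trichotomy v v' with hlt | rfl | hlt
        · have := aux m' v' m v hm' hv' h0' hm hv h0 hlt
          rw [abs_sub_comm v' v, abs_sub_comm m' m, ← neg_sub v v', flux_neg] at this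
          linarith
        · simp [flux_zero, persp_zero_right hp1]
        · exact aux m v m' v' hm hv h0 hm' hv' h0' hlt
      refine hq.trans ?_
      rcases (abs_nonneg (v - v')).eq_or_lt with h0 | hpos
      · rw [← h0, persp_zero_right hp1, mul_zero]; positivity
      have hApos : 0 < A := by
        by_contra hcon
        have : A = 0 := le_antisymm (not_lt.1 hcon) hA0
        rw [this] at h; linarith
      have h4 := hg.div_mono hpos h
      have hmA : |m - m'| ≤ A := by rw [hA]; linarith [abs_nonneg (w - w')]
      have h5 : |m - m'| ^ p ≤ A ^ p := Real.rpow_le_rpow (abs_nonneg _) hmA (by linarith)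
      have h6 : A ^ p = A ^ (p - 1) * A := by rw [← Real.rpow_add_one hApos.ne']; simp
      have h7 : A ^ (p - 1) ≤ (4 * p * A) ^ (p - 1) :=
        Real.rpow_le_rpow hA0 (by nlinarith) (by linarith)
      calc g |v - v'| * persp p |m - m'| |v - v'|
          = g |v - v'| / |v - v'| ^ (p - 1) * |m - m'| ^ p := by unfold persp; ring
        _ ≤ g (4 * p * A) / (4 * p * A) ^ (p - 1) * A ^ p :=
          mul_le_mul h4 h5 (by positivity) (by positivity)
        _ = g (4 * p * A) * A * (A ^ (p - 1) / (4 * p * A) ^ (p - 1)) := by rw [h6]; ring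
        _ ≤ g (4 * p * A) * A * 1 := by
          refine mul_le_mul_of_nonneg_left ?_ (by positivity)
          exact (div_le_one (by positivity)).2 h7
        _ = _ := mul_one _
    have h8 : g (4 * p * A) * (2 * p * (A + 4 * p * A)) + g (4 * p * A) * A ≤
        20 * p ^ (2 : ℕ) * (g (4 * p * A) * A) := by
      have h9 : 0 ≤ g (4 * p * A) * A := by positivity
      have h10 : 2 * p * (1 + 4 * p) + 1 ≤ 20 * p ^ (2 : ℕ) := by nlinarith
      nlinarith [mul_le_mul_of_nonneg_right h10 h9]
    unfold testedFlux
    linarith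

/-- Replacing `u` by `(u - ε)⁺` decreases the tested flux when the test function vanishes where
`u ≤ ε`. -/
lemma flux_posPart_mul_le (hg : IsPowerMono p g) {u u' φ φ' e : ℝ} (hu : 0 ≤ u)
    (hu' : 0 ≤ u') (hφ : 0 ≤ φ) (hφ' : 0 ≤ φ') (h : u ≤ e → φ = 0) (h' : u' ≤ e → φ' = 0) :
    flux g (max (u - e) 0 - max (u' - e) 0) * (φ - φ') ≤ flux g (u - u') * (φ - φ') := by
  have aux : ∀ u u' φ : ℝ, 0 ≤ u' → 0 ≤ φ → e < u → u' ≤ e →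
      flux g (max (u - e) 0 - max (u' - e) 0) * φ ≤ flux g (u - u') * φ := by
    intro u u' φ hu' hφ h1 h2
    rw [max_eq_left (by linarith), max_eq_right (show u' - e ≤ 0 by linarith), sub_zero,
      flux_of_pos (by linarith), flux_of_pos (by linarith)]
    exact mul_le_mul_of_nonneg_right (hg.mono _ _ (by linarith) (by linarith)) hφ
  rcases le_or_gt u e with h1 | h1
  · rcases le_or_gt u' e with h2 | h2
    · simp [h h1, h' h2]
    · have := aux u' u φ' hu hφ' h2 h1
      rw [h h1, ← neg_sub u' u, ← neg_sub (max (u' - e) 0), flux_neg, flux_neg]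
      linarith
  · rcases le_or_gt u' e with h2 | h2
    · have := aux u u' φ hu' hφ h1 h2
      rwa [h' h2, sub_zero]
    · rw [max_eq_left (by linarith), max_eq_left (show 0 ≤ u' - e by linarith)]
      rw [show u - e - (u' - e) = u - u' by ring]

end Pointwise

/-! ### Growth of the density and of the `N`-function -/

section Growth

variable {N : ℕ} {s : ℝ} {G g : ℝ → ℝ} {pm pp : ℝ}

lemma IsDensity.pos (hg : IsDensity G g) {t : ℝ} (ht : 0 < t) : 0 < g t :=
  (hg.nonneg t ht.le).lt_of_ne fun h => ht.ne' ((hg.eq_zero_iff t ht.le).1 h.symm)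

lemma IsDensity.apply_zero (hg : IsDensity G g) : g 0 = 0 := (hg.eq_zero_iff 0 le_rfl).2 rfl

lemma IsDensity.hasDerivAt (hg : IsDensity G g) {t : ℝ} (ht : 0 < t) :
    HasDerivAt g (deriv g t) t :=
  ((hg.contDiffOn.differentiableOn one_ne_zero).differentiableAt (Ici_mem_nhds ht)).hasDerivAt

lemma IsDensity.hasDerivAt_log_sub (hg : IsDensity G g) (q : ℝ) {t : ℝ} (ht : 0 < t) :
    HasDerivAt (fun x => Real.log (g x) - q * Real.log x) (deriv g t / g t - q * t⁻¹) t :=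
  ((hg.hasDerivAt ht).log (hg.pos ht).ne').sub ((Real.hasDerivAt_log ht.ne').const_mul q)

/-- The lower index bound says that `log g - (pm - 1) log` is nondecreasing. -/
lemma IsDensity.mul_le_of_index_lower (hg : IsDensity G g)
    (hH : StructuralConditions N s G g pm pp) {l t : ℝ} (hl : 0 ≤ l) (hl1 : l ≤ 1) (ht : 0 ≤ t) :
    g (l * t) ≤ l ^ (pm - 1) * g t := by
  have h1 := hH.one_lt
  rcases hl.eq_or_lt with rfl | hl
  · rw [zero_mul, hg.apply_zero, Real.zero_rpow (by linarith), zero_mul]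
  rcases ht.eq_or_lt with rfl | ht
  · rw [mul_zero, hg.apply_zero, mul_zero]
  have hmono : MonotoneOn (fun x => Real.log (g x) - (pm - 1) * Real.log x) (Ioi 0) := by
    refine monotoneOn_of_deriv_nonneg (convex_Ioi 0)
      (fun x hx => (hg.hasDerivAt_log_sub _ hx).continuousAt.continuousWithinAt) ?_ ?_
    · rw [interior_Ioi]
      exact fun x hx => (hg.hasDerivAt_log_sub _ hx).differentiableAt.differentiableWithinAt
    · rw [interior_Ioi]
      intro x hx
      rw [(hg.hasDerivAt_log_sub _ hx).deriv]
      have h2 := hH.index_lower x hx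
      have h3 := hg.pos hx
      have hx' : 0 < x := hx
      have h4 : (pm - 1) * x⁻¹ ≤ x * deriv g x / g x * x⁻¹ :=
        mul_le_mul_of_nonneg_right h2 (by positivity)
      have h5 : x * deriv g x / g x * x⁻¹ = deriv g x / g x := by field_simp
      linarith
  have hlt : 0 < l * t := by positivity
  have h2 := hmono (mem_Ioi.2 hlt) (mem_Ioi.2 ht) (by nlinarith)
  have h3 : g (l * t) = Real.exp (Real.log (g (l * t))) := (Real.exp_log (hg.pos hlt)).symm
  rw [h3]
  simp only [Real.log_mul hl.ne' ht.ne'] at h2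
  calc Real.exp (Real.log (g (l * t))) ≤ Real.exp ((pm - 1) * Real.log l + Real.log (g t)) :=
        Real.exp_le_exp.2 (by linarith)
    _ = _ := by rw [Real.exp_add, Real.exp_log (hg.pos ht), Real.rpow_def_of_pos hl, mul_comm (pm - 1)]

lemma IsDensity.mul_le_of_index_upper (hg : IsDensity G g)
    (hH : StructuralConditions N s G g pm pp) {l t : ℝ} (hl1 : 1 ≤ l) (ht : 0 ≤ t) :
    g (l * t) ≤ l ^ (pp - 1) * g t := by
  have hl : 0 < l := by linarith
  rcases ht.eq_or_lt with rfl | ht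
  · rw [mul_zero, hg.apply_zero, mul_zero]
  have hmono : AntitoneOn (fun x => Real.log (g x) - (pp - 1) * Real.log x) (Ioi 0) := by
    refine antitoneOn_of_deriv_nonpos (convex_Ioi 0)
      (fun x hx => (hg.hasDerivAt_log_sub _ hx).continuousAt.continuousWithinAt) ?_ ?_
    · rw [interior_Ioi]
      exact fun x hx => (hg.hasDerivAt_log_sub _ hx).differentiableAt.differentiableWithinAt
    · rw [interior_Ioi]
      intro x hx
      rw [(hg.hasDerivAt_log_sub _ hx).deriv]
      have h2 := hH.index_upper x hx
      have h3 := hg.pos hx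
      have hx' : 0 < x := hx
      have h4 : x * deriv g x / g x * x⁻¹ ≤ (pp - 1) * x⁻¹ :=
        mul_le_mul_of_nonneg_right h2 (by positivity)
      have h5 : x * deriv g x / g x * x⁻¹ = deriv g x / g x := by field_simp
      linarith
  have hlt : 0 < l * t := by positivity
  have h2 := hmono (mem_Ioi.2 ht) (mem_Ioi.2 hlt) (by nlinarith)
  rw [← Real.exp_log (hg.pos hlt)]
  simp only [Real.log_mul hl.ne' ht.ne'] at h2
  calc Real.exp (Real.log (g (l * t))) ≤ Real.exp ((pp - 1) * Real.log l + Real.log (g t)) :=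
        Real.exp_le_exp.2 (by linarith)
    _ = _ := by rw [Real.exp_add, Real.exp_log (hg.pos ht), Real.rpow_def_of_pos hl, mul_comm (pp - 1)]

/-- The pointwise inequalities are applied with the weight `g(· / ρ)`, `ρ = |x - y| ^ s`. The value
`ρ = 0` is admitted, and makes the weight constant. -/
lemma IsDensity.isPowerMono (hg : IsDensity G g) (hH : StructuralConditions N s G g pm pp)
    {ρ : ℝ} (hρ : 0 ≤ ρ) : IsPowerMono pm (fun t => g (t / ρ)) where
  nonneg t ht := hg.nonneg _ (by positivity)
  mono t t' ht htt := hg.monotoneOn (mem_Ici.2 (by positivity))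
    (mem_Ici.2 (div_nonneg (ht.trans htt) hρ)) (by gcongr)
  scale l t hl hl1 ht := by
    rw [mul_div_assoc]
    exact hg.mul_le_of_index_lower hH hl hl1 (by positivity)

lemma IsDensity.intervalIntegrable (hg : IsDensity G g) {a b : ℝ} (ha : 0 ≤ a) (hb : 0 ≤ b) :
    IntervalIntegrable g volume a b :=
  (hg.monotoneOn.mono fun _ hx => (le_min ha hb).trans hx.1).intervalIntegrable

lemma IsDensity.G_zero (hg : IsDensity G g) : G 0 = 0 := by
  rw [hg.integral_eq 0 le_rfl]; simp

lemma IsDensity.G_sub (hg : IsDensity G g) {a b : ℝ} (ha : 0 ≤ a) (hb : 0 ≤ b) :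
    G b - G a = ∫ τ in a..b, g τ := by
  rw [hg.integral_eq a ha, hg.integral_eq b hb]
  exact intervalIntegral.integral_interval_sub_left (hg.intervalIntegrable le_rfl hb)
    (hg.intervalIntegrable le_rfl ha)

lemma IsDensity.G_mono (hg : IsDensity G g) {a b : ℝ} (ha : 0 ≤ a) (hab : a ≤ b) : G a ≤ G b := by
  rw [← sub_nonneg, hg.G_sub ha (ha.trans hab)]
  exact intervalIntegral.integral_nonneg hab fun x hx => hg.nonneg x (ha.trans hx.1)

lemma IsDensity.G_nonneg (hg : IsDensity G g) {a : ℝ} (ha : 0 ≤ a) : 0 ≤ G a := by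
  rw [← hg.G_zero]; exact hg.G_mono le_rfl ha

lemma IsDensity.G_mul_le (hg : IsDensity G g) {l c t : ℝ} (hl : 0 ≤ l) (ht : 0 ≤ t)
    (h : ∀ τ, 0 ≤ τ → g (l * τ) ≤ c * g τ) : G (l * t) ≤ l * c * G t := by
  rw [hg.integral_eq _ (mul_nonneg hl ht), hg.integral_eq _ ht]
  have e : ∫ τ in (0 : ℝ)..(l * t), g τ = l * ∫ τ in (0 : ℝ)..t, g (l * τ) := by
    have := intervalIntegral.mul_integral_comp_mul_left (f := g) (a := 0) (b := t) (c := l)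
    rw [this]; simp
  rw [e, mul_assoc, ← intervalIntegral.integral_const_mul c]
  refine mul_le_mul_of_nonneg_left ?_ hl
  refine intervalIntegral.integral_mono_on ht ?_ ((hg.intervalIntegrable le_rfl ht).const_mul c)
    fun τ hτ => h τ hτ.1
  refine MonotoneOn.intervalIntegrable ?_
  rw [uIcc_of_le ht]
  intro a ha b hb hab
  exact hg.monotoneOn (mem_Ici.2 (mul_nonneg hl ha.1)) (mem_Ici.2 (mul_nonneg hl hb.1))
    (mul_le_mul_of_nonneg_left hab hl)

/-- The `Δ₂` condition, with an arbitrary dilation `l` instead of `2`. -/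
lemma IsDensity.exists_delta_two (hg : IsDensity G g) (hH : StructuralConditions N s G g pm pp)
    {l : ℝ} (hl : 0 ≤ l) : ∃ C, 0 ≤ C ∧ ∀ t, 0 ≤ t → G (l * t) ≤ C * G t := by
  refine ⟨max 1 l * (max 1 l) ^ (pp - 1), by positivity, fun t ht => ?_⟩
  refine (hg.G_mono (by positivity) (mul_le_mul_of_nonneg_right (le_max_right 1 l) ht)).trans ?_
  exact hg.G_mul_le (by positivity) ht
    fun τ hτ => hg.mul_le_of_index_upper hH (le_max_left _ _) hτ

lemma IsDensity.mul_le_G_two (hg : IsDensity G g) {t : ℝ} (ht : 0 ≤ t) : t * g t ≤ G (2 * t) := by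
  have h1 := hg.G_sub ht (show 0 ≤ 2 * t by positivity)
  have h2 := intervalIntegral.integral_mono_on (show t ≤ 2 * t by linarith)
    (intervalIntegrable_const (c := g t) (μ := volume)) (hg.intervalIntegrable ht (by positivity))
    fun τ hτ => hg.monotoneOn (mem_Ici.2 ht) (mem_Ici.2 (ht.trans hτ.1)) hτ.1
  rw [intervalIntegral.integral_const, smul_eq_mul] at h2
  have := hg.G_nonneg ht
  nlinarith

lemma IsDensity.exists_mul_le_G (hg : IsDensity G g) (hH : StructuralConditions N s G g pm pp)
    {l : ℝ} (hl : 0 ≤ l) : ∃ C, 0 ≤ C ∧ ∀ t, 0 ≤ t → g (l * t) * t ≤ C * G t := by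
  obtain ⟨C, hC, h⟩ := hg.exists_delta_two hH (l := 2 * max 1 l) (by positivity)
  refine ⟨C, hC, fun t ht => ?_⟩
  have h0 : 0 ≤ max 1 l * t := by positivity
  have h1 := hg.mul_le_G_two h0
  have h2 : g (l * t) ≤ g (max 1 l * t) := hg.monotoneOn (mem_Ici.2 (by positivity)) (mem_Ici.2 h0)
    (mul_le_mul_of_nonneg_right (le_max_right _ _) ht)
  have h3 := hg.nonneg _ h0
  have h4 : t ≤ max 1 l * t := le_mul_of_one_le_left ht (le_max_left _ _)
  calc g (l * t) * t ≤ g (max 1 l * t) * (max 1 l * t) := by gcongr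
    _ = max 1 l * t * g (max 1 l * t) := mul_comm _ _
    _ ≤ G (2 * max 1 l * t) := by rw [mul_assoc 2]; exact h1
    _ ≤ _ := h t ht

/-- Quasi-subadditivity of the `N`-function on finite sums. -/
lemma IsDensity.exists_G_sum_le (hg : IsDensity G g) (hH : StructuralConditions N s G g pm pp)
    {ι : Type*} (S : Finset ι) : ∃ C, 0 ≤ C ∧ ∀ a : ι → ℝ, (∀ i ∈ S, 0 ≤ a i) →
      G (∑ i ∈ S, a i) ≤ C * ∑ i ∈ S, G (a i) := by
  obtain ⟨C, hC, h⟩ := hg.exists_delta_two hH (l := S.card) (by positivity)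
  refine ⟨C, hC, fun a ha => ?_⟩
  rcases S.eq_empty_or_nonempty with rfl | hS
  · simp [hg.G_zero]
  obtain ⟨j, hj, hmax⟩ := S.exists_max_image a hS
  calc G (∑ i ∈ S, a i) ≤ G (S.card * a j) := by
        refine hg.G_mono (Finset.sum_nonneg ha) ?_
        rw [← nsmul_eq_mul]
        exact Finset.sum_le_card_nsmul S a _ hmax
    _ ≤ C * G (a j) := h _ (ha j hj)
    _ ≤ _ := by
      refine mul_le_mul_of_nonneg_left ?_ hC
      exact Finset.single_le_sum (f := fun i => G (a i)) (fun i hi => hg.G_nonneg (ha i hi)) hj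

lemma IsDensity.exists_G_add_le (hg : IsDensity G g) (hH : StructuralConditions N s G g pm pp)
    {l : ℝ} (hl : 0 ≤ l) : ∃ C, 0 ≤ C ∧ ∀ a b, 0 ≤ a → 0 ≤ b →
      G (l * (a + b)) ≤ C * (G a + G b) := by
  obtain ⟨C, hC, h⟩ := hg.exists_delta_two hH (l := l * 2) (by positivity)
  refine ⟨C, hC, fun a b ha hb => ?_⟩
  have aux : ∀ a b, 0 ≤ a → 0 ≤ b → a ≤ b → G (l * (a + b)) ≤ C * (G a + G b) := by
    intro a b ha hb hab
    calc G (l * (a + b)) ≤ G (l * 2 * b) := hg.G_mono (by positivity) (by nlinarith)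
      _ ≤ C * G b := h b hb
      _ ≤ _ := mul_le_mul_of_nonneg_left (by linarith [hg.G_nonneg ha]) hC
  rcases le_total a b with hab | hab
  · exact aux a b ha hb hab
  · rw [add_comm a, add_comm (G a)]; exact aux b a hb ha hab

lemma IsDensity.G_mul_le_of_le_one (hg : IsDensity G g) {l t : ℝ} (hl : 0 ≤ l) (hl1 : l ≤ 1)
    (ht : 0 ≤ t) : G (l * t) ≤ l * G t := by
  have := hg.G_mul_le (c := 1) hl ht fun τ hτ => by
    rw [one_mul]
    exact hg.monotoneOn (mem_Ici.2 (by positivity)) (mem_Ici.2 hτ)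
      (mul_le_of_le_one_left hτ hl1)
  simpa using this

lemma IsDensity.rpow_le_G (hg : IsDensity G g) (hH : StructuralConditions N s G g pm pp) {t : ℝ}
    (ht : 1 ≤ t) : G 1 * t ^ pm ≤ G t := by
  have ht0 : 0 < t := by linarith
  have h1 := hg.G_mul_le (l := t⁻¹) (by positivity) ht0.le
    fun τ hτ => hg.mul_le_of_index_lower hH (by positivity) (inv_le_one_of_one_le₀ ht) hτ
  rw [inv_mul_cancel₀ ht0.ne'] at h1
  have h2 : t⁻¹ * t⁻¹ ^ (pm - 1) = (t ^ pm)⁻¹ := by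
    rw [mul_comm, ← Real.rpow_add_one (by positivity), Real.inv_rpow ht0.le]; simp
  rw [h2, inv_mul_eq_div, le_div_iff₀ (by positivity)] at h1
  exact h1

end Growth

/-! ### Continuity of translations -/

/-- Continuity of translations in `L¹`. -/
lemma tendsto_lintegral_translate_sub {V : Type*} [NormedAddCommGroup V] [MeasurableSpace V]
    [BorelSpace V] {μ : Measure V} [μ.IsAddRightInvariant]
    [μ.InnerRegularCompactLTTop] [IsLocallyFiniteMeasure μ] {f : V → ℝ} (hf : Integrable f μ)
    {a : ℕ → V} (ha : Tendsto a atTop (𝓝 0)) :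
    Tendsto (fun n => ∫⁻ x, ‖f (x - a n) - f x‖ₑ ∂μ) atTop (𝓝 0) := by
  have hf1 : MemLp f 1 μ := memLp_one_iff_integrable.2 hf
  have hc : Continuous fun q : V × V => q.2 - q.1 := by fun_prop
  set T : C(V, C(V, V)) := (ContinuousMap.mk (fun q : V × V => q.2 - q.1) hc).curry with hT
  have hT' : Tendsto (fun n => T (a n)) atTop (𝓝 (T 0)) := (T.continuous.tendsto 0).comp ha
  have hmp : ∀ b : V, MeasurePreserving (T b) μ μ := fun b => measurePreserving_sub_right μ b
  have h1 := Filter.Tendsto.compMeasurePreservingLp (p := 1)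
    (tendsto_const_nhds (x := hf1.toLp f) (f := atTop)) hT' (fun n => hmp (a n)) (hmp 0)
    ENNReal.one_ne_top
  rw [tendsto_iff_edist_tendsto_0] at h1
  refine h1.congr fun n => ?_
  rw [Lp.toLp_compMeasurePreserving, Lp.toLp_compMeasurePreserving, Lp.edist_toLp_toLp,
    eLpNorm_one_eq_lintegral_enorm]
  refine lintegral_congr fun x => ?_
  simp [hT]

/-- The integrals of translates of an integrable function over sets shrinking to a null set tend
to zero. -/
lemma tendsto_setLIntegral_translate {V : Type*} [NormedAddCommGroup V] [MeasurableSpace V]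
    [BorelSpace V] {μ : Measure V} [μ.IsAddRightInvariant]
    [μ.InnerRegularCompactLTTop] [IsLocallyFiniteMeasure μ] {F : V → ENNReal} (hF : Measurable F)
    (hF' : ∫⁻ x, F x ∂μ < ⊤)
    {a : ℕ → V} (ha : Tendsto a atTop (𝓝 0)) {A : ℕ → Set V} (hA : ∀ n, MeasurableSet (A n))
    (hA0 : ∀ᵐ x ∂μ, ∀ᶠ n in atTop, x ∉ A n) :
    Tendsto (fun n => ∫⁻ x in A n, F (x - a n) ∂μ) atTop (𝓝 0) := by
  have hint : Integrable (fun x => (F x).toReal) μ := integrable_toReal_of_lintegral_ne_top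
    hF.aemeasurable hF'.ne
  have h1 := tendsto_lintegral_translate_sub hint ha
  have h2 : Tendsto (fun n => ∫⁻ x in A n, F x ∂μ) atTop (𝓝 0) := by
    simp_rw [← lintegral_indicator (hA _)]
    rw [show (0 : ENNReal) = ∫⁻ _, 0 ∂μ by simp]
    refine tendsto_lintegral_of_dominated_convergence F (fun n => hF.indicator (hA n))
      (fun n => ae_of_all _ fun x => indicator_le_self' (fun _ _ => zero_le) x) hF'.ne ?_
    filter_upwards [hA0] with x hx
    refine tendsto_const_nhds.congr' ?_
    filter_upwards [hx] with n hn
    rw [indicator_of_notMem hn]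
  have h3 := h1.add h2
  rw [add_zero] at h3
  refine tendsto_of_tendsto_of_tendsto_of_le_of_le tendsto_const_nhds h3 (fun _ => zero_le) ?_
  intro n
  have hae : ∀ᵐ x ∂μ, F x < ⊤ := ae_lt_top hF hF'.ne
  have hae' : ∀ᵐ x ∂μ, F (x - a n) < ⊤ :=
    (measurePreserving_sub_right μ (a n)).quasiMeasurePreserving.ae hae
  have hFm : Measurable fun x => F (x - a n) := hF.comp (measurable_sub_const (a n))
  calc ∫⁻ x in A n, F (x - a n) ∂μ
      ≤ ∫⁻ x in A n, (‖(F (x - a n)).toReal - (F x).toReal‖ₑ + F x) ∂μ := by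
        refine lintegral_mono_ae (ae_restrict_of_ae ?_)
        filter_upwards [hae, hae'] with x hx hx'
        rw [Real.enorm_eq_ofReal_abs]
        calc F (x - a n) = ENNReal.ofReal (F (x - a n)).toReal := (ENNReal.ofReal_toReal hx'.ne).symm
          _ ≤ ENNReal.ofReal (|(F (x - a n)).toReal - (F x).toReal| + (F x).toReal) :=
            ENNReal.ofReal_le_ofReal (by linarith [le_abs_self ((F (x - a n)).toReal - (F x).toReal)])
          _ = _ := by
            rw [ENNReal.ofReal_add (abs_nonneg _) ENNReal.toReal_nonneg, ENNReal.ofReal_toReal hx.ne]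
    _ = ∫⁻ x in A n, ‖(F (x - a n)).toReal - (F x).toReal‖ₑ ∂μ + ∫⁻ x in A n, F x ∂μ :=
        lintegral_add_right _ hF
    _ ≤ _ := add_le_add (setLIntegral_le_lintegral _ _) le_rfl

/-! ### Energy densities -/

section Energy

variable {N : ℕ} {s : ℝ} {G g : ℝ → ℝ} {pm pp : ℝ}

local notation "ℝᴺ" => EuclideanSpace ℝ (Fin N)

/-- The density of the modular of `W^{s,G}` on the product space. -/
noncomputable def energy (s : ℝ) (G : ℝ → ℝ) (w : EuclideanSpace ℝ (Fin N) → ℝ)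
    (z : EuclideanSpace ℝ (Fin N) × EuclideanSpace ℝ (Fin N)) : ENNReal :=
  ENNReal.ofReal (G (|w z.1 - w z.2| / ‖z.1 - z.2‖ ^ s) / ‖z.1 - z.2‖ ^ N)

lemma IsNFunction.measurable_comp (hG : IsNFunction G) {X : Type*} [MeasurableSpace X] {h : X → ℝ}
    (hh : Measurable h) (h0 : ∀ x, 0 ≤ h x) : Measurable fun x => G (h x) := by
  have hc : Continuous fun t => G (max t 0) :=
    hG.continuousOn.comp_continuous (by fun_prop) fun t => mem_Ici.2 (le_max_right t 0)
  have : (fun x => G (h x)) = fun x => G (max (h x) 0) := by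
    ext x; rw [max_eq_left (h0 x)]
  rw [this]
  exact hc.measurable.comp hh

lemma measurable_energy (hG : IsNFunction G) {w : ℝᴺ → ℝ} (hw : Measurable w) :
    Measurable (energy s G w) := by
  unfold energy
  refine ENNReal.measurable_ofReal.comp (Measurable.div (hG.measurable_comp ?_ ?_) ?_)
  · have h1 : Measurable fun z : ℝᴺ × ℝᴺ => w z.1 - w z.2 :=
      (hw.comp measurable_fst).sub (hw.comp measurable_snd)
    have h2 : Measurable fun z : ℝᴺ × ℝᴺ => ‖z.1 - z.2‖ := by fun_prop
    exact (by fun_prop : Measurable fun z : ℝᴺ × ℝᴺ => |w z.1 - w z.2|).div (h2.pow_const s)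
  · intro z; positivity
  · fun_prop

lemma gagliardoModular_eq (hG : IsNFunction G) {w : ℝᴺ → ℝ} (hw : Measurable w) (S : Set ℝᴺ) :
    gagliardoModular s G S w = ∫⁻ z in S ×ˢ S, energy s G w z ∂(volume.prod volume) := by
  unfold gagliardoModular
  rw [← Measure.prod_restrict, lintegral_prod _ (measurable_energy hG hw).aemeasurable]
  rfl

lemma gagliardoModular_univ_eq (hG : IsNFunction G) {w : ℝᴺ → ℝ} (hw : Measurable w) :
    gagliardoModular s G univ w = ∫⁻ z, energy s G w z ∂(volume.prod volume) := by
  rw [gagliardoModular_eq hG hw, univ_prod_univ, Measure.restrict_univ]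

/-- Pointwise comparison of energy densities. -/
lemma energy_le_of_abs_le (hg : IsDensity G g) {w w' : ℝᴺ → ℝ} {z : ℝᴺ × ℝᴺ}
    (h : |w z.1 - w z.2| ≤ |w' z.1 - w' z.2|) : energy s G w z ≤ energy s G w' z := by
  unfold energy
  refine ENNReal.ofReal_le_ofReal ?_
  gcongr
  exact hg.G_mono (by positivity) (by gcongr)

lemma IsDensity.exists_energy_le (hg : IsDensity G g) (hH : StructuralConditions N s G g pm pp)
    {l : ℝ} (hl : 0 ≤ l) : ∃ C : ENNReal, C ≠ ⊤ ∧ ∀ (w w' : ℝᴺ → ℝ) (z : ℝᴺ × ℝᴺ),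
      |w z.1 - w z.2| ≤ l * |w' z.1 - w' z.2| → energy s G w z ≤ C * energy s G w' z := by
  obtain ⟨C, hC, h⟩ := hg.exists_delta_two hH hl
  refine ⟨ENNReal.ofReal C, ENNReal.ofReal_ne_top, fun w w' z hz => ?_⟩
  unfold energy
  rw [← ENNReal.ofReal_mul hC]
  refine ENNReal.ofReal_le_ofReal ?_
  rw [← mul_div_assoc]
  gcongr
  refine (hg.G_mono (by positivity) ?_).trans (h _ (by positivity))
  rw [← mul_div_assoc]
  gcongr

lemma IsDensity.exists_energy_add_le (hg : IsDensity G g) (hH : StructuralConditions N s G g pm pp)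
    {l : ℝ} (hl : 0 ≤ l) : ∃ C : ENNReal, C ≠ ⊤ ∧ ∀ (w w₁ w₂ : ℝᴺ → ℝ) (z : ℝᴺ × ℝᴺ),
      |w z.1 - w z.2| ≤ l * (|w₁ z.1 - w₁ z.2| + |w₂ z.1 - w₂ z.2|) →
        energy s G w z ≤ C * (energy s G w₁ z + energy s G w₂ z) := by
  obtain ⟨C, hC, h⟩ := hg.exists_G_add_le hH hl
  refine ⟨ENNReal.ofReal C, ENNReal.ofReal_ne_top, fun w w₁ w₂ z hz => ?_⟩
  unfold energy
  have hG0 : ∀ x : ℝ, 0 ≤ x → 0 ≤ G x := fun x hx => hg.G_nonneg hx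
  rw [← ENNReal.ofReal_add (div_nonneg (hG0 _ (by positivity)) (by positivity))
    (div_nonneg (hG0 _ (by positivity)) (by positivity)), ← ENNReal.ofReal_mul hC]
  refine ENNReal.ofReal_le_ofReal ?_
  rw [← add_div, ← mul_div_assoc]
  gcongr
  refine (hg.G_mono (by positivity) ?_).trans (h _ _ (by positivity) (by positivity))
  rw [← add_div, ← mul_div_assoc]
  gcongr

lemma IsDensity.exists_energy_sum_le (hg : IsDensity G g) (hH : StructuralConditions N s G g pm pp)
    {ι : Type*} (S : Finset ι) : ∃ C : ENNReal, C ≠ ⊤ ∧ ∀ (w : ι → ℝᴺ → ℝ) (z : ℝᴺ × ℝᴺ),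
      energy s G (fun x => ∑ i ∈ S, w i x) z ≤ C * ∑ i ∈ S, energy s G (w i) z := by
  obtain ⟨C, hC, h⟩ := hg.exists_G_sum_le hH S
  refine ⟨ENNReal.ofReal C, ENNReal.ofReal_ne_top, fun w z => ?_⟩
  unfold energy
  have hG0 : ∀ x : ℝ, 0 ≤ x → 0 ≤ G x := fun x hx => hg.G_nonneg hx
  rw [← ENNReal.ofReal_sum_of_nonneg fun i _ => div_nonneg (hG0 _ (by positivity)) (by positivity),
    ← ENNReal.ofReal_mul hC]
  refine ENNReal.ofReal_le_ofReal ?_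
  rw [← Finset.sum_div, ← mul_div_assoc]
  gcongr
  refine (hg.G_mono (by positivity) ?_).trans (h _ fun i _ => by positivity)
  rw [← Finset.sum_div, ← Finset.sum_sub_distrib]
  gcongr
  exact Finset.abs_sum_le_sum_abs _ _

/-! ### Integrability of the interaction kernel -/

/-- The energy kernel of a bounded Lipschitz function is integrable: it is of order
`|z| ^ (1 - s - N)` at the origin and of order `|z| ^ (-s - N)` at infinity. -/
lemma lintegral_kernel_lt_top (hN : 1 ≤ N) (hs0 : 0 < s) (hs1 : s < 1) (hG : IsNFunction G)
    (hg : IsDensity G g) {C₁ C₂ : ℝ} (hC₁ : 0 ≤ C₁) (hC₂ : 0 ≤ C₂) :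
    ∫⁻ z : ℝᴺ, ENNReal.ofReal (G (min C₁ (C₂ * ‖z‖) / ‖z‖ ^ s) / ‖z‖ ^ N) < ⊤ := by
  set F : ℝᴺ → ℝ := fun z => G (min C₁ (C₂ * ‖z‖) / ‖z‖ ^ s) / ‖z‖ ^ N with hF
  have hnn : ∀ z : ℝᴺ, 0 ≤ min C₁ (C₂ * ‖z‖) / ‖z‖ ^ s := fun z => by positivity
  have hFm : Measurable F := by
    refine Measurable.div (hG.measurable_comp (Measurable.div ?_ ?_) hnn) (by fun_prop)
    · exact measurable_const.min (measurable_norm.const_mul C₂)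
    · exact measurable_norm.pow_const s
  have hF0 : ∀ z, 0 ≤ F z := fun z => div_nonneg (hg.G_nonneg (hnn z)) (by positivity)
  have hdim : Module.finrank ℝ ℝᴺ = N := by simp
  have hr : ∀ z : ℝᴺ, z ≠ 0 → 0 < ‖z‖ := fun z hz => norm_pos_iff.2 hz
  have hball : IntegrableOn F (Metric.ball 0 1) volume := by
    refine integrableOn_ball_of_norm_le_rpow (μ := volume) (C := G C₂) (α := N - 1 + s)
      (by rw [hdim]; exact hN) (by rw [hdim]; linarith) ?_ hFm.aestronglyMeasurable
    refine (ae_restrict_iff' measurableSet_ball).2 (ae_of_all _ fun z hz => ?_)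
    rw [Real.norm_of_nonneg (hF0 z)]
    rcases eq_or_ne z 0 with rfl | hz0
    · have : F 0 = 0 := by simp [hF, min_eq_right hC₁, hg.G_zero]
      rw [this]
      have := hg.G_nonneg hC₂
      positivity
    have hz1 : ‖z‖ ≤ 1 := by simpa using (mem_ball_zero_iff.1 hz).le
    have hz2 := hr z hz0
    have e1 : ‖z‖ / ‖z‖ ^ s = ‖z‖ ^ (1 - s) := by rw [Real.rpow_sub hz2, Real.rpow_one]
    have h1 : G (min C₁ (C₂ * ‖z‖) / ‖z‖ ^ s) ≤ ‖z‖ ^ (1 - s) * G C₂ := by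
      refine le_trans (hg.G_mono (hnn z) ?_) (hg.G_mul_le_of_le_one (by positivity)
        (Real.rpow_le_one hz2.le hz1 (by linarith)) hC₂)
      rw [← e1, div_mul_eq_mul_div, mul_comm ‖z‖]
      gcongr
      exact min_le_right _ _
    have e2 : ‖z‖ ^ (1 - s) / ‖z‖ ^ N = ‖z‖ ^ (-(N - 1 + s)) := by
      rw [← Real.rpow_natCast, ← Real.rpow_sub hz2]; congr 1; ring
    calc F z ≤ ‖z‖ ^ (1 - s) * G C₂ / ‖z‖ ^ N := by simp only [hF]; gcongr
      _ = _ := by rw [← e2]; ring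
  have hcompl : IntegrableOn F (Metric.ball 0 1)ᶜ volume := by
    have hj := (integrable_one_add_norm (E := ℝᴺ) (μ := volume) (r := N + s)
      (by rw [hdim]; linarith)).const_mul (G C₁ * 2 ^ (N + s))
    refine Integrable.mono' hj.integrableOn hFm.aestronglyMeasurable ?_
    refine (ae_restrict_iff' measurableSet_ball.compl).2 (ae_of_all _ fun z hz => ?_)
    rw [Real.norm_of_nonneg (hF0 z)]
    have hz1 : 1 ≤ ‖z‖ := by simpa using hz
    have hz2 : 0 < ‖z‖ := by linarith
    have h1 : G (min C₁ (C₂ * ‖z‖) / ‖z‖ ^ s) ≤ ‖z‖ ^ (-s) * G C₁ := by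
      refine le_trans (hg.G_mono (hnn z) ?_) (hg.G_mul_le_of_le_one (by positivity)
        (Real.rpow_le_one_of_one_le_of_nonpos hz1 (by linarith)) hC₁)
      rw [Real.rpow_neg hz2.le, ← div_eq_inv_mul]
      gcongr
      exact min_le_left _ _
    have e2 : ‖z‖ ^ (-s) / ‖z‖ ^ N = ‖z‖ ^ (-((N : ℝ) + s)) := by
      rw [← Real.rpow_natCast, ← Real.rpow_sub hz2]; congr 1; ring
    have h3 : ‖z‖ ^ (-((N : ℝ) + s)) ≤ 2 ^ ((N : ℝ) + s) * (1 + ‖z‖) ^ (-((N : ℝ) + s)) := by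
      rw [Real.rpow_neg hz2.le, Real.rpow_neg (by positivity), ← div_eq_mul_inv,
        le_div_iff₀ (by positivity), ← div_eq_inv_mul, ← Real.div_rpow (by positivity) hz2.le]
      refine Real.rpow_le_rpow (by positivity) ?_ (by positivity)
      rw [div_le_iff₀ hz2]; linarith
    calc F z ≤ ‖z‖ ^ (-s) * G C₁ / ‖z‖ ^ N := by simp only [hF]; gcongr
      _ = G C₁ * ‖z‖ ^ (-((N : ℝ) + s)) := by rw [← e2]; ring
      _ ≤ G C₁ * (2 ^ ((N : ℝ) + s) * (1 + ‖z‖) ^ (-((N : ℝ) + s))) :=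
        mul_le_mul_of_nonneg_left h3 (hg.G_nonneg hC₁)
      _ = _ := by ring
  have hint : Integrable F volume := by
    rw [← integrableOn_univ, ← union_compl_self (Metric.ball (0 : ℝᴺ) 1)]
    exact hball.union hcompl
  have := hint.lintegral_lt_top
  exact this

/-- The kernel is integrable over the pairs of points at least one of which lies in a set of finite
measure. -/
lemma lintegral_prod_kernel_lt_top (hN : 1 ≤ N) (hs0 : 0 < s) (hs1 : s < 1) (hG : IsNFunction G)
    (hg : IsDensity G g) {C₁ C₂ : ℝ} (hC₁ : 0 ≤ C₁) (hC₂ : 0 ≤ C₂) {K : Set ℝᴺ}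
    (hK : MeasurableSet K) (hKv : volume K < ⊤) :
    ∫⁻ z : ℝᴺ × ℝᴺ, (K ×ˢ univ ∪ univ ×ˢ K).indicator (fun z : ℝᴺ × ℝᴺ => ENNReal.ofReal
      (G (min C₁ (C₂ * ‖z.1 - z.2‖) / ‖z.1 - z.2‖ ^ s) / ‖z.1 - z.2‖ ^ N)) z
      ∂(volume.prod volume) < ⊤ := by
  set F : ℝᴺ → ENNReal := fun z => ENNReal.ofReal (G (min C₁ (C₂ * ‖z‖) / ‖z‖ ^ s) / ‖z‖ ^ N)
    with hF
  have hFm : Measurable F := by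
    refine ENNReal.measurable_ofReal.comp
      (Measurable.div (hG.measurable_comp (Measurable.div ?_ ?_) fun z => by positivity)
        (by fun_prop))
    · exact measurable_const.min (measurable_norm.const_mul C₂)
    · exact measurable_norm.pow_const s
  have hFs : ∀ z, F (-z) = F z := fun z => by simp [hF]
  have hFm2 : Measurable fun z : ℝᴺ × ℝᴺ => F (z.1 - z.2) :=
    hFm.comp (measurable_fst.sub measurable_snd)
  have hfin := lintegral_kernel_lt_top (N := N) hN hs0 hs1 hG hg hC₁ hC₂
  have h1 : ∫⁻ z in K ×ˢ univ, F (z.1 - z.2) ∂((volume : Measure ℝᴺ).prod volume) < ⊤ := by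
    rw [← Measure.prod_restrict, Measure.restrict_univ, lintegral_prod _ hFm2.aemeasurable]
    have : ∀ x : ℝᴺ, ∫⁻ y, F (x - y) = ∫⁻ y, F y := fun x => lintegral_sub_left_eq_self F x
    simp only [this, lintegral_const, Measure.restrict_apply_univ]
    exact ENNReal.mul_lt_top hfin hKv
  have h2 : ∫⁻ z in univ ×ˢ K, F (z.1 - z.2) ∂((volume : Measure ℝᴺ).prod volume) < ⊤ := by
    rw [← Measure.prod_restrict, Measure.restrict_univ, lintegral_prod_symm _ hFm2.aemeasurable]
    have : ∀ y : ℝᴺ, ∫⁻ x, F (x - y) = ∫⁻ x, F x := fun y => lintegral_sub_right_eq_self F y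
    simp only [this, lintegral_const, Measure.restrict_apply_univ]
    exact ENNReal.mul_lt_top hfin hKv
  rw [lintegral_indicator ((hK.prod .univ).union (MeasurableSet.univ.prod hK))]
  exact (lintegral_union_le _ _ _).trans_lt (ENNReal.add_lt_top.2 ⟨h1, h2⟩)

end Energy

/-! ### Approximation by functions with compact support -/

section Approximation

variable {N : ℕ} {s : ℝ} {G g : ℝ → ℝ} {pm pp : ℝ}

local notation "ℝᴺ" => EuclideanSpace ℝ (Fin N)

lemma energy_le_kernel (hg : IsDensity G g) {φ : ℝᴺ → ℝ} {z : ℝᴺ × ℝᴺ} {C₁ C₂ : ℝ}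
    (h : |φ z.1 - φ z.2| ≤ min C₁ (C₂ * ‖z.1 - z.2‖)) :
    energy s G φ z ≤ ENNReal.ofReal
      (G (min C₁ (C₂ * ‖z.1 - z.2‖) / ‖z.1 - z.2‖ ^ s) / ‖z.1 - z.2‖ ^ N) := by
  unfold energy
  refine ENNReal.ofReal_le_ofReal ?_
  gcongr
  exact hg.G_mono (by positivity) (by gcongr)

lemma energy_eq_zero (hg : IsDensity G g) {φ : ℝᴺ → ℝ} {z : ℝᴺ × ℝᴺ} (h : φ z.1 = φ z.2) :
    energy s G φ z = 0 := by
  simp [energy, h, hg.G_zero]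

/-- Multiplication by a Lipschitz cut-off keeps the energy of a bounded function finite. -/
lemma lintegral_energy_mul_lt_top (hN : 1 ≤ N) (hs0 : 0 < s) (hs1 : s < 1) (hG : IsNFunction G)
    (hg : IsDensity G g) (hH : StructuralConditions N s G g pm pp) {w ξ : ℝᴺ → ℝ} {M B L : ℝ}
    (hB : 0 ≤ B) (hL : 0 ≤ L) (hw : Measurable w)
    (hwM : ∀ x, |w x| ≤ M) (hwE : ∫⁻ z, energy s G w z ∂(volume.prod volume) < ⊤)
    (hξB : ∀ x, |ξ x| ≤ B) (hξL : ∀ x y, |ξ x - ξ y| ≤ L * ‖x - y‖)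
    {K : Set ℝᴺ} (hK : MeasurableSet K) (hKv : volume K < ⊤) (hξK : ∀ x, x ∉ K → ξ x = 0) :
    ∫⁻ z, energy s G (fun x => ξ x * w x) z ∂(volume.prod volume) < ⊤ := by
  obtain ⟨C, hC, h⟩ := hg.exists_energy_add_le hH (l := max B M) (hB.trans (le_max_left _ _))
  have hker := lintegral_prod_kernel_lt_top (N := N) hN hs0 hs1 hG hg (C₁ := 2 * B) (C₂ := L)
    (by positivity) hL hK hKv
  have hξE : ∫⁻ z, energy s G ξ z ∂(volume.prod volume) < ⊤ := by
    refine (lintegral_mono fun z => ?_).trans_lt hker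
    by_cases hz : z ∈ K ×ˢ univ ∪ univ ×ˢ K
    · rw [indicator_of_mem hz]
      refine energy_le_kernel hg (le_min ?_ (hξL _ _))
      have := abs_sub (ξ z.1) (ξ z.2)
      linarith [hξB z.1, hξB z.2]
    · have h1 : z.1 ∉ K ∧ z.2 ∉ K := by simpa using hz
      rw [energy_eq_zero hg (by rw [hξK _ h1.1, hξK _ h1.2])]
      exact zero_le
  calc ∫⁻ z, energy s G (fun x => ξ x * w x) z ∂(volume.prod volume)
      ≤ ∫⁻ z, C * (energy s G w z + energy s G ξ z) ∂(volume.prod volume) := by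
        refine lintegral_mono fun z => h _ _ _ _ ?_
        calc |ξ z.1 * w z.1 - ξ z.2 * w z.2| =
              |ξ z.1 * (w z.1 - w z.2) + w z.2 * (ξ z.1 - ξ z.2)| := by congr 1; ring
          _ ≤ |ξ z.1| * |w z.1 - w z.2| + |w z.2| * |ξ z.1 - ξ z.2| := by
            rw [← abs_mul, ← abs_mul]; exact abs_add_le _ _
          _ ≤ max B M * |w z.1 - w z.2| + max B M * |ξ z.1 - ξ z.2| := by
            gcongr
            · exact (hξB _).trans (le_max_left _ _)
            · exact (hwM _).trans (le_max_right _ _)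
          _ = _ := by ring
    _ = C * (∫⁻ z, energy s G w z ∂(volume.prod volume) +
          ∫⁻ z, energy s G ξ z ∂(volume.prod volume)) := by
        rw [lintegral_const_mul' _ _ hC, lintegral_add_left (measurable_energy hG hw)]
    _ < ⊤ := ENNReal.mul_lt_top hC.lt_top (ENNReal.add_lt_top.2 ⟨hwE, hξE⟩)

/-- Near each point of its closure, a Lipschitz domain is mapped into itself, together with its
boundary, by the small translations in some direction. -/
lemma IsBoundedLipschitzDomain.exists_translate_mem {Ω : Set ℝᴺ}
    (hΩ : IsBoundedLipschitzDomain Ω) {x : ℝᴺ} (hx : x ∈ closure Ω) :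
    ∃ (r h₀ : ℝ) (e : ℝᴺ), 0 < r ∧ 0 < h₀ ∧ ∀ h, 0 < h → h < h₀ →
      ∀ y ∈ closure Ω, dist y x ≤ r → y + h • e ∈ Ω := by
  by_cases hxΩ : x ∈ Ω
  · obtain ⟨r, hr, hsub⟩ := Metric.isOpen_iff.1 hΩ.isOpen x hxΩ
    refine ⟨r / 2, 1, 0, by positivity, one_pos, fun h _ _ y _ hy => ?_⟩
    rw [smul_zero, add_zero]
    exact hsub (Metric.mem_ball.2 (by linarith))
  · have hxf : x ∈ frontier Ω := by
      rw [frontier, hΩ.isOpen.interior_eq]; exact ⟨hx, hxΩ⟩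
    obtain ⟨e, he, L, γ, hγ, r, hr, hgr⟩ := hΩ.lipschitz_boundary x hxf
    refine ⟨r / 2, r / 2, e, by positivity, by positivity, fun h hh0 hh1 y hy hyx => ?_⟩
    have hyb : y ∈ Metric.ball x r := Metric.mem_ball.2 (by linarith)
    have hcl : IsClosed {y : ℝᴺ | γ ((ℝ ∙ e)ᗮ.orthogonalProjectionOnto y) ≤ inner ℝ e y} := by
      refine isClosed_le (hγ.continuous.comp (ContinuousLinearMap.continuous _)) ?_
      exact continuous_const.inner continuous_id
    have h1 : γ ((ℝ ∙ e)ᗮ.orthogonalProjectionOnto y) ≤ inner ℝ e y := by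
      have hyc : y ∈ closure (Ω ∩ Metric.ball x r) :=
        Metric.isOpen_ball.closure_inter ⟨hy, hyb⟩
      exact hcl.closure_subset_iff.2 (fun z hz => ((hgr z hz.2).1 hz.1).le) hyc
    refine (hgr _ ?_).2 ?_
    · rw [Metric.mem_ball]
      calc dist (y + h • e) x ≤ dist (y + h • e) y + dist y x := dist_triangle _ _ _
        _ = h + dist y x := by
          rw [dist_eq_norm, add_sub_cancel_left, norm_smul, he, mul_one, Real.norm_of_nonneg hh0.le]
        _ < r := by linarith
    · have h2 : (ℝ ∙ e)ᗮ.orthogonalProjectionOnto e = 0 :=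
        Submodule.orthogonalProjectionOnto_orthogonal_apply_eq_zero (Submodule.mem_span_singleton_self e)
      rw [map_add, map_smul, h2, smul_zero, add_zero, inner_add_right, inner_smul_right,
        real_inner_self_eq_norm_sq, he]
      linarith

/-- The conical cut-off with peak `4` at `c` and support in the ball of radius `r`. The height makes
it at least `2` on the ball of radius `r / 2`. -/
noncomputable def tent (c : EuclideanSpace ℝ (Fin N)) (r : ℝ) (x : EuclideanSpace ℝ (Fin N)) : ℝ :=
  max (4 * (1 - dist x c / r)) 0

lemma tent_nonneg (c : ℝᴺ) (r : ℝ) (x : ℝᴺ) : 0 ≤ tent c r x := le_max_right _ _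

lemma tent_le (c : ℝᴺ) {r : ℝ} (hr : 0 < r) (x : ℝᴺ) : tent c r x ≤ 4 := by
  have : 0 ≤ dist x c / r := by positivity
  exact max_le (by linarith) (by norm_num)

lemma two_le_tent {c : ℝᴺ} {r : ℝ} (hr : 0 < r) {x : ℝᴺ} (hx : dist x c < r / 2) :
    2 ≤ tent c r x := by
  refine le_trans ?_ (le_max_left _ _)
  have : dist x c / r ≤ 1 / 2 := by rw [div_le_iff₀ hr]; linarith
  linarith

lemma tent_eq_zero {c : ℝᴺ} {r : ℝ} (hr : 0 < r) {x : ℝᴺ} (hx : r < dist x c) :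
    tent c r x = 0 := by
  refine max_eq_right ?_
  have : 1 ≤ dist x c / r := by rw [le_div_iff₀ hr]; linarith
  linarith

lemma abs_tent_sub_le (c : ℝᴺ) {r : ℝ} (hr : 0 < r) (x y : ℝᴺ) :
    |tent c r x - tent c r y| ≤ 4 / r * ‖x - y‖ := by
  refine (abs_max_sub_max_le_abs _ _ _).trans ?_
  have e : 4 * (1 - dist x c / r) - 4 * (1 - dist y c / r) = 4 / r * (dist y c - dist x c) := by
    field_simp; ring
  rw [e, abs_mul, abs_of_pos (by positivity)]
  refine mul_le_mul_of_nonneg_left ?_ (by positivity)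
  rw [← dist_eq_norm, dist_comm x y]
  exact abs_dist_sub_le _ _ _

lemma continuous_tent (c : ℝᴺ) (r : ℝ) : Continuous (tent c r) := by
  unfold tent; fun_prop

/-- A bounded function of finite energy that vanishes outside a Lipschitz domain is approximated
from below by functions with compact support in the domain, with equality at almost every point from
some index on, and with vanishing energy on the set where equality fails. The approximations are
`min w (∑ Wᵢ(· - h eᵢ))`, where `Wᵢ` is `w` times a cut-off near a point of the closure and `eᵢ`
moves the closure into the domain there; as `∑ Wᵢ ≥ 2 w`, the minimum is `w` where the translates
are close to `Wᵢ`. -/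
lemma exists_compact_support_approx (hN : 1 ≤ N) (hs0 : 0 < s) (hs1 : s < 1) (hG : IsNFunction G)
    (hg : IsDensity G g) (hH : StructuralConditions N s G g pm pp) {Ω : Set ℝᴺ}
    (hΩ : IsBoundedLipschitzDomain Ω) {w : ℝᴺ → ℝ} {M : ℝ} (hw : Measurable w)
    (hw0 : ∀ x, 0 ≤ w x) (hwM : ∀ x, w x ≤ M) (hwΩ : ∀ x, x ∉ Ω → w x = 0)
    (hwE : ∫⁻ z, energy s G w z ∂(volume.prod volume) < ⊤) :
    ∃ m : ℕ → ℝᴺ → ℝ, (∀ n, Measurable (m n)) ∧ (∀ n x, 0 ≤ m n x) ∧ (∀ n x, m n x ≤ w x) ∧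
      (∀ n, ∃ K : Set ℝᴺ, IsCompact K ∧ K ⊆ Ω ∧ ∀ x, x ∉ K → m n x = 0) ∧
      (∀ᵐ x, ∀ᶠ n in atTop, m n x = w x) ∧
      (∀ n, ∫⁻ z, energy s G (m n) z ∂(volume.prod volume) < ⊤) ∧
      ∀ F : ℝᴺ × ℝᴺ → ENNReal, Measurable F → ∫⁻ z, F z ∂(volume.prod volume) < ⊤ →
        Tendsto (fun n => ∫⁻ z in {z : ℝᴺ × ℝᴺ | m n z.1 ≠ w z.1 ∨ m n z.2 ≠ w z.2},
          (F z + energy s G (m n) z) ∂(volume.prod volume)) atTop (𝓝 0) := by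
  have hM : 0 ≤ M := (hw0 0).trans (hwM 0)
  have hcpt : IsCompact (closure Ω) := hΩ.isBounded.isCompact_closure
  -- the finite cover of the closure, with the direction of translation for each of its balls
  have hloc : ∀ x : ℝᴺ, ∃ (r h₀ : ℝ) (e : ℝᴺ), 0 < r ∧ 0 < h₀ ∧ (x ∈ closure Ω →
      ∀ h, 0 < h → h < h₀ → ∀ y ∈ closure Ω, dist y x ≤ r → y + h • e ∈ Ω) := by
    intro x
    by_cases hx : x ∈ closure Ω
    · obtain ⟨r, h₀, e, h1, h2, h3⟩ := hΩ.exists_translate_mem hx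
      exact ⟨r, h₀, e, h1, h2, fun _ => h3⟩
    · exact ⟨1, 1, 0, one_pos, one_pos, fun h => absurd h hx⟩
  choose r h₀ e hr hh₀ hpush using hloc
  obtain ⟨t, ht, hcover⟩ := hcpt.elim_nhds_subcover (fun x => Metric.ball x (r x / 2))
    fun x _ => Metric.ball_mem_nhds x (by have := hr x; positivity)
  obtain ⟨δ, hδ, hδt⟩ : ∃ δ : ℝ, 0 < δ ∧ ∀ x ∈ t, δ ≤ h₀ x := by
    have : ∀ᶠ h in 𝓝[>] (0 : ℝ), ∀ x ∈ t, h ≤ h₀ x := by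
      rw [Filter.eventually_all_finset]
      intro x _
      exact mem_nhdsWithin_of_mem_nhds (Iic_mem_nhds (hh₀ x))
    obtain ⟨h, h1, h2⟩ := (this.and self_mem_nhdsWithin).exists
    exact ⟨h, h2, h1⟩
  set h : ℕ → ℝ := fun n => δ / (n + 2) with hh
  have hhpos : ∀ n, 0 < h n := fun n => by positivity
  have hhlt : ∀ n, h n < δ := fun n => by
    rw [hh]
    have : (0 : ℝ) ≤ n := n.cast_nonneg
    exact div_lt_self hδ (by linarith)
  have hhtend : Tendsto h atTop (𝓝 0) := by
    refine Tendsto.div_atTop tendsto_const_nhds ?_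
    exact tendsto_atTop_add_const_right _ _ tendsto_natCast_atTop_atTop
  -- the localized functions
  set W : ℝᴺ → ℝᴺ → ℝ := fun i x => tent i (r i) x * w x with hW
  have hWm : ∀ i, Measurable (W i) := fun i => (continuous_tent i (r i)).measurable.mul hw
  have hW0 : ∀ i x, 0 ≤ W i x := fun i x => mul_nonneg (tent_nonneg _ _ _) (hw0 x)
  have hWE : ∀ i, ∫⁻ z, energy s G (W i) z ∂(volume.prod volume) < ⊤ := by
    intro i
    refine lintegral_energy_mul_lt_top (M := M) (B := 4) (L := 4 / r i) hN hs0 hs1 hG hg hH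
      (by norm_num) (by have := hr i; positivity) hw
      (fun x => by rw [abs_of_nonneg (hw0 x)]; exact hwM x) hwE
      (fun x => by rw [abs_of_nonneg (tent_nonneg _ _ _)]; exact tent_le _ (hr i) x)
      (abs_tent_sub_le i (hr i)) (K := Metric.closedBall i (r i)) measurableSet_closedBall
      measure_closedBall_lt_top fun x hx => tent_eq_zero (hr i) ?_
    simpa using hx
  have hWint : ∀ i, Integrable (W i) volume := by
    intro i
    have hvol : volume (closure Ω) < ⊤ := hcpt.measure_lt_top
    have : IntegrableOn (W i) (closure Ω) volume := by
      refine Measure.integrableOn_of_bounded (M := 4 * M) hvol.ne (hWm i).aestronglyMeasurable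
        (ae_of_all _ fun x => ?_)
      rw [Real.norm_of_nonneg (hW0 i x)]
      exact mul_le_mul (tent_le _ (hr i) x) (hwM x) (hw0 x) (by norm_num)
    refine (integrableOn_iff_integrable_of_support_subset fun x hx => ?_).1 this
    by_contra hcon
    exact hx (by simp [hW, hwΩ x fun h => hcon (subset_closure h)])
  -- a subsequence along which the translates converge almost everywhere
  set T : ℕ → ℝᴺ → ℝ := fun n x => ∑ i ∈ t, |W i (x - h n • e i) - W i x| with hT
  have hTm : ∀ n, Measurable (T n) := fun n => Finset.measurable_sum _ fun i _ =>
    (((hWm i).comp (measurable_sub_const _)).sub (hWm i)).abs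
  have hhe : ∀ i, Tendsto (fun n => h n • e i) atTop (𝓝 0) := fun i => by
    simpa using hhtend.smul_const (e i)
  have hTt : Tendsto (fun n => eLpNorm (T n - 0) 1 volume) atTop (𝓝 0) := by
    have h1 : Tendsto (fun n => ∑ i ∈ t, ∫⁻ x, ‖W i (x - h n • e i) - W i x‖ₑ) atTop
        (𝓝 (∑ i ∈ t, 0)) :=
      tendsto_finsetSum _ fun i _ => tendsto_lintegral_translate_sub (hWint i) (hhe i)
    rw [Finset.sum_const_zero] at h1
    refine h1.congr fun n => ?_
    rw [sub_zero, eLpNorm_one_eq_lintegral_enorm, ← lintegral_finsetSum]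
    · refine lintegral_congr fun x => ?_
      simp only [hT]
      rw [Real.enorm_of_nonneg (Finset.sum_nonneg fun i _ => abs_nonneg _),
        ENNReal.ofReal_sum_of_nonneg fun i _ => abs_nonneg _]
      exact Finset.sum_congr rfl fun i _ => Real.enorm_eq_ofReal_abs _
    · exact fun i _ => (((hWm i).comp (measurable_sub_const _)).sub (hWm i)).enorm
  obtain ⟨ns, hns, hae⟩ := (tendstoInMeasure_of_tendsto_eLpNorm one_ne_zero
    (fun n => (hTm n).aestronglyMeasurable) aestronglyMeasurable_zero hTt).exists_seq_tendsto_ae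
  have hhe' : ∀ i, Tendsto (fun n => h (ns n) • e i) atTop (𝓝 0) := fun i =>
    (hhe i).comp hns.tendsto_atTop
  set m : ℕ → ℝᴺ → ℝ := fun n x => min (w x) (∑ i ∈ t, W i (x - h (ns n) • e i)) with hm
  have hmm : ∀ n, Measurable (m n) := fun n => hw.min
    (Finset.measurable_sum _ fun i _ => (hWm i).comp (measurable_sub_const _))
  have hmev : ∀ᵐ x, ∀ᶠ n in atTop, m n x = w x := by
    filter_upwards [hae] with x hx
    rcases (hw0 x).eq_or_lt with h0 | hpos
    · refine Eventually.of_forall fun n => ?_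
      rw [hm]
      simp only [← h0]
      exact min_eq_left (Finset.sum_nonneg fun i _ => hW0 _ _)
    have hxΩ : x ∈ Ω := by
      by_contra hcon
      exact hpos.ne' (hwΩ x hcon)
    have h1 : ∀ i ∈ t, Tendsto (fun n => W i (x - h (ns n) • e i)) atTop (𝓝 (W i x)) := by
      intro i hi
      rw [tendsto_iff_dist_tendsto_zero]
      refine squeeze_zero (fun _ => dist_nonneg) (fun n => ?_) hx
      rw [Real.dist_eq]
      exact Finset.single_le_sum (f := fun i => |W i (x - h (ns n) • e i) - W i x|)
        (fun j _ => abs_nonneg _) hi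
    have h2 := tendsto_finsetSum t h1
    obtain ⟨j, hj, hxj⟩ : ∃ j ∈ t, x ∈ Metric.ball j (r j / 2) := by
      simpa using hcover (subset_closure hxΩ)
    have h3 : w x < ∑ i ∈ t, W i x := by
      have h4 : W j x ≤ ∑ i ∈ t, W i x :=
        Finset.single_le_sum (f := fun i => W i x) (fun j _ => hW0 j x) hj
      have h5 : 2 * w x ≤ W j x :=
        mul_le_mul_of_nonneg_right (two_le_tent (hr j) hxj) (hw0 x)
      linarith
    filter_upwards [h2.eventually_const_lt h3] with n hn
    exact min_eq_left hn.le
  have hA : ∀ n, MeasurableSet {z : ℝᴺ × ℝᴺ | m n z.1 ≠ w z.1 ∨ m n z.2 ≠ w z.2} := by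
    intro n
    have h1 : MeasurableSet {x | m n x = w x} := measurableSet_eq_fun (hmm n) hw
    exact (measurable_fst h1.compl).union (measurable_snd h1.compl)
  have hA0 : ∀ᵐ z ∂((volume : Measure ℝᴺ).prod volume), ∀ᶠ n in atTop,
      z ∉ {z : ℝᴺ × ℝᴺ | m n z.1 ≠ w z.1 ∨ m n z.2 ≠ w z.2} := by
    filter_upwards [Measure.quasiMeasurePreserving_fst.ae hmev,
      Measure.quasiMeasurePreserving_snd.ae hmev] with z h1 h2
    filter_upwards [h1, h2] with n h3 h4
    simp [h3, h4]
  -- the energies of the approximations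
  obtain ⟨C, hC, hadd⟩ := hg.exists_energy_add_le (N := N) (s := s) hH (l := 1) zero_le_one
  obtain ⟨C', hC', hsum⟩ := hg.exists_energy_sum_le (N := N) (s := s) hH t
  have hEm : ∀ n z, energy s G (m n) z ≤ C * (energy s G w z +
      C' * ∑ i ∈ t, energy s G (W i) (z - (h (ns n) • e i, h (ns n) • e i))) := by
    intro n z
    refine (hadd (m n) w (fun x => ∑ i ∈ t, W i (x - h (ns n) • e i)) z ?_).trans ?_
    · rw [one_mul]
      exact (abs_min_sub_min_le_max _ _ _ _).trans
        (max_le_add_of_nonneg (abs_nonneg _) (abs_nonneg _))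
    · gcongr
      refine (hsum (fun i x => W i (x - h (ns n) • e i)) z).trans (le_of_eq ?_)
      congr 1
      refine Finset.sum_congr rfl fun i _ => ?_
      simp [energy]
  have hEtm : ∀ n i, Measurable fun z : ℝᴺ × ℝᴺ =>
      energy s G (W i) (z - (h (ns n) • e i, h (ns n) • e i)) := fun n i =>
    (measurable_energy hG (hWm i)).comp (measurable_sub_const _)
  have hint : ∀ n (A : Set (ℝᴺ × ℝᴺ)),
      ∫⁻ z in A, energy s G (m n) z ∂(volume.prod volume) ≤
      C * (∫⁻ z in A, energy s G w z ∂(volume.prod volume) + C' * ∑ i ∈ t,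
        ∫⁻ z in A, energy s G (W i) (z - (h (ns n) • e i, h (ns n) • e i))
          ∂(volume.prod volume)) := by
    intro n A
    refine (lintegral_mono fun z => hEm n z).trans (le_of_eq ?_)
    rw [lintegral_const_mul' _ _ hC, lintegral_add_left (measurable_energy hG hw),
      lintegral_const_mul' _ _ hC', lintegral_finsetSum _ fun i _ => hEtm n i]
  refine ⟨m, hmm, fun n x => le_min (hw0 x) (Finset.sum_nonneg fun i _ => hW0 _ _),
    fun n x => min_le_left _ _, ?_, hmev, ?_, ?_⟩
  · intro n
    refine ⟨⋃ i ∈ t, (fun y => y + h (ns n) • e i) '' (closure Ω ∩ Metric.closedBall i (r i)),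
      ?_, ?_, ?_⟩
    · refine t.finite_toSet.isCompact_biUnion fun i _ => ?_
      exact (hcpt.inter_right Metric.isClosed_closedBall).image (by fun_prop)
    · refine iUnion₂_subset fun i hi => ?_
      rintro _ ⟨y, ⟨hy1, hy2⟩, rfl⟩
      exact hpush i (ht i hi) _ (hhpos _) ((hhlt _).trans_le (hδt i hi)) y hy1 hy2
    · intro x hx
      have hz : ∑ i ∈ t, W i (x - h (ns n) • e i) = 0 := by
        refine Finset.sum_eq_zero fun i hi => ?_
        by_contra hne
        refine hx (mem_iUnion₂.2 ⟨i, hi, x - h (ns n) • e i, ⟨?_, ?_⟩, by simp⟩)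
        · by_contra hcon
          exact hne (by simp [hW, hwΩ _ fun h => hcon (subset_closure h)])
        · by_contra hcon
          exact hne (by simp only [hW]; rw [tent_eq_zero (hr i) (by simpa using hcon), zero_mul])
      simp only [hm, hz]
      exact min_eq_right (hw0 x)
  · intro n
    rw [← setLIntegral_univ]
    refine (hint n univ).trans_lt (ENNReal.mul_lt_top hC.lt_top (ENNReal.add_lt_top.2 ⟨?_, ?_⟩))
    · rwa [setLIntegral_univ]
    · refine ENNReal.mul_lt_top hC'.lt_top (ENNReal.sum_lt_top.2 fun i _ => ?_)
      rw [setLIntegral_univ, lintegral_sub_right_eq_self (energy s G (W i))]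
      exact hWE i
  · intro F hF hFE
    have h1 : ∀ F : ℝᴺ × ℝᴺ → ENNReal, Measurable F → ∫⁻ z, F z ∂(volume.prod volume) < ⊤ →
        Tendsto (fun n => ∫⁻ z in {z : ℝᴺ × ℝᴺ | m n z.1 ≠ w z.1 ∨ m n z.2 ≠ w z.2},
        F z ∂(volume.prod volume)) atTop (𝓝 0) := fun F hF hFE => by
      simpa using tendsto_setLIntegral_translate hF hFE
        (tendsto_const_nhds (x := (0 : ℝᴺ × ℝᴺ))) hA hA0
    have h2 : ∀ i, Tendsto (fun n => ∫⁻ z in {z : ℝᴺ × ℝᴺ | m n z.1 ≠ w z.1 ∨ m n z.2 ≠ w z.2},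
        energy s G (W i) (z - (h (ns n) • e i, h (ns n) • e i)) ∂(volume.prod volume))
        atTop (𝓝 0) := fun i =>
      tendsto_setLIntegral_translate (measurable_energy hG (hWm i)) (hWE i)
        ((hhe' i).prodMk_nhds (hhe' i)) hA hA0
    have h3 : Tendsto (fun n => ∑ i ∈ t,
        ∫⁻ z in {z : ℝᴺ × ℝᴺ | m n z.1 ≠ w z.1 ∨ m n z.2 ≠ w z.2},
        energy s G (W i) (z - (h (ns n) • e i, h (ns n) • e i)) ∂(volume.prod volume))
        atTop (𝓝 0) := by
      simpa using tendsto_finsetSum t fun i _ => h2 i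
    have h4 := (h1 F hF hFE).add (ENNReal.Tendsto.const_mul ((h1 _ (measurable_energy hG hw) hwE).add
      (ENNReal.Tendsto.const_mul h3 (Or.inr hC'))) (Or.inr hC))
    simp only [mul_zero, add_zero] at h4
    refine tendsto_of_tendsto_of_tendsto_of_le_of_le tendsto_const_nhds h4 (fun _ => zero_le)
      fun n => ?_
    dsimp only
    rw [lintegral_add_left hF]
    exact add_le_add le_rfl (hint n _)

end Approximation

/-! ### Integrability of the coefficient `k` -/

section Coefficient

variable {N : ℕ} {s : ℝ} {G g : ℝ → ℝ} {pm pp : ℝ}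

local notation "ℝᴺ" => EuclideanSpace ℝ (Fin N)

lemma IsDensity.exists_G_eq (hG : IsNFunction G) (hg : IsDensity G g)
    (hH : StructuralConditions N s G g pm pp) {τ : ℝ} (hτ : 0 ≤ τ) : ∃ t ∈ Ici (0 : ℝ), G t = τ := by
  have h1 : 0 < G 1 := (hg.G_nonneg zero_le_one).lt_of_ne
    fun h => one_ne_zero ((hG.eq_zero_iff 1 zero_le_one).1 h.symm)
  set b := max 1 (τ / G 1) with hb
  have hb1 : 1 ≤ b := le_max_left _ _
  have h2 : τ ≤ G b := by
    refine le_trans ?_ (hg.rpow_le_G hH hb1)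
    have h3 : b ≤ b ^ pm := by
      have := Real.rpow_le_rpow_of_exponent_le hb1 (show (1 : ℝ) ≤ pm by linarith [hH.one_lt])
      rwa [Real.rpow_one] at this
    calc τ = G 1 * (τ / G 1) := by field_simp
      _ ≤ G 1 * b ^ pm := mul_le_mul_of_nonneg_left ((le_max_right _ _).trans h3) h1.le
  obtain ⟨t, ht, htτ⟩ := intermediate_value_Icc (show (0 : ℝ) ≤ b by linarith)
    (hG.continuousOn.mono Icc_subset_Ici_self) ⟨by rw [hg.G_zero]; exact hτ, h2⟩
  exact ⟨t, ht.1, htτ⟩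

lemma invNonneg_G_nonneg (hG : IsNFunction G) (hg : IsDensity G g)
    (hH : StructuralConditions N s G g pm pp) {τ : ℝ} (hτ : 0 ≤ τ) : 0 ≤ invNonneg G τ :=
  Function.invFunOn_mem (hg.exists_G_eq hG hH hτ)

lemma G_invNonneg (hG : IsNFunction G) (hg : IsDensity G g)
    (hH : StructuralConditions N s G g pm pp) {τ : ℝ} (hτ : 0 ≤ τ) : G (invNonneg G τ) = τ :=
  Function.invFunOn_eq (hg.exists_G_eq hG hH hτ)

lemma monotoneOn_invNonneg_G (hG : IsNFunction G) (hg : IsDensity G g)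
    (hH : StructuralConditions N s G g pm pp) : MonotoneOn (invNonneg G) (Ici 0) := by
  intro a ha b hb hab
  by_contra hcon
  have h1 := hg.G_mono (invNonneg_G_nonneg hG hg hH hb) (not_le.1 hcon).le
  rw [G_invNonneg hG hg hH ha, G_invNonneg hG hg hH hb] at h1
  exact hcon (by rw [le_antisymm hab h1])

/-- `G⁻¹` grows at most like `τ ^ (1 / pm)`. -/
lemma exists_invNonneg_G_le (hG : IsNFunction G) (hg : IsDensity G g)
    (hH : StructuralConditions N s G g pm pp) :
    ∃ C, 0 ≤ C ∧ ∀ τ, 1 ≤ τ → invNonneg G τ ≤ C * τ ^ (1 / pm) := by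
  have hpm : 0 < pm := by linarith [hH.one_lt]
  have h1 : 0 < G 1 := (hg.G_nonneg zero_le_one).lt_of_ne
    fun h => one_ne_zero ((hG.eq_zero_iff 1 zero_le_one).1 h.symm)
  refine ⟨max 1 ((G 1)⁻¹ ^ (1 / pm)), by positivity, fun τ hτ => ?_⟩
  have hτ0 : 0 ≤ τ := by linarith
  rcases le_total (invNonneg G τ) 1 with h | h
  · refine h.trans ?_
    exact one_le_mul_of_one_le_of_one_le (le_max_left _ _) (Real.one_le_rpow hτ (by positivity))
  · have h2 := hg.rpow_le_G hH h
    rw [G_invNonneg hG hg hH hτ0] at h2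
    have h3 : invNonneg G τ ^ pm ≤ (G 1)⁻¹ * τ := by
      rw [inv_mul_eq_div, le_div_iff₀ h1]; linarith
    have h4 := Real.rpow_le_rpow (by positivity) h3 (show 0 ≤ 1 / pm by positivity)
    rw [← Real.rpow_mul (by linarith), mul_one_div_cancel hpm.ne', Real.rpow_one,
      Real.mul_rpow (by positivity) hτ0] at h4
    exact h4.trans (mul_le_mul_of_nonneg_right (le_max_right _ _) (by positivity))

/-- The primitive inverted by the Sobolev conjugate maps onto `[0, ∞)`, since its integrand is
integrable at zero but not at infinity, so that `sobolevConj` is a genuine right inverse; and the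
primitive grows at most like `y ^ (1 / pm)`. -/
lemma sobolevConj_spec (hN : 1 ≤ N) (hs0 : 0 < s) (hG : IsNFunction G) (hg : IsDensity G g)
    (hH : StructuralConditions N s G g pm pp) :
    ∃ B, 0 < B ∧ ∀ σ, 0 ≤ σ → 0 ≤ sobolevConj N s G σ ∧
      σ ≤ B * (1 + sobolevConj N s G σ ^ (1 / pm)) := by
  have hpm : 0 < pm := by linarith [hH.one_lt]
  have hN0 : (0 : ℝ) < N := by exact_mod_cast hN
  set q : ℝ := ((N : ℝ) + s) / (N : ℝ) with hq
  have hq1 : 1 ≤ q := by rw [hq, one_le_div hN0]; linarith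
  set I : ℝ → ℝ := fun τ => invNonneg G τ / τ ^ q with hI
  set H : ℝ → ℝ := fun t => ∫ τ in (0 : ℝ)..t, I τ with hHdef
  have hI0 : ∀ τ, 0 ≤ τ → 0 ≤ I τ := fun τ hτ =>
    div_nonneg (invNonneg_G_nonneg hG hg hH hτ) (by positivity)
  have hIm : AEMeasurable I (volume.restrict (Ici 0)) :=
    (aemeasurable_restrict_of_monotoneOn measurableSet_Ici
      (monotoneOn_invNonneg_G hG hg hH)).div (by fun_prop)
  have hI01 : IntegrableOn I (Ioc 0 1) := by
    refine ⟨(hIm.mono_set (Ioc_subset_Ioi_self.trans Ioi_subset_Ici_self)).aestronglyMeasurable, ?_⟩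
    rw [hasFiniteIntegral_iff_ofReal]
    · exact hH.integral_zero
    · exact (ae_restrict_iff' measurableSet_Ioc).2 (ae_of_all _ fun x hx => hI0 x hx.1.le)
  have hI1 : ∀ y, IntegrableOn I (Ioc 1 y) := by
    intro y
    have hsub : Ioc 1 y ⊆ Ici (0 : ℝ) := fun x hx => zero_le_one.trans hx.1.le
    refine IntegrableOn.of_bound measure_Ioc_lt_top
      (hIm.mono_set hsub).aestronglyMeasurable (invNonneg G y) ?_
    refine (ae_restrict_iff' measurableSet_Ioc).2 (ae_of_all _ fun x hx => ?_)
    have hx0 : 0 ≤ x := zero_le_one.trans hx.1.le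
    rw [Real.norm_of_nonneg (hI0 x hx0)]
    have h1 : invNonneg G x ≤ invNonneg G y :=
      monotoneOn_invNonneg_G hG hg hH hx0 (mem_Ici.2 (hx0.trans hx.2)) hx.2
    have h2 : 1 ≤ x ^ q := Real.one_le_rpow hx.1.le (by linarith)
    exact (div_le_self (invNonneg_G_nonneg hG hg hH hx0) h2).trans h1
  have hI0y : ∀ y, IntegrableOn I (Ioc 0 y) := by
    intro y
    refine (hI01.union (hI1 y)).mono_set fun x hx => ?_
    rcases le_total x 1 with h | h
    · exact Or.inl ⟨hx.1, h⟩
    · rcases h.eq_or_lt with h | h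
      · exact Or.inl ⟨hx.1, h.ge⟩
      · exact Or.inr ⟨h, hx.2⟩
  have hii : ∀ a b, 0 ≤ a → 0 ≤ b → IntervalIntegrable I volume a b := by
    intro a b ha hb
    rw [intervalIntegrable_iff]
    refine (hI0y (max a b)).mono_set fun x hx => ⟨?_, hx.2⟩
    exact lt_of_le_of_lt (le_min ha hb) hx.1
  have hHsub : ∀ a b, 0 ≤ a → 0 ≤ b → H b - H a = ∫ τ in a..b, I τ := fun a b ha hb =>
    intervalIntegral.integral_interval_sub_left (hii _ _ le_rfl hb) (hii _ _ le_rfl ha)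
  have hHmono : ∀ a b, 0 ≤ a → a ≤ b → H a ≤ H b := by
    intro a b ha hab
    rw [← sub_nonneg, hHsub a b ha (ha.trans hab)]
    exact intervalIntegral.integral_nonneg hab fun x hx => hI0 x (ha.trans hx.1)
  have hH0 : H 0 = 0 := by simp [hHdef]
  have hsurj : ∀ σ, 0 ≤ σ → ∃ y ∈ Ici (0 : ℝ), H y = σ := by
    intro σ hσ
    have hunb : ∃ y, 1 ≤ y ∧ σ ≤ H y := by
      by_contra! hcon
      have h1 : IntegrableOn I (Ioi 1) := by
        refine integrableOn_Ioi_of_intervalIntegral_norm_bounded (l := atTop) (b := fun y : ℝ => y)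
          σ 1 (fun y => hI1 y) tendsto_id ?_
        filter_upwards [eventually_ge_atTop 1] with y hy
        have h2 : ∫ x in (1 : ℝ)..y, ‖I x‖ = ∫ x in (1 : ℝ)..y, I x := by
          refine intervalIntegral.integral_congr fun x hx => ?_
          rw [uIcc_of_le hy] at hx
          exact Real.norm_of_nonneg (hI0 x (zero_le_one.trans hx.1))
        rw [h2, ← hHsub 1 y zero_le_one (by linarith)]
        have h3 := hHmono 0 1 le_rfl zero_le_one
        rw [hH0] at h3
        linarith [hcon y hy]
      exact h1.lintegral_lt_top.ne hH.integral_infty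
    obtain ⟨Y, hY, hYσ⟩ := hunb
    have hcont : ContinuousOn H (Icc 0 Y) := by
      have := intervalIntegral.continuousOn_primitive_interval (f := I) (a := 0) (b := Y)
        (μ := volume) (by
          rw [uIcc_of_le (by linarith), integrableOn_Icc_iff_integrableOn_Ioc]
          exact hI0y Y)
      rwa [uIcc_of_le (by linarith)] at this
    obtain ⟨y, hy, hyσ⟩ := intermediate_value_Icc (show (0 : ℝ) ≤ Y by linarith) hcont
      ⟨by rw [hH0]; exact hσ, hYσ⟩
    exact ⟨y, hy.1, hyσ⟩
  obtain ⟨C, hC, hle⟩ := exists_invNonneg_G_le hG hg hH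
  have hH1 : 0 ≤ H 1 := by rw [← hH0]; exact hHmono 0 1 le_rfl zero_le_one
  have hgrow : ∀ y, 0 ≤ y → H y ≤ H 1 + C * pm * y ^ (1 / pm) := by
    intro y hy
    have hnn : 0 ≤ C * pm * y ^ (1 / pm) := by positivity
    rcases le_total y 1 with h | h
    · linarith [hHmono y 1 hy h]
    · have h1 := hHsub 1 y zero_le_one hy
      have h2 : ∫ τ in (1 : ℝ)..y, I τ ≤ ∫ τ in (1 : ℝ)..y, C * τ ^ (1 / pm - 1) := by
        refine intervalIntegral.integral_mono_on h (hii _ _ zero_le_one hy)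
          ((intervalIntegral.intervalIntegrable_rpow (Or.inr ?_)).const_mul C) ?_
        · rw [uIcc_of_le h]; intro h0; linarith [h0.1]
        · intro x hx
          have hx0 : 0 < x := by linarith [hx.1]
          rw [Real.rpow_sub hx0, Real.rpow_one, ← mul_div_assoc]
          refine div_le_div₀ (by positivity) (hle x hx.1) hx0 ?_
          have := Real.rpow_le_rpow_of_exponent_le hx.1 hq1
          rwa [Real.rpow_one] at this
      rw [intervalIntegral.integral_const_mul, integral_rpow (Or.inl (by
        have : 0 < 1 / pm := by positivity
        linarith))] at h2
      have h3 : C * ((y ^ (1 / pm - 1 + 1) - 1 ^ (1 / pm - 1 + 1)) / (1 / pm - 1 + 1)) =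
          C * pm * y ^ (1 / pm) - C * pm := by
        rw [sub_add_cancel, Real.one_rpow]; field_simp
      have h4 : 0 ≤ C * pm := by positivity
      linarith
  refine ⟨H 1 + C * pm + 1, by positivity, fun σ hσ => ?_⟩
  have hy0 : 0 ≤ sobolevConj N s G σ := Function.invFunOn_mem (hsurj σ hσ)
  have hyσ : H (sobolevConj N s G σ) = σ := Function.invFunOn_eq (hsurj σ hσ)
  refine ⟨hy0, ?_⟩
  have h1 := hgrow _ hy0
  rw [hyσ] at h1
  have h2 : 0 ≤ sobolevConj N s G σ ^ (1 / pm) := by positivity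
  have h3 : 0 ≤ C * pm := by positivity
  nlinarith

/-- The complementary function in the condition on `k` is a supremum of a bounded set, and not the
value `0` given to unbounded sets, since `β + 1 < pm` and the Sobolev conjugate grows at least like
`t ^ pm`. -/
lemma bddAbove_complementary (hN : 1 ≤ N) (hs0 : 0 < s) (hG : IsNFunction G) (hg : IsDensity G g)
    (hH : StructuralConditions N s G g pm pp) {β : ℝ} (hβ0 : 0 < β) (hβ1 : β < pm - 1) {t : ℝ}
    (ht : 0 ≤ t) : BddAbove ((fun τ => t * τ - sobolevConj N s G (τ ^ (1 / (β + 1)))) '' Ici 0) := by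
  obtain ⟨B, hB, hspec⟩ := sobolevConj_spec hN hs0 hG hg hH
  have hpm : 0 < pm := by linarith [hH.one_lt]
  set θ := (β + 1) / pm with hθ
  have hθ1 : θ < 1 := by rw [hθ, div_lt_one hpm]; linarith
  have hθ0 : 0 < θ := by positivity
  set c := (2 * B) ^ (β + 1) with hc
  have hc0 : 0 < c := by positivity
  -- above the threshold `Y` the power `y ^ (1 - θ)` exceeds `t * c`, and `t * τ` is at most `y`
  set Y := max 1 ((t * c) ^ (1 / (1 - θ))) with hY
  have hY1 : 1 ≤ Y := le_max_left _ _
  refine ⟨t * (c * Y ^ θ), ?_⟩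
  rintro _ ⟨τ, hτ, rfl⟩
  have hτ : 0 ≤ τ := hτ
  dsimp only
  obtain ⟨hy0, hy⟩ := hspec (τ ^ (1 / (β + 1))) (by positivity)
  set y := sobolevConj N s G (τ ^ (1 / (β + 1))) with hydef
  have key : ∀ z, 1 ≤ z → y ≤ z → τ ≤ c * z ^ θ := by
    intro z hz hyz
    have h1 : τ ^ (1 / (β + 1)) ≤ 2 * B * z ^ (1 / pm) := by
      have h2 : y ^ (1 / pm) ≤ z ^ (1 / pm) := Real.rpow_le_rpow hy0 hyz (by positivity)
      have h3 : 1 ≤ z ^ (1 / pm) := Real.one_le_rpow hz (by positivity)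
      nlinarith
    have h4 := Real.rpow_le_rpow (by positivity) h1 (show 0 ≤ β + 1 by linarith)
    rw [← Real.rpow_mul hτ, one_div_mul_cancel (by linarith), Real.rpow_one,
      Real.mul_rpow (by positivity) (by positivity), ← Real.rpow_mul (by linarith)] at h4
    rwa [one_div_mul_eq_div] at h4
  rcases le_total y Y with h | h
  · have := mul_le_mul_of_nonneg_left (key Y hY1 h) ht
    linarith
  · have hy1 : 1 ≤ y := hY1.trans h
    have h1 := mul_le_mul_of_nonneg_left (key y hy1 le_rfl) ht
    have h2 : t * c ≤ y ^ (1 - θ) := by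
      have h3 := Real.rpow_le_rpow (by positivity) ((le_max_right _ _).trans h)
        (show 0 ≤ 1 - θ by linarith)
      rwa [← Real.rpow_mul (by positivity), one_div_mul_cancel (by linarith), Real.rpow_one] at h3
    have h4 : y ^ (1 - θ) * y ^ θ = y := by
      rw [← Real.rpow_add (by linarith)]; simp
    have h5 : t * (c * y ^ θ) ≤ y := by
      calc t * (c * y ^ θ) = t * c * y ^ θ := by ring
        _ ≤ y ^ (1 - θ) * y ^ θ := mul_le_mul_of_nonneg_right h2 (by positivity)
        _ = y := h4
    have h6 : 0 ≤ t * (c * Y ^ θ) := by positivity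
    linarith

/-- The complementary function grows at least linearly, so that `k` is integrable on the bounded
set `Ω`. -/
lemma integrableOn_of_memOrlicz_complementary (hN : 1 ≤ N) (hs0 : 0 < s) (hG : IsNFunction G)
    (hg : IsDensity G g) (hH : StructuralConditions N s G g pm pp) {β : ℝ} (hβ0 : 0 < β)
    (hβ1 : β < pm - 1) {Ω : Set ℝᴺ} (hΩ : Bornology.IsBounded Ω) {k : ℝᴺ → ℝ}
    (hk : MemOrlicz (complementary fun t => sobolevConj N s G (t ^ (1 / (β + 1)))) Ω k) :
    IntegrableOn k Ω := by
  obtain ⟨hkm, l, hl, hfin⟩ := hk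
  set A : ℝ → ℝ := fun t => sobolevConj N s G (t ^ (1 / (β + 1))) with hA
  have hvol : volume Ω < ⊤ := hΩ.measure_lt_top
  have h1 : ∀ t, 0 ≤ t → t ≤ complementary A t + |A 1| := by
    intro t ht
    have := le_csSup (bddAbove_complementary hN hs0 hG hg hH hβ0 hβ1 ht)
      (mem_image_of_mem (fun τ => t * τ - A τ) (mem_Ici.2 zero_le_one))
    have h2 : t * 1 - A 1 ≤ complementary A t := this
    linarith [le_abs_self (A 1)]
  refine ⟨hkm.aestronglyMeasurable, ?_⟩
  have h3 : ∫⁻ x in Ω, ‖k x‖ₑ ≤ ∫⁻ x in Ω, ENNReal.ofReal l *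
      (ENNReal.ofReal (complementary A (|k x| / l)) + ENNReal.ofReal |A 1|) := by
    refine lintegral_mono fun x => ?_
    rw [Real.enorm_eq_ofReal_abs]
    have h4 : |k x| = l * (|k x| / l) := by field_simp
    conv_lhs => rw [h4]
    rw [ENNReal.ofReal_mul hl.le]
    gcongr
    exact (ENNReal.ofReal_le_ofReal (h1 _ (by positivity))).trans ENNReal.ofReal_add_le
  refine lt_of_le_of_lt h3 ?_
  rw [lintegral_const_mul' _ _ ENNReal.ofReal_ne_top, lintegral_add_right _ measurable_const,
    lintegral_const, Measure.restrict_apply_univ]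
  exact ENNReal.mul_lt_top ENNReal.ofReal_lt_top (ENNReal.add_lt_top.2
    ⟨hfin, ENNReal.mul_lt_top ENNReal.ofReal_lt_top hvol⟩)

end Coefficient

/-! ### Measurable representatives -/

section Representative

variable {N : ℕ} {s : ℝ} {G g : ℝ → ℝ} {pm pp : ℝ}

local notation "ℝᴺ" => EuclideanSpace ℝ (Fin N)

lemma gagliardoModular_congr {S : Set ℝᴺ} {u u' : ℝᴺ → ℝ} (h : u =ᵐ[volume] u') :
    gagliardoModular s G S u = gagliardoModular s G S u' := by
  unfold gagliardoModular
  refine lintegral_congr_ae (ae_restrict_of_ae ?_)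
  filter_upwards [h] with x hx
  refine lintegral_congr_ae (ae_restrict_of_ae ?_)
  filter_upwards [h] with y hy
  rw [hx, hy]

lemma MemW.congr {S : Set ℝᴺ} {u u' : ℝᴺ → ℝ} (hu : MemW s G S u) (h : u =ᵐ[volume] u') :
    MemW s G S u' := by
  obtain ⟨⟨hm, l, hl, h1⟩, l', hl', h2⟩ := hu
  refine ⟨⟨hm.congr (ae_restrict_of_ae h), l, hl, ?_⟩, l', hl', ?_⟩
  · rw [← lintegral_congr_ae (ae_restrict_of_ae (h.mono fun x hx => by
      show ENNReal.ofReal (G (|u x| / l)) = _; rw [hx]))]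
    exact h1
  · rwa [← gagliardoModular_congr (h.mono fun x hx => by
      show u x / l' = u' x / l'; rw [hx])]

lemma operatorIntegrand_congr {u u' : ℝᴺ → ℝ} (h : u =ᵐ[volume] u') (φ : ℝᴺ → ℝ) :
    operatorIntegrand s g u φ =ᵐ[volume.prod volume] operatorIntegrand s g u' φ := by
  filter_upwards [Measure.quasiMeasurePreserving_fst.ae h,
    Measure.quasiMeasurePreserving_snd.ae h] with z h1 h2
  unfold operatorIntegrand
  rw [h1, h2]

lemma sourceIntegrand_congr {f k : ℝᴺ → ℝ} {α β : ℝ} {u u' : ℝᴺ → ℝ} (h : u =ᵐ[volume] u')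
    (φ : ℝᴺ → ℝ) : sourceIntegrand f k α β u φ =ᵐ[volume] sourceIntegrand f k α β u' φ := by
  filter_upwards [h] with x hx
  unfold sourceIntegrand
  rw [hx]

lemma IsAdmissible.congr {Ω : Set ℝᴺ} {f k : ℝᴺ → ℝ} {α β : ℝ} {u u' : ℝᴺ → ℝ}
    (hu : IsAdmissible s G g Ω f k α β u) (h : u =ᵐ[volume] u') :
    IsAdmissible s G g Ω f k α β u' where
  memWloc K hK hKΩ := (hu.memWloc K hK hKΩ).congr h
  pos := by filter_upwards [hu.pos, h] with x h1 h2; rwa [← h2]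
  eq_zero := by filter_upwards [hu.eq_zero, h] with x h1 h2; rwa [← h2]
  boundary := by
    obtain ⟨Ψ, h1, h2, h3⟩ := hu.boundary
    have h4 : (Ω.indicator fun x => Ψ (u x)) =ᵐ[volume] Ω.indicator fun x => Ψ (u' x) := by
      filter_upwards [h] with x hx
      simp only [indicator, hx]
    refine ⟨Ψ, h1, h2.congr h4, ?_⟩
    filter_upwards [h3, h4] with x h5 h6
    rwa [← h6]
  lower_bound K hK hKΩ := by
    obtain ⟨C, hC, h1⟩ := hu.lower_bound K hK hKΩ
    refine ⟨C, hC, ?_⟩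
    filter_upwards [h1, h] with x h2 h3
    rwa [← h3]
  integrable_operator φ hφ := (hu.integrable_operator φ hφ).congr (operatorIntegrand_congr h φ)
  integrable_source φ hφ :=
    (hu.integrable_source φ hφ).congr (ae_restrict_of_ae (sourceIntegrand_congr h φ))

lemma IsWeakSubsolution.congr {Ω : Set ℝᴺ} {f k : ℝᴺ → ℝ} {α β : ℝ} {u u' : ℝᴺ → ℝ}
    (hu : IsWeakSubsolution s G g Ω f k α β u) (h : u =ᵐ[volume] u') :
    IsWeakSubsolution s G g Ω f k α β u' := by
  refine ⟨hu.1.congr h, fun φ hφ => ?_⟩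
  rw [← integral_congr_ae (operatorIntegrand_congr h φ),
    ← integral_congr_ae (ae_restrict_of_ae (sourceIntegrand_congr h φ))]
  exact hu.2 φ hφ

lemma IsWeakSupersolution.congr {Ω : Set ℝᴺ} {f k : ℝᴺ → ℝ} {α β : ℝ} {u u' : ℝᴺ → ℝ}
    (hu : IsWeakSupersolution s G g Ω f k α β u) (h : u =ᵐ[volume] u') :
    IsWeakSupersolution s G g Ω f k α β u' := by
  refine ⟨hu.1.congr h, fun φ hφ => ?_⟩
  rw [← integral_congr_ae (operatorIntegrand_congr h φ),
    ← integral_congr_ae (ae_restrict_of_ae (sourceIntegrand_congr h φ))]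
  exact hu.2 φ hφ

/-- Measurability on `Ω` comes from an exhaustion of `Ω` by compact sets. -/
lemma IsAdmissible.exists_representative {Ω : Set ℝᴺ} (hΩ : IsBoundedLipschitzDomain Ω)
    {f k : ℝᴺ → ℝ} {α β : ℝ} {u : ℝᴺ → ℝ} (hu : IsAdmissible s G g Ω f k α β u) :
    ∃ u' : ℝᴺ → ℝ, u =ᵐ[volume] u' ∧ Measurable u' ∧ (∀ x ∈ Ω, 0 < u' x) ∧
      ∀ x, x ∉ Ω → u' x = 0 := by
  have hm : AEMeasurable u volume := by
    obtain ⟨F, hF1, hF2, hF3, -⟩ := hΩ.isOpen.exists_iUnion_isClosed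
    have h1 : AEMeasurable u (volume.restrict Ω) := by
      rw [← hF3, aemeasurable_iUnion_iff]
      intro n
      exact (hu.memWloc (F n) (Metric.isCompact_of_isClosed_isBounded (hF1 n)
        (hΩ.isBounded.subset (hF2 n))) (hF2 n)).1.1
    refine ((aemeasurable_indicator_iff hΩ.isOpen.measurableSet).2 h1).congr ?_
    filter_upwards [hu.eq_zero] with x hx
    by_cases hxΩ : x ∈ Ω
    · rw [indicator_of_mem hxΩ]
    · rw [indicator_of_notMem hxΩ, hx hxΩ]
  classical
  set v := hm.mk u with hv
  have hvm : Measurable v := hm.measurable_mk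
  refine ⟨Ω.indicator fun x => if 0 < v x then v x else 1, ?_, ?_, ?_, ?_⟩
  · filter_upwards [hm.ae_eq_mk, hu.pos, hu.eq_zero] with x h1 h2 h3
    by_cases hxΩ : x ∈ Ω
    · have h4 : u x = v x := h1
      rw [indicator_of_mem hxΩ, ← h4, if_pos (h2 hxΩ)]
    · rw [indicator_of_notMem hxΩ, h3 hxΩ]
  · exact (Measurable.ite (measurableSet_lt measurable_const hvm) hvm
      measurable_const).indicator hΩ.isOpen.measurableSet
  · intro x hx
    rw [indicator_of_mem hx]
    split_ifs with h
    · exact h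
    · exact one_pos
  · exact fun x hx => indicator_of_notMem hx _

end Representative

/-! ### Energy above a level -/

section Level

variable {N : ℕ} {s : ℝ} {G g : ℝ → ℝ} {pm pp : ℝ}

local notation "ℝᴺ" => EuclideanSpace ℝ (Fin N)

/-- Where one of the two values is at least `ε`, the function `Ψ`, with its value at `0` replaced by
`0`, contracts distances by at most a constant factor. -/
lemma IsFC.exists_le_mul_abs_sub {Ψ : ℝ → ℝ} (hΨ : IsFC Ψ) {ε : ℝ} (hε : 0 < ε) :
    ∃ L, 0 ≤ L ∧ ∀ a b : ℝ, 0 ≤ a → 0 ≤ b → ε ≤ max a b →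
      |a - b| ≤ L * |(if 0 < a then Ψ a else 0) - (if 0 < b then Ψ b else 0)| := by
  obtain ⟨θ₁, θ₂, hθ₁, -, hθ⟩ := hΨ.bounds
  have hd0 : ∀ t, 0 < t → 0 ≤ deriv Ψ t := fun t ht =>
    (mul_nonneg hθ₁ (div_nonneg (hΨ.pos t ht).le ht.le)).trans (hθ t ht).1
  have hdpos : ∀ t, 0 < t → 0 < deriv Ψ t := fun t ht =>
    (hd0 (t / 2) (by positivity)).trans_lt
      (hΨ.deriv_strictMonoOn (mem_Ioi.2 (by positivity)) (mem_Ioi.2 ht) (by linarith))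
  set c := deriv Ψ (ε / 2) with hc
  have hcpos : 0 < c := hdpos _ (by positivity)
  have hdiff : DifferentiableOn ℝ Ψ (Ioi 0) := hΨ.contDiffOn.differentiableOn one_ne_zero
  have hmvt : ∀ a b, 0 < a → a < b → ∃ ξ ∈ Ioo a b, Ψ b - Ψ a = deriv Ψ ξ * (b - a) := by
    intro a b ha hab
    obtain ⟨ξ, hξ, h⟩ := exists_deriv_eq_slope Ψ hab
      (hdiff.continuousOn.mono fun x hx => mem_Ioi.2 (ha.trans_le hx.1))
      (hdiff.mono fun x hx => mem_Ioi.2 (ha.trans hx.1))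
    refine ⟨ξ, hξ, ?_⟩
    rw [h, div_mul_cancel₀]
    linarith
  have hΨmono : ∀ a b, 0 < a → a ≤ b → Ψ a ≤ Ψ b := by
    intro a b ha hab
    rcases hab.eq_or_lt with rfl | hab
    · exact le_rfl
    obtain ⟨ξ, hξ, h⟩ := hmvt a b ha hab
    have := mul_nonneg (hd0 ξ (ha.trans hξ.1)) (sub_nonneg.2 hab.le)
    linarith
  have hslope : ∀ a b, ε / 2 ≤ a → a ≤ b → c * (b - a) ≤ Ψ b - Ψ a := by
    intro a b ha hab
    rcases hab.eq_or_lt with rfl | hab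
    · simp
    obtain ⟨ξ, hξ, h⟩ := hmvt a b (by linarith) hab
    rw [h]
    refine mul_le_mul_of_nonneg_right ?_ (by linarith)
    exact (hΨ.deriv_strictMonoOn (mem_Ioi.2 (by positivity)) (mem_Ioi.2 (by linarith [hξ.1]))
      (by linarith [hξ.1])).le
  have main : ∀ a b, 0 ≤ b → b ≤ a → ε ≤ a →
      c / 2 * (a - b) ≤ Ψ a - (if 0 < b then Ψ b else 0) := by
    intro a b hb hba ha
    rcases le_or_gt (ε / 2) b with h | h
    · rw [if_pos (by linarith)]
      have := hslope b a h hba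
      nlinarith
    · have h1 := hslope (ε / 2) a le_rfl (by linarith)
      have h2 : (if 0 < b then Ψ b else 0) ≤ Ψ (ε / 2) := by
        split_ifs with h3
        · exact hΨmono b _ h3 h.le
        · exact (hΨ.pos _ (by positivity)).le
      nlinarith
  have main' : ∀ a b, 0 ≤ b → b ≤ a → ε ≤ a →
      |a - b| ≤ 2 / c * |(if 0 < a then Ψ a else 0) - (if 0 < b then Ψ b else 0)| := by
    intro a b hb hba ha
    rw [if_pos (show 0 < a by linarith), abs_of_nonneg (by linarith), div_mul_eq_mul_div,
      le_div_iff₀ hcpos]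
    have h1 := main a b hb hba ha
    have h2 := le_abs_self (Ψ a - if 0 < b then Ψ b else 0)
    linarith
  refine ⟨2 / c, by positivity, fun a b ha hb hmax => ?_⟩
  rcases le_total b a with h | h
  · exact main' a b hb h (by rwa [max_eq_left h] at hmax)
  · rw [abs_sub_comm a b, abs_sub_comm (if 0 < a then Ψ a else 0)]
    exact main' b a ha h (by rwa [max_eq_right h] at hmax)

/-- The energy of `u` is finite on the pairs of points at one of which `u` is at least `ε`, as it is
dominated there by the energy of `Ψ(u)`. -/
lemma IsAdmissible.lintegral_energy_level_lt_top (hG : IsNFunction G) (hg : IsDensity G g)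
    (hH : StructuralConditions N s G g pm pp) {Ω : Set ℝᴺ} {f k : ℝᴺ → ℝ} {α β : ℝ} {u : ℝᴺ → ℝ}
    (hu : IsAdmissible s G g Ω f k α β u) (hum : Measurable u) (hupos : ∀ x ∈ Ω, 0 < u x)
    (huz : ∀ x, x ∉ Ω → u x = 0) {ε : ℝ} (hε : 0 < ε) :
    ∫⁻ z in {z : ℝᴺ × ℝᴺ | ε ≤ max (u z.1) (u z.2)}, energy s G u z ∂(volume.prod volume) < ⊤ := by
  obtain ⟨Ψ, hΨ, ⟨-, l, hl, hfin⟩, -⟩ := hu.boundary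
  obtain ⟨L, hL, hle⟩ := hΨ.exists_le_mul_abs_sub hε
  obtain ⟨C, hC, hE⟩ := hg.exists_energy_le (N := N) (s := s) hH (l := L * l) (by positivity)
  have hu0 : ∀ x, 0 ≤ u x := fun x => by
    by_cases hx : x ∈ Ω
    · exact (hupos x hx).le
    · rw [huz x hx]
  have hΨu : ∀ x, Ω.indicator (fun x => Ψ (u x)) x = if 0 < u x then Ψ (u x) else 0 := by
    intro x
    by_cases hx : x ∈ Ω
    · rw [indicator_of_mem hx, if_pos (hupos x hx)]
    · rw [indicator_of_notMem hx, if_neg (by rw [huz x hx]; exact lt_irrefl _)]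
  have hA : MeasurableSet {z : ℝᴺ × ℝᴺ | ε ≤ max (u z.1) (u z.2)} :=
    measurableSet_le measurable_const ((hum.comp measurable_fst).max (hum.comp measurable_snd))
  rw [← lintegral_indicator hA, lintegral_prod _ ((measurable_energy hG hum).indicator hA).aemeasurable]
  refine lt_of_le_of_lt ?_ (ENNReal.mul_lt_top hC.lt_top hfin)
  unfold gagliardoModular
  rw [Measure.restrict_univ, ← lintegral_const_mul' _ _ hC]
  refine lintegral_mono fun x => ?_
  rw [← lintegral_const_mul' _ _ hC]
  refine lintegral_mono fun y => ?_
  by_cases hz : ε ≤ max (u x) (u y)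
  · rw [indicator_of_mem (by exact hz)]
    refine hE u (fun x => Ω.indicator (fun x => Ψ (u x)) x / l) (x, y) ?_
    dsimp only
    rw [hΨu, hΨu, ← sub_div, abs_div, abs_of_pos hl]
    refine (hle _ _ (hu0 x) (hu0 y) hz).trans (le_of_eq ?_)
    field_simp
  · rw [indicator_of_notMem (by exact hz)]
    exact zero_le

/-- The energy of `u` on the pairs of points at one of which `u` exceeds `M` tends to zero. -/
lemma IsAdmissible.tendsto_lintegral_energy_level (hG : IsNFunction G) (hg : IsDensity G g)
    (hH : StructuralConditions N s G g pm pp) {Ω : Set ℝᴺ} {f k : ℝᴺ → ℝ} {α β : ℝ} {u : ℝᴺ → ℝ}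
    (hu : IsAdmissible s G g Ω f k α β u) (hum : Measurable u) (hupos : ∀ x ∈ Ω, 0 < u x)
    (huz : ∀ x, x ∉ Ω → u x = 0) :
    Tendsto (fun M : ℕ => ∫⁻ z in {z : ℝᴺ × ℝᴺ | (M : ℝ) < max (u z.1) (u z.2)},
      energy s G u z ∂(volume.prod volume)) atTop (𝓝 0) := by
  have hmax : Measurable fun z : ℝᴺ × ℝᴺ => max (u z.1) (u z.2) :=
    (hum.comp measurable_fst).max (hum.comp measurable_snd)
  have hA : ∀ M : ℕ, MeasurableSet {z : ℝᴺ × ℝᴺ | (M : ℝ) < max (u z.1) (u z.2)} := fun M =>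
    measurableSet_lt measurable_const hmax
  have hA1 : MeasurableSet {z : ℝᴺ × ℝᴺ | (1 : ℝ) ≤ max (u z.1) (u z.2)} :=
    measurableSet_le measurable_const hmax
  have hfin := hu.lintegral_energy_level_lt_top hG hg hH hum hupos huz one_pos
  rw [← lintegral_indicator hA1] at hfin
  simp_rw [← lintegral_indicator (hA _)]
  rw [show (0 : ENNReal) = ∫⁻ _ : ℝᴺ × ℝᴺ, 0 ∂(volume.prod volume) by simp]
  have hE := measurable_energy (s := s) hG hum
  refine tendsto_lintegral_filter_of_dominated_convergence _
    (Eventually.of_forall fun M => hE.indicator (hA M)) ?_ hfin.ne (ae_of_all _ fun z => ?_)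
  · filter_upwards [eventually_ge_atTop 1] with M hM
    refine ae_of_all _ fun z => indicator_le_indicator_of_subset (fun z hz => ?_)
      (fun _ => zero_le) z
    have h1 : (1 : ℝ) ≤ M := by exact_mod_cast hM
    exact h1.trans (le_of_lt hz)
  · refine tendsto_const_nhds.congr' ?_
    obtain ⟨M₀, hM₀⟩ := exists_nat_ge (max (u z.1) (u z.2))
    filter_upwards [eventually_ge_atTop M₀] with M hM
    rw [indicator_of_notMem]
    have h1 : (M₀ : ℝ) ≤ M := by exact_mod_cast hM
    exact not_lt.2 (hM₀.trans h1)

end Level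

/-! ### Admissibility of the test functions -/

section Test

variable {N : ℕ} {s : ℝ} {G g : ℝ → ℝ} {pm pp : ℝ}

local notation "ℝᴺ" => EuclideanSpace ℝ (Fin N)

lemma IsDensity.exists_energy_add_add_le (hg : IsDensity G g)
    (hH : StructuralConditions N s G g pm pp) {l : ℝ} (hl : 0 ≤ l) :
    ∃ C : ENNReal, C ≠ ⊤ ∧ ∀ (w w₁ w₂ w₃ : ℝᴺ → ℝ) (z : ℝᴺ × ℝᴺ),
      |w z.1 - w z.2| ≤ l * (|w₁ z.1 - w₁ z.2| + |w₂ z.1 - w₂ z.2| + |w₃ z.1 - w₃ z.2|) →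
        energy s G w z ≤ C * (energy s G w₁ z + energy s G w₂ z + energy s G w₃ z) := by
  obtain ⟨C, hC, h⟩ := hg.exists_G_add_le hH hl
  obtain ⟨C', hC', h'⟩ := hg.exists_G_add_le hH (l := 1) zero_le_one
  refine ⟨ENNReal.ofReal (C * (C' + 1)), ENNReal.ofReal_ne_top, fun w w₁ w₂ w₃ z hz => ?_⟩
  unfold energy
  have hG0 : ∀ x : ℝ, 0 ≤ x → 0 ≤ G x := fun x hx => hg.G_nonneg hx
  set ρ := ‖z.1 - z.2‖
  have hD : ∀ w : ℝᴺ → ℝ, 0 ≤ |w z.1 - w z.2| / ρ ^ s := fun w => by positivity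
  rw [← ENNReal.ofReal_add (div_nonneg (hG0 _ (hD _)) (by positivity))
    (div_nonneg (hG0 _ (hD _)) (by positivity)),
    ← ENNReal.ofReal_add (add_nonneg (div_nonneg (hG0 _ (hD _)) (by positivity))
    (div_nonneg (hG0 _ (hD _)) (by positivity))) (div_nonneg (hG0 _ (hD _)) (by positivity)),
    ← ENNReal.ofReal_mul (by positivity)]
  refine ENNReal.ofReal_le_ofReal ?_
  rw [← add_div, ← add_div, ← mul_div_assoc]
  gcongr
  have h1 : |w z.1 - w z.2| / ρ ^ s ≤ l * (|w₁ z.1 - w₁ z.2| / ρ ^ s +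
      |w₂ z.1 - w₂ z.2| / ρ ^ s + |w₃ z.1 - w₃ z.2| / ρ ^ s) := by
    rw [← add_div, ← add_div, ← mul_div_assoc]
    gcongr
  have h2 := (hg.G_mono (hD w) h1).trans (h _ _ (add_nonneg (hD w₁) (hD w₂)) (hD w₃))
  have h3 := h' _ _ (hD w₁) (hD w₂)
  rw [one_mul] at h3
  refine h2.trans ?_
  rw [mul_assoc]
  refine mul_le_mul_of_nonneg_left ?_ hC
  nlinarith [hG0 _ (hD w₁), hG0 _ (hD w₂), hG0 _ (hD w₃)]

lemma IsAdmissible.lintegral_energy_prod_lt_top (hG : IsNFunction G) (hg : IsDensity G g)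
    (hH : StructuralConditions N s G g pm pp) {Ω : Set ℝᴺ} {f k : ℝᴺ → ℝ} {α β : ℝ} {u : ℝᴺ → ℝ}
    (hu : IsAdmissible s G g Ω f k α β u) (hum : Measurable u) {K : Set ℝᴺ} (hK : IsCompact K)
    (hKΩ : K ⊆ Ω) : ∫⁻ z in K ×ˢ K, energy s G u z ∂(volume.prod volume) < ⊤ := by
  obtain ⟨-, l, hl, hfin⟩ := hu.memWloc K hK hKΩ
  rw [gagliardoModular_eq hG (hum.div_const l)] at hfin
  obtain ⟨C, hC, hE⟩ := hg.exists_energy_le (N := N) (s := s) hH (l := l) hl.le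
  refine lt_of_le_of_lt (lintegral_mono fun z => hE u (fun x => u x / l) z ?_)
    ((lintegral_const_mul' C _ hC).trans_lt (ENNReal.mul_lt_top hC.lt_top hfin))
  rw [← sub_div, abs_div, abs_of_pos hl, mul_div_cancel₀ _ hl.ne']

/-- A bounded function with compact support in `Ω` and locally finite energy is a test function:
the interaction of its support with the exterior is controlled by the kernel. -/
lemma isTest_of_local (hN : 1 ≤ N) (hs0 : 0 < s) (hs1 : s < 1) (hG : IsNFunction G)
    (hg : IsDensity G g) {Ω : Set ℝᴺ} (hΩ : IsOpen Ω) {φ : ℝᴺ → ℝ} {B : ℝ} (hφ : Measurable φ)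
    (hφ0 : ∀ x, 0 ≤ φ x) (hφB : ∀ᵐ x, φ x ≤ B) {K : Set ℝᴺ} (hK : IsCompact K) (hKΩ : K ⊆ Ω)
    (hφK : ∀ x, x ∉ K → φ x = 0)
    (hloc : ∀ K' : Set ℝᴺ, IsCompact K' → K' ⊆ Ω →
      ∫⁻ z in K' ×ˢ K', energy s G φ z ∂(volume.prod volume) < ⊤) :
    IsTest s G Ω φ := by
  have hB : 0 ≤ B := by
    obtain ⟨x, hx⟩ := hφB.exists
    exact (hφ0 x).trans hx
  obtain ⟨d, hd, hdΩ⟩ := hK.exists_cthickening_subset_open hΩ hKΩ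
  set K' := Metric.cthickening d K with hK'
  have hK'c : IsCompact K' := hK.cthickening
  have hker := lintegral_prod_kernel_lt_top (N := N) hN hs0 hs1 hG hg (C₁ := B) (C₂ := B / d)
    hB (by positivity) hK.measurableSet hK.measure_lt_top
  have hE : ∫⁻ z, energy s G φ z ∂(volume.prod volume) < ⊤ := by
    have hm : MeasurableSet (K' ×ˢ K') := hK'c.measurableSet.prod hK'c.measurableSet
    have h1 := hloc K' hK'c hdΩ
    rw [← lintegral_indicator hm] at h1
    refine lt_of_le_of_lt (lintegral_mono_ae ?_) ((lintegral_add_left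
      ((measurable_energy hG hφ).indicator hm) _).trans_lt (ENNReal.add_lt_top.2 ⟨h1, hker⟩))
    filter_upwards [Measure.quasiMeasurePreserving_fst.ae hφB,
      Measure.quasiMeasurePreserving_snd.ae hφB] with z hz1 hz2
    by_cases hz : z ∈ K' ×ˢ K'
    · rw [indicator_of_mem hz]; exact le_self_add
    rw [indicator_of_notMem hz, zero_add]
    by_cases hz' : z ∈ K ×ˢ univ ∪ univ ×ˢ K
    · rw [indicator_of_mem hz']
      refine energy_le_kernel hg (le_min ?_ ?_)
      · rw [abs_le]; constructor <;> linarith [hφ0 z.1, hφ0 z.2]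
      · have hdist : d ≤ ‖z.1 - z.2‖ := by
          by_contra hcon
          push Not at hcon
          rw [← dist_eq_norm] at hcon
          have hKK' : K ⊆ K' := Metric.self_subset_cthickening K
          rcases hz' with h | h
          · exact hz ⟨hKK' h.1, Metric.mem_cthickening_of_dist_le _ _ _ _ h.1
              (by rw [dist_comm]; exact hcon.le)⟩
          · exact hz ⟨Metric.mem_cthickening_of_dist_le _ _ _ _ h.2 hcon.le, hKK' h.2⟩
        calc |φ z.1 - φ z.2| ≤ B := by
              rw [abs_le]; constructor <;> linarith [hφ0 z.1, hφ0 z.2]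
          _ = B / d * d := by field_simp
          _ ≤ _ := mul_le_mul_of_nonneg_left hdist (by positivity)
    · have h1 : z.1 ∉ K ∧ z.2 ∉ K := by simpa using hz'
      rw [energy_eq_zero hg (by rw [hφK _ h1.1, hφK _ h1.2])]
      exact zero_le
  refine ⟨⟨⟨⟨hφ.aemeasurable, 1, one_pos, ?_⟩, 1, one_pos, ?_⟩, ?_⟩, ⟨B, ?_⟩,
    ⟨K, hK, hKΩ, ae_of_all _ hφK⟩, ae_of_all _ hφ0⟩
  · rw [Measure.restrict_univ]
    have : ∫⁻ x, K.indicator (fun _ => ENNReal.ofReal (G B)) x < ⊤ := by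
      rw [lintegral_indicator hK.measurableSet, setLIntegral_const]
      exact ENNReal.mul_lt_top ENNReal.ofReal_lt_top hK.measure_lt_top
    refine lt_of_le_of_lt (lintegral_mono_ae ?_) this
    filter_upwards [hφB] with x hx
    by_cases hxK : x ∈ K
    · rw [indicator_of_mem hxK, div_one, abs_of_nonneg (hφ0 x)]
      exact ENNReal.ofReal_le_ofReal (hg.G_mono (hφ0 x) hx)
    · simp [hφK x hxK, hg.G_zero]
  · simp only [div_one]
    rwa [gagliardoModular_univ_eq hG hφ]
  · exact ae_of_all _ fun x hx => hφK x fun h => hx (hKΩ h)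
  · filter_upwards [hφB] with x hx
    rwa [abs_of_nonneg (hφ0 x)]

lemma measurable_excess {p : ℝ} {m v : ℝᴺ → ℝ} (hm : Measurable m) (hv : Measurable v) :
    Measurable fun x => excess p (m x) (v x) :=
  ((hm.pow_const p).sub (hv.pow_const p)).max measurable_const

/-- The test function for the sub-solution; its energy is controlled by that of `w`, `m`, `v`. -/
lemma isTest_excess_div_left (hN : 1 ≤ N) (hs0 : 0 < s) (hs1 : s < 1) (hG : IsNFunction G)
    (hg : IsDensity G g) (hH : StructuralConditions N s G g pm pp) {Ω : Set ℝᴺ} (hΩ : IsOpen Ω)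
    {f k : ℝᴺ → ℝ} {α β : ℝ} {v w m : ℝᴺ → ℝ} {B : ℝ}
    (hv : IsAdmissible s G g Ω f k α β v) (hvm : Measurable v) (hv0 : ∀ x, 0 ≤ v x)
    (hwm : Measurable w) (hwE : ∫⁻ z, energy s G w z ∂(volume.prod volume) < ⊤)
    (hmm : Measurable m) (hm0 : ∀ x, 0 ≤ m x) (hmw : ∀ x, m x ≤ w x) (hmB : ∀ x, m x ≤ B)
    (hmE : ∫⁻ z, energy s G m z ∂(volume.prod volume) < ⊤)
    {K : Set ℝᴺ} (hK : IsCompact K) (hKΩ : K ⊆ Ω) (hmK : ∀ x, x ∉ K → m x = 0) :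
    IsTest s G Ω fun x => excess pm (m x) (v x) / w x ^ (pm - 1) := by
  have hp : 1 < pm := by linarith [hH.one_lt]
  have hw0 : ∀ x, 0 ≤ w x := fun x => (hm0 x).trans (hmw x)
  have hφm : Measurable fun x => excess pm (m x) (v x) / w x ^ (pm - 1) :=
    (measurable_excess hmm hvm).div (hwm.pow_const _)
  refine isTest_of_local hN hs0 hs1 hG hg hΩ (B := B) hφm
    (fun x => div_nonneg (excess_nonneg _ _) (Real.rpow_nonneg (hw0 x) _))
    (ae_of_all _ fun x => ?_) hK hKΩ (fun x hx => ?_) fun K' hK' hK'Ω => ?_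
  · rw [excess_div_left hp _ (hm0 x) (hv0 x)]
    have h1 := persp_le_self hp (hm0 x) (hmw x)
    have h2 := persp_nonneg (p := pm) (le_min (hv0 x) (hm0 x)) (hw0 x)
    linarith [hmB x]
  · simp only [hmK x hx, excess_eq_zero hp le_rfl (hv0 x), zero_div]
  · obtain ⟨C, hC, hE⟩ := hg.exists_energy_add_add_le (N := N) (s := s) hH (l := 2 * pm)
      (by linarith)
    have h1 : ∀ z : ℝᴺ × ℝᴺ, energy s G (fun x => excess pm (m x) (v x) / w x ^ (pm - 1)) z ≤
        C * (energy s G m z + energy s G w z + energy s G v z) := fun z =>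
      hE _ _ _ _ z (abs_excess_div_sub_le hp (hm0 _) (hmw _) (hv0 _) (hm0 _) (hmw _) (hv0 _))
    refine (lintegral_mono fun z => h1 z).trans_lt ?_
    have hmeas := fun (w : ℝᴺ → ℝ) (hw : Measurable w) => measurable_energy (s := s) hG hw
    rw [lintegral_const_mul' _ _ hC, lintegral_add_right _ (hmeas v hvm),
      lintegral_add_left (hmeas m hmm)]
    exact ENNReal.mul_lt_top hC.lt_top (ENNReal.add_lt_top.2 ⟨ENNReal.add_lt_top.2
      ⟨(setLIntegral_le_lintegral _ _).trans_lt hmE, (setLIntegral_le_lintegral _ _).trans_lt hwE⟩,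
      hv.lintegral_energy_prod_lt_top hG hg hH hvm hK' hK'Ω⟩)

lemma abs_max_persp_sub_le {p : ℝ} (hp : 1 < p) {B c m v m' v' : ℝ} (hc : 0 < c) (hm : 0 ≤ m)
    (hmB : m ≤ B) (hv : c ≤ v) (hm' : 0 ≤ m') (hmB' : m' ≤ B) (hv' : c ≤ v') :
    |max (persp p m v - v) 0 - max (persp p m' v' - v') 0| ≤
      (p * (B / c) ^ (p - 1) + p * (B / c) ^ p + 1) * (|m - m'| + |v - v'|) := by
  have hB : 0 ≤ B := hm.trans hmB
  set a := (B / c) ^ (p - 1) with ha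
  set b := (B / c) ^ p with hb
  have ha0 : 0 ≤ a := by positivity
  have hb0 : 0 ≤ b := by positivity
  have aux : ∀ m v m' v', 0 ≤ m → m ≤ B → c ≤ v → 0 ≤ m' → m' ≤ B → c ≤ v' →
      persp p m v - persp p m' v' ≤ p * a * |m - m'| + p * b * |v - v'| := by
    intro m v m' v' hm hmB hv hm' hmB' hv'
    have hv0 : 0 < v := hc.trans_le hv
    have h1 := persp_sub_le hp hm hv0 hm' (hc.le.trans hv') fun h => by linarith
    have hq : m / v ≤ B / c := div_le_div₀ hB hmB hc hv
    have hq0 : 0 ≤ m / v := by positivity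
    have h2 : (m / v) ^ (p - 1) ≤ a := Real.rpow_le_rpow hq0 hq (by linarith)
    have h3 : (m / v) ^ p ≤ b := Real.rpow_le_rpow hq0 hq (by linarith)
    have h2' : 0 ≤ (m / v) ^ (p - 1) := by positivity
    have h3' : 0 ≤ (m / v) ^ p := by positivity
    have h4 : p * (m / v) ^ (p - 1) * (m - m') ≤ p * a * |m - m'| := by
      calc p * (m / v) ^ (p - 1) * (m - m') ≤ p * (m / v) ^ (p - 1) * |m - m'| :=
            mul_le_mul_of_nonneg_left (le_abs_self _) (by positivity)
        _ ≤ _ := by gcongr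
    have h5 : -((p - 1) * (m / v) ^ p * (v - v')) ≤ p * b * |v - v'| := by
      calc -((p - 1) * (m / v) ^ p * (v - v')) = (p - 1) * (m / v) ^ p * (-(v - v')) := by ring
        _ ≤ (p - 1) * (m / v) ^ p * |v - v'| :=
          mul_le_mul_of_nonneg_left (neg_le_abs _) (mul_nonneg (by linarith) h3')
        _ ≤ _ := by gcongr; linarith
    linarith
  have h1 : |persp p m v - persp p m' v'| ≤ p * a * |m - m'| + p * b * |v - v'| := by
    rw [abs_le]
    have h2 := aux m v m' v' hm hmB hv hm' hmB' hv'
    have h3 := aux m' v' m v hm' hmB' hv' hm hmB hv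
    rw [abs_sub_comm m' m, abs_sub_comm v' v] at h3
    constructor <;> linarith
  refine (abs_max_sub_max_le_abs _ _ _).trans ?_
  have h2 : |persp p m v - v - (persp p m' v' - v')| ≤ |persp p m v - persp p m' v'| + |v - v'| := by
    rw [show persp p m v - v - (persp p m' v' - v') =
      (persp p m v - persp p m' v') - (v - v') by ring]
    exact abs_sub _ _
  have h3 : 0 ≤ p * a * |v - v'| := by positivity
  have h4 : 0 ≤ p * b * |m - m'| := by positivity
  nlinarith [abs_nonneg (m - m')]

/-- The test function for the super-solution; its energy is controlled since `v` is bounded below by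
a positive constant on compact subsets of `Ω`. -/
lemma isTest_excess_div_right (hN : 1 ≤ N) (hs0 : 0 < s) (hs1 : s < 1) (hG : IsNFunction G)
    (hg : IsDensity G g) (hH : StructuralConditions N s G g pm pp) {Ω : Set ℝᴺ} (hΩ : IsOpen Ω)
    {f k : ℝᴺ → ℝ} {α β : ℝ} {v m : ℝᴺ → ℝ} {B : ℝ}
    (hv : IsAdmissible s G g Ω f k α β v) (hvm : Measurable v) (hv0 : ∀ x, 0 ≤ v x)
    (hmm : Measurable m) (hm0 : ∀ x, 0 ≤ m x) (hmB : ∀ x, m x ≤ B)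
    (hmE : ∫⁻ z, energy s G m z ∂(volume.prod volume) < ⊤)
    {K : Set ℝᴺ} (hK : IsCompact K) (hKΩ : K ⊆ Ω) (hmK : ∀ x, x ∉ K → m x = 0) :
    IsTest s G Ω fun x => excess pm (m x) (v x) / v x ^ (pm - 1) := by
  have hp : 1 < pm := by linarith [hH.one_lt]
  have hB : 0 ≤ B := (hm0 0).trans (hmB 0)
  have hφm : Measurable fun x => excess pm (m x) (v x) / v x ^ (pm - 1) :=
    (measurable_excess hmm hvm).div (hvm.pow_const _)
  obtain ⟨c, hc, hcK⟩ := hv.lower_bound K hK hKΩ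
  refine isTest_of_local hN hs0 hs1 hG hg hΩ (B := B ^ pm / c ^ (pm - 1)) hφm
    (fun x => div_nonneg (excess_nonneg _ _) (Real.rpow_nonneg (hv0 x) _)) ?_ hK hKΩ
    (fun x hx => ?_) fun K' hK' hK'Ω => ?_
  · filter_upwards [hcK] with x hx
    by_cases hxK : x ∈ K
    · have hD : excess pm (m x) (v x) ≤ B ^ pm := by
        refine max_le ?_ (by positivity)
        have h1 : m x ^ pm ≤ B ^ pm := Real.rpow_le_rpow (hm0 x) (hmB x) (by linarith)
        have h2 : 0 ≤ v x ^ pm := Real.rpow_nonneg (hv0 x) _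
        linarith
      exact div_le_div₀ (by positivity) hD (by positivity)
        (Real.rpow_le_rpow hc.le (hx hxK) (by linarith))
    · rw [hmK x hxK, excess_eq_zero hp le_rfl (hv0 x), zero_div]
      positivity
  · simp only [hmK x hx, excess_eq_zero hp le_rfl (hv0 x), zero_div]
  · obtain ⟨c', hc', hcK'⟩ := hv.lower_bound K' hK' hK'Ω
    obtain ⟨C, hC, hE⟩ := hg.exists_energy_add_le (N := N) (s := s) hH
      (l := pm * (B / c') ^ (pm - 1) + pm * (B / c') ^ pm + 1) (by positivity)
    have hmK' : MeasurableSet (K' ×ˢ K') := hK'.measurableSet.prod hK'.measurableSet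
    have h1 : ∀ᵐ z ∂(volume.prod volume).restrict (K' ×ˢ K'),
        energy s G (fun x => excess pm (m x) (v x) / v x ^ (pm - 1)) z ≤
        C * (energy s G m z + energy s G v z) := by
      rw [ae_restrict_iff' hmK']
      filter_upwards [Measure.quasiMeasurePreserving_fst.ae hcK',
        Measure.quasiMeasurePreserving_snd.ae hcK'] with z hz1 hz2 hz
      refine hE _ _ _ z ?_
      rw [excess_div_right hp (hv0 _), excess_div_right hp (hv0 _)]
      exact abs_max_persp_sub_le hp hc' (hm0 _) (hmB _) (hz1 hz.1) (hm0 _) (hmB _) (hz2 hz.2)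
    refine (lintegral_mono_ae h1).trans_lt ?_
    rw [lintegral_const_mul' _ _ hC, lintegral_add_left (measurable_energy hG hmm)]
    exact ENNReal.mul_lt_top hC.lt_top (ENNReal.add_lt_top.2
      ⟨(setLIntegral_le_lintegral _ _).trans_lt hmE,
      hv.lintegral_energy_prod_lt_top hG hg hH hvm hK' hK'Ω⟩)

end Test

/-! ### Estimates for the operator and for the source -/

section Estimates

variable {N : ℕ} {s : ℝ} {G g : ℝ → ℝ} {pm pp : ℝ}

local notation "ℝᴺ" => EuclideanSpace ℝ (Fin N)

lemma operatorIntegrand_eq (u φ : ℝᴺ → ℝ) (z : ℝᴺ × ℝᴺ) :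
    operatorIntegrand s g u φ z =
      flux (fun t => g (t / ‖z.1 - z.2‖ ^ s)) (u z.1 - u z.2) * (φ z.1 - φ z.2) /
        ‖z.1 - z.2‖ ^ ((N : ℝ) + s) := by
  unfold operatorIntegrand flux
  rw [mul_div_assoc]

/-- The negative part of the difference of the two tested operators is controlled by the energies
of `w = (u - e)⁺` and `m`, and it vanishes where `m = w`. -/
lemma exists_operatorIntegrand_sub_le (hN : 1 ≤ N) (hs0 : 0 < s) (hg : IsDensity G g)
    (hH : StructuralConditions N s G g pm pp) :
    ∃ C : ENNReal, C ≠ ⊤ ∧ ∀ (u v m : ℝᴺ → ℝ) (e : ℝ) (z : ℝᴺ × ℝᴺ), (∀ x, 0 ≤ u x) →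
      (∀ x, 0 ≤ v x) → (∀ x, 0 ≤ m x) → (∀ x, m x ≤ max (u x - e) 0) →
      (∀ x, v x = 0 → u x = 0) → 0 ≤ e →
      ENNReal.ofReal (-(operatorIntegrand s g u
          (fun x => excess pm (m x) (v x) / max (u x - e) 0 ^ (pm - 1)) z -
        operatorIntegrand s g v (fun x => excess pm (m x) (v x) / v x ^ (pm - 1)) z)) ≤
      {z : ℝᴺ × ℝᴺ | m z.1 ≠ max (u z.1 - e) 0 ∨ m z.2 ≠ max (u z.2 - e) 0}.indicator
        (fun z => C * (energy s G (fun x => max (u x - e) 0) z + energy s G m z)) z := by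
  have hp : 2 ≤ pm := by linarith [hH.one_lt]
  have hp1 : 1 < pm := by linarith
  obtain ⟨C₁, hC₁, h₁⟩ := hg.exists_mul_le_G hH (l := 4 * pm) (by linarith)
  obtain ⟨C₂, hC₂, h₂⟩ := hg.exists_G_add_le hH (l := 1) zero_le_one
  refine ⟨ENNReal.ofReal (20 * pm ^ (2 : ℕ) * (C₁ * C₂)), ENNReal.ofReal_ne_top,
    fun u v m e z hu hv hm hmw huv he => ?_⟩
  set w : ℝᴺ → ℝ := fun x => max (u x - e) 0 with hw
  have hw0 : ∀ x, 0 ≤ w x := fun x => le_max_right _ _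
  have hvw : ∀ x, v x = 0 → w x = 0 := fun x hx => by
    simp only [hw, huv x hx]; exact max_eq_right (by linarith)
  have hvm : ∀ x, v x = 0 → m x = 0 := fun x hx =>
    le_antisymm ((hmw x).trans (hvw x hx).le) (hm x)
  set ρ := ‖z.1 - z.2‖ with hρ
  have hρ0 : 0 ≤ ρ := norm_nonneg _
  set gρ : ℝ → ℝ := fun t => g (t / ρ ^ s) with hgρ
  have hpow : IsPowerMono pm gρ := hg.isPowerMono hH (by positivity)
  set φ : ℝᴺ → ℝ := fun x => excess pm (m x) (v x) / w x ^ (pm - 1) with hφ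
  have hφ0 : ∀ x, 0 ≤ φ x := fun x =>
    div_nonneg (excess_nonneg _ _) (Real.rpow_nonneg (hw0 x) _)
  have hφz : ∀ x, u x ≤ e → φ x = 0 := fun x hx => by
    have h1 : w x = 0 := max_eq_right (by linarith)
    have h2 : m x = 0 := le_antisymm ((hmw x).trans h1.le) (hm x)
    simp only [hφ, h2, excess_eq_zero hp1 le_rfl (hv x), zero_div]
  have key : testedFlux pm gρ (w z.1) (m z.1) (v z.1) (w z.2) (m z.2) (v z.2) /
      ρ ^ ((N : ℝ) + s) ≤ operatorIntegrand s g u φ z -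
        operatorIntegrand s g v (fun x => excess pm (m x) (v x) / v x ^ (pm - 1)) z := by
    rw [operatorIntegrand_eq, operatorIntegrand_eq, ← sub_div]
    refine div_le_div_of_nonneg_right ?_ (by positivity)
    unfold testedFlux
    have := flux_posPart_mul_le hpow (hu z.1) (hu z.2) (hφ0 z.1) (hφ0 z.2)
      (hφz z.1) (hφz z.2)
    exact sub_le_sub_right this _
  by_cases hz : m z.1 = w z.1 ∧ m z.2 = w z.2
  · have h0 : 0 ≤ testedFlux pm gρ (w z.1) (m z.1) (v z.1) (w z.2) (m z.2) (v z.2) := by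
      rw [hz.1, hz.2]
      exact testedFlux_self_nonneg hp1 hpow (hw0 _) (hv _) (hvw _) (hw0 _) (hv _) (hvw _)
    have h1 : 0 ≤ testedFlux pm gρ (w z.1) (m z.1) (v z.1) (w z.2) (m z.2) (v z.2) /
      ρ ^ ((N : ℝ) + s) := by positivity
    rw [ENNReal.ofReal_of_nonpos (by linarith)]
    exact zero_le
  · rw [indicator_of_mem (by
      show m z.1 ≠ w z.1 ∨ m z.2 ≠ w z.2
      tauto)]
    have h1 := neg_le_testedFlux hp hpow (hm z.1) (hmw z.1) (hv z.1) (hvm z.1) (hm z.2) (hmw z.2)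
      (hv z.2) (hvm z.2)
    set a := |w z.1 - w z.2| with ha
    set b := |m z.1 - m z.2| with hb
    have hG0 : ∀ x : ℝ, 0 ≤ x → 0 ≤ G x := fun x hx => hg.G_nonneg hx
    have hGa : 0 ≤ G (a / ρ ^ s) := hG0 _ (by positivity)
    have hGb : 0 ≤ G (b / ρ ^ s) := hG0 _ (by positivity)
    have h2 : gρ (4 * pm * (a + b)) * (a + b) / ρ ^ ((N : ℝ) + s) ≤
        C₁ * C₂ * ((G (a / ρ ^ s) + G (b / ρ ^ s)) / ρ ^ N) := by
      rcases hρ0.eq_or_lt with h0 | hpos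
      · rw [← h0, Real.zero_rpow (show (N : ℝ) + s ≠ 0 by positivity), div_zero]
        rw [← h0] at hGa hGb
        positivity
      · have h3 := h₁ ((a + b) / ρ ^ s) (by positivity)
        have h4 := h₂ (a / ρ ^ s) (b / ρ ^ s) (by positivity) (by positivity)
        rw [one_mul, ← add_div] at h4
        have h5 : gρ (4 * pm * (a + b)) * (a + b) / ρ ^ ((N : ℝ) + s) =
            g (4 * pm * ((a + b) / ρ ^ s)) * ((a + b) / ρ ^ s) / ρ ^ N := by
          rw [Real.rpow_add hpos, Real.rpow_natCast]
          simp only [hgρ]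
          rw [mul_div_assoc (4 * pm)]
          field_simp
        rw [h5, ← mul_div_assoc (C₁ * C₂)]
        refine div_le_div_of_nonneg_right ?_ (by positivity)
        refine h3.trans ?_
        rw [mul_assoc]
        exact mul_le_mul_of_nonneg_left h4 hC₁
    unfold energy
    rw [← ENNReal.ofReal_add (div_nonneg hGa (by positivity)) (div_nonneg hGb (by positivity)),
      ← ENNReal.ofReal_mul (by positivity)]
    refine ENNReal.ofReal_le_ofReal ?_
    have h6 : -(20 * pm ^ (2 : ℕ)) * (gρ (4 * pm * (a + b)) * (a + b) / ρ ^ ((N : ℝ) + s)) ≤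
        testedFlux pm gρ (w z.1) (m z.1) (v z.1) (w z.2) (m z.2) (v z.2) /
          ρ ^ ((N : ℝ) + s) := by
      rw [← mul_div_assoc]
      refine div_le_div_of_nonneg_right ?_ (by positivity)
      linarith
    have h7 := mul_le_mul_of_nonneg_left h2 (show 0 ≤ 20 * pm ^ (2 : ℕ) by positivity)
    rw [← add_div, mul_assoc (20 * pm ^ (2 : ℕ))]
    linarith

lemma rpow_div_rpow_le {β q a b : ℝ} (hβ : β ≤ q) (ha : 0 < a) (hab : a ≤ b) :
    b ^ β / b ^ q ≤ a ^ β / a ^ q := by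
  rw [← Real.rpow_sub ha, ← Real.rpow_sub (ha.trans_le hab)]
  exact Real.rpow_le_rpow_of_nonpos ha hab (by linarith)

/-- The source terms decrease from `v` to `w`, up to the error of replacing `u` by `w ≤ u` in the
power `u ^ β`. -/
lemma source_sub_le {p α β f k u v w m M : ℝ} (hp : 1 < p) (hα : 0 < α) (hβ0 : 0 < β)
    (hf : 0 ≤ f) (hk : 0 ≤ k) (hv : 0 < v) (hm : 0 ≤ m) (hmw : m ≤ w)
    (hmM : m ≤ M) (hwu : w ≤ u) :
    (f * u ^ (-α) + k * u ^ β) * (excess p m v / w ^ (p - 1)) -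
        (f * v ^ (-α) + k * v ^ β) * (excess p m v / v ^ (p - 1)) ≤
      -(k * excess p m v * (v ^ β / v ^ (p - 1) - w ^ β / w ^ (p - 1))) +
        k * (min w M ^ p / w ^ (p - 1) * (u ^ β - w ^ β)) := by
  have hw0 : 0 ≤ w := hm.trans hmw
  have huw : 0 ≤ u ^ β - w ^ β := sub_nonneg.2 (Real.rpow_le_rpow hw0 hwu hβ0.le)
  have hmin : 0 ≤ min w M := le_min hw0 (hm.trans hmM)
  rcases le_or_gt m v with h | h
  · rw [excess_eq_zero hp hm h]
    have : 0 ≤ k * (min w M ^ p / w ^ (p - 1) * (u ^ β - w ^ β)) := by positivity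
    simpa using this
  have hw : 0 < w := by linarith
  have hD0 := excess_nonneg (p := p) m v
  have hD : excess p m v ≤ min w M ^ p := by
    rw [excess_of_le hp hv.le h.le]
    have h1 : m ^ p ≤ min w M ^ p := Real.rpow_le_rpow hm (le_min hmw hmM) (by linarith)
    have h2 : 0 ≤ v ^ p := by positivity
    linarith
  have h1 : u ^ (-α) ≤ v ^ (-α) := Real.rpow_le_rpow_of_nonpos hv (by linarith) (by linarith)
  have h2 : excess p m v / w ^ (p - 1) ≤ excess p m v / v ^ (p - 1) :=
    div_le_div_of_nonneg_left hD0 (by positivity)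
      (Real.rpow_le_rpow hv.le (by linarith) (by linarith))
  have h3 : f * u ^ (-α) * (excess p m v / w ^ (p - 1)) ≤
      f * v ^ (-α) * (excess p m v / v ^ (p - 1)) := by
    have : 0 ≤ f * v ^ (-α) := by positivity
    exact mul_le_mul (mul_le_mul_of_nonneg_left h1 hf) h2 (by positivity) this
  have h4 : k * (u ^ β - w ^ β) * (excess p m v / w ^ (p - 1)) ≤
      k * (u ^ β - w ^ β) * (min w M ^ p / w ^ (p - 1)) := by gcongr
  have h5 : k * u ^ β * (excess p m v / w ^ (p - 1)) =
      k * (u ^ β - w ^ β) * (excess p m v / w ^ (p - 1)) +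
        k * excess p m v * (w ^ β / w ^ (p - 1)) := by ring
  have h6 : k * v ^ β * (excess p m v / v ^ (p - 1)) =
      k * excess p m v * (v ^ β / v ^ (p - 1)) := by ring
  linarith

/-- The error in `source_sub_le` is bounded uniformly in `e` for a fixed level `M`; `β < p - 1` is
used where `w` is large. -/
lemma source_error_le {p β u w M e : ℝ} (hp : 1 < p) (hβ0 : 0 < β) (hβ1 : β < p - 1)
    (hM : 0 ≤ M) (he0 : 0 ≤ e) (he1 : e ≤ 1) (hw : w = max (u - e) 0) :
    min w M ^ p / w ^ (p - 1) * (u ^ β - w ^ β) ≤ 2 ^ β * (1 + M ^ p) := by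
  have hw0 : 0 ≤ w := by rw [hw]; exact le_max_right _ _
  have hrhs : 0 ≤ 2 ^ β * (1 + M ^ p) := by positivity
  rcases hw0.eq_or_lt with h0 | hpos
  · rw [← h0, min_eq_left hM, Real.zero_rpow (by linarith)]
    simpa using hrhs
  have hu : u ≤ w + 1 := by
    have : u - e ≤ w := by rw [hw]; exact le_max_left _ _
    linarith
  have hu1 : 0 ≤ u := by
    by_contra hcon
    by_cases h : u - e ≤ 0
    · rw [hw, max_eq_right h] at hpos; exact lt_irrefl _ hpos
    · rw [hw, max_eq_left (not_le.1 h).le] at hpos hu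
      linarith
  have hmin : 0 ≤ min w M := le_min hw0 hM
  have hfac : 0 ≤ min w M ^ p / w ^ (p - 1) := by positivity
  have hwβ : 0 ≤ w ^ β := by positivity
  have h1 : min w M ^ p / w ^ (p - 1) * (u ^ β - w ^ β) ≤
      min w M ^ p / w ^ (p - 1) * u ^ β :=
    mul_le_mul_of_nonneg_left (by linarith) hfac
  refine h1.trans ?_
  rcases le_total w 1 with hw1 | hw1
  · have h2 : min w M ^ p / w ^ (p - 1) ≤ 1 := by
      have := persp_le_self hp hmin (min_le_left w M)
      exact this.trans ((min_le_left _ _).trans hw1)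
    have h3 : u ^ β ≤ 2 ^ β := Real.rpow_le_rpow hu1 (by linarith) hβ0.le
    have h4 : 0 ≤ M ^ p := by positivity
    calc min w M ^ p / w ^ (p - 1) * u ^ β ≤ 1 * 2 ^ β :=
          mul_le_mul h2 h3 (by positivity) zero_le_one
      _ ≤ _ := by
        have : (0 : ℝ) ≤ 2 ^ β := by positivity
        nlinarith
  · have h2 : min w M ^ p ≤ M ^ p := Real.rpow_le_rpow hmin (min_le_right _ _) (by linarith)
    have h3 : u ^ β ≤ 2 ^ β * w ^ β := by
      rw [← Real.mul_rpow (by norm_num) hw0]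
      exact Real.rpow_le_rpow hu1 (by linarith) hβ0.le
    have h4 : w ^ β / w ^ (p - 1) ≤ 1 := by
      rw [div_le_one (by positivity)]
      exact Real.rpow_le_rpow_of_exponent_le hw1 hβ1.le
    calc min w M ^ p / w ^ (p - 1) * u ^ β ≤ M ^ p / w ^ (p - 1) * (2 ^ β * w ^ β) := by gcongr
      _ = 2 ^ β * M ^ p * (w ^ β / w ^ (p - 1)) := by ring
      _ ≤ 2 ^ β * M ^ p * 1 := mul_le_mul_of_nonneg_left h4 (by positivity)
      _ ≤ _ := by
        have : (0 : ℝ) ≤ 2 ^ β := by positivity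
        nlinarith

/-- Fatou's lemma for an almost everywhere convergent sequence, with a convergent bound. -/
lemma lintegral_le_of_tendsto_of_le {X : Type*} [MeasurableSpace X] {μ : Measure X}
    {F : ℕ → X → ENNReal} {F₀ : X → ENNReal} {b : ℕ → ENNReal} {b₀ : ENNReal}
    (hF : ∀ n, AEMeasurable (F n) μ) (hlim : ∀ᵐ x ∂μ, Tendsto (fun n => F n x) atTop (𝓝 (F₀ x)))
    (hle : ∀ n, ∫⁻ x, F n x ∂μ ≤ b n) (hb : Tendsto b atTop (𝓝 b₀)) :
    ∫⁻ x, F₀ x ∂μ ≤ b₀ :=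
  calc ∫⁻ x, F₀ x ∂μ = ∫⁻ x, liminf (fun n => F n x) atTop ∂μ :=
        lintegral_congr_ae (hlim.mono fun x hx => hx.liminf_eq.symm)
    _ ≤ liminf (fun n => ∫⁻ x, F n x ∂μ) atTop := lintegral_liminf_le' hF
    _ ≤ liminf b atTop := liminf_le_liminf (Eventually.of_forall hle)
    _ = b₀ := hb.liminf_eq

lemma ofReal_integral_le_lintegral {X : Type*} [MeasurableSpace X] {μ : Measure X} {h : X → ℝ}
    (hh : Integrable h μ) : ENNReal.ofReal (∫ x, h x ∂μ) ≤ ∫⁻ x, ENNReal.ofReal (h x) ∂μ := by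
  have h1 : ∫ x, h x ∂μ ≤ ∫ x, max (h x) 0 ∂μ :=
    integral_mono hh hh.pos_part fun x => le_max_left _ _
  refine (ENNReal.ofReal_le_ofReal h1).trans ?_
  rw [ofReal_integral_eq_lintegral_ofReal hh.pos_part (ae_of_all _ fun x => le_max_right _ _)]
  refine lintegral_mono fun x => ?_
  rcases le_total (h x) 0 with h2 | h2
  · simp [max_eq_right h2]
  · simp [max_eq_left h2]

end Estimates

/-! ### The comparison inequality and the limits -/

section Limits

variable {N : ℕ} {s : ℝ} {G g : ℝ → ℝ} {pm pp : ℝ}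

local notation "ℝᴺ" => EuclideanSpace ℝ (Fin N)

/-- Testing the sub-solution `u` and the super-solution `v` with the matched functions
`(m ^ pm - v ^ pm)⁺ / w ^ (pm - 1)` and `(m ^ pm - v ^ pm)⁺ / v ^ (pm - 1)`, where `w = (u - e)⁺`
and `m ≤ min w M` has compact support. The hypothesis `hC` is the bound from
`exists_operatorIntegrand_sub_le`. -/
lemma lintegral_source_le (hN : 1 ≤ N) (hs0 : 0 < s) (hs1 : s < 1) (hG : IsNFunction G)
    (hg : IsDensity G g) (hH : StructuralConditions N s G g pm pp) {Ω : Set ℝᴺ} (hΩ : IsOpen Ω)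
    {α β : ℝ} (hα : 0 < α) (hβ0 : 0 < β) (hβ1 : β < pm - 1) {f k : ℝᴺ → ℝ}
    (hf0 : ∀ᵐ x, x ∈ Ω → 0 ≤ f x) (hk0 : ∀ᵐ x, x ∈ Ω → 0 < k x) (hk : IntegrableOn k Ω)
    {u v m : ℝᴺ → ℝ} {e M : ℝ} {C : ENNReal}
    (hC : ∀ z : ℝᴺ × ℝᴺ, ENNReal.ofReal (-(operatorIntegrand s g u
          (fun x => excess pm (m x) (v x) / max (u x - e) 0 ^ (pm - 1)) z -
        operatorIntegrand s g v (fun x => excess pm (m x) (v x) / v x ^ (pm - 1)) z)) ≤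
      {z : ℝᴺ × ℝᴺ | m z.1 ≠ max (u z.1 - e) 0 ∨ m z.2 ≠ max (u z.2 - e) 0}.indicator
        (fun z => C * (energy s G (fun x => max (u x - e) 0) z + energy s G m z)) z)
    (hu : IsWeakSubsolution s G g Ω f k α β u) (hv : IsWeakSupersolution s G g Ω f k α β v)
    (hum : Measurable u) (hvm : Measurable v) (hu0 : ∀ x, 0 ≤ u x) (hvpos : ∀ x ∈ Ω, 0 < v x)
    (hv0 : ∀ x, 0 ≤ v x) (he0 : 0 ≤ e) (he1 : e ≤ 1) (hM : 0 ≤ M)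
    (hwE : ∫⁻ z, energy s G (fun x => max (u x - e) 0) z ∂(volume.prod volume) < ⊤)
    (hmm : Measurable m) (hm0 : ∀ x, 0 ≤ m x) (hmw : ∀ x, m x ≤ max (u x - e) 0)
    (hmM : ∀ x, m x ≤ M) (hmE : ∫⁻ z, energy s G m z ∂(volume.prod volume) < ⊤)
    (hmK : ∃ K : Set ℝᴺ, IsCompact K ∧ K ⊆ Ω ∧ ∀ x, x ∉ K → m x = 0) :
    ∫⁻ x in Ω, ENNReal.ofReal (k x * excess pm (m x) (v x) *
        (v x ^ β / v x ^ (pm - 1) - max (u x - e) 0 ^ β / max (u x - e) 0 ^ (pm - 1))) ≤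
      (∫⁻ x in Ω, ENNReal.ofReal (k x * (min (max (u x - e) 0) M ^ pm /
        max (u x - e) 0 ^ (pm - 1) * (u x ^ β - max (u x - e) 0 ^ β)))) +
      ∫⁻ z in {z : ℝᴺ × ℝᴺ | m z.1 ≠ max (u z.1 - e) 0 ∨ m z.2 ≠ max (u z.2 - e) 0},
        C * (energy s G (fun x => max (u x - e) 0) z + energy s G m z) ∂(volume.prod volume) := by
  have hp : 1 < pm := by linarith [hH.one_lt]
  obtain ⟨K, hK, hKΩ, hmK⟩ := hmK
  set w : ℝᴺ → ℝ := fun x => max (u x - e) 0 with hw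
  have hwm : Measurable w := (hum.sub_const e).max measurable_const
  have hw0 : ∀ x, 0 ≤ w x := fun x => le_max_right _ _
  have hwu : ∀ x, w x ≤ u x := fun x => max_le (by linarith) (hu0 x)
  set φ₁ : ℝᴺ → ℝ := fun x => excess pm (m x) (v x) / w x ^ (pm - 1) with hφ₁
  set φ₂ : ℝᴺ → ℝ := fun x => excess pm (m x) (v x) / v x ^ (pm - 1) with hφ₂
  have ht₁ : IsTest s G Ω φ₁ := isTest_excess_div_left hN hs0 hs1 hG hg hH hΩ hv.1 hvm hv0 hwm hwE
    hmm hm0 hmw hmM hmE hK hKΩ hmK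
  have ht₂ : IsTest s G Ω φ₂ := isTest_excess_div_right hN hs0 hs1 hG hg hH hΩ hv.1 hvm hv0
    hmm hm0 hmM hmE hK hKΩ hmK
  have hO₁ := hu.1.integrable_operator φ₁ ht₁
  have hO₂ := hv.1.integrable_operator φ₂ ht₂
  have hS₁ := hu.1.integrable_source φ₁ ht₁
  have hS₂ := hv.1.integrable_source φ₂ ht₂
  have hu2 := hu.2 φ₁ ht₁
  have hv2 := hv.2 φ₂ ht₂
  set S : ℝᴺ → ℝ := fun x =>
    sourceIntegrand f k α β u φ₁ x - sourceIntegrand f k α β v φ₂ x with hS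
  set I : ℝᴺ × ℝᴺ → ℝ := fun z =>
    operatorIntegrand s g u φ₁ z - operatorIntegrand s g v φ₂ z with hI
  set r : ℝᴺ → ℝ := fun x =>
    k x * (min (w x) M ^ pm / w x ^ (pm - 1) * (u x ^ β - w x ^ β)) with hr
  have hSint : IntegrableOn S Ω := hS₁.sub hS₂
  have hIint : Integrable I (volume.prod volume) := hO₁.sub hO₂
  have hIS : ∫ z, I z ∂(volume.prod volume) ≤ ∫ x in Ω, S x := by
    rw [hI, hS, integral_sub hO₁ hO₂, integral_sub hS₁ hS₂]
    linarith
  have hr0 : ∀ᵐ x ∂volume.restrict Ω, 0 ≤ r x := by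
    rw [ae_restrict_iff' hΩ.measurableSet]
    filter_upwards [hk0] with x hkx hx
    have h1 : 0 ≤ u x ^ β - w x ^ β :=
      sub_nonneg.2 (Real.rpow_le_rpow (hw0 x) (hwu x) hβ0.le)
    have h2 : 0 ≤ min (w x) M := le_min (hw0 x) hM
    exact mul_nonneg (hkx hx).le (mul_nonneg (div_nonneg (Real.rpow_nonneg h2 _)
      (Real.rpow_nonneg (hw0 x) _)) h1)
  have hrint : IntegrableOn r Ω := by
    have hb : IntegrableOn (fun x => k x * (2 ^ β * (1 + M ^ pm))) Ω := hk.mul_const _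
    refine Integrable.mono' hb ?_ ?_
    · refine hk.aestronglyMeasurable.mul (Measurable.aestronglyMeasurable ?_)
      exact (((hwm.min measurable_const).pow_const _).div (hwm.pow_const _)).mul
        ((hum.pow_const _).sub (hwm.pow_const _))
    · have hk' : ∀ᵐ x ∂volume.restrict Ω, 0 < k x :=
        (ae_restrict_iff' hΩ.measurableSet).2 hk0
      filter_upwards [hr0, hk'] with x h1 h2
      rw [Real.norm_of_nonneg h1]
      exact mul_le_mul_of_nonneg_left (source_error_le hp hβ0 hβ1 hM he0 he1 rfl) h2.le
  have hPS : ∀ᵐ x ∂volume.restrict Ω, k x * excess pm (m x) (v x) *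
      (v x ^ β / v x ^ (pm - 1) - w x ^ β / w x ^ (pm - 1)) ≤ r x - S x := by
    rw [ae_restrict_iff' hΩ.measurableSet]
    filter_upwards [hf0, hk0] with x hfx hkx hx
    have := source_sub_le (f := f x) (k := k x) (u := u x) (v := v x) (w := w x) (m := m x)
      (M := M) hp hα hβ0 (hfx hx) (hkx hx).le (hvpos x hx) (hm0 x) (hmw x) (hmM x) (hwu x)
    simp only [hS, hr, sourceIntegrand, hφ₁, hφ₂]
    linarith
  have hP0 : ∀ᵐ x ∂volume.restrict Ω, 0 ≤ k x * excess pm (m x) (v x) *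
      (v x ^ β / v x ^ (pm - 1) - w x ^ β / w x ^ (pm - 1)) := by
    rw [ae_restrict_iff' hΩ.measurableSet]
    filter_upwards [hk0] with x hkx hx
    rcases le_or_gt (m x) (v x) with h | h
    · rw [excess_eq_zero hp (hm0 x) h]; simp
    · have h1 := rpow_div_rpow_le hβ1.le (hvpos x hx) (h.le.trans (hmw x))
      exact mul_nonneg (mul_nonneg (hkx hx).le (excess_nonneg _ _)) (sub_nonneg.2 h1)
  calc ∫⁻ x in Ω, ENNReal.ofReal (k x * excess pm (m x) (v x) *
        (v x ^ β / v x ^ (pm - 1) - w x ^ β / w x ^ (pm - 1)))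
      ≤ ∫⁻ x in Ω, ENNReal.ofReal (r x - S x) :=
        lintegral_mono_ae (hPS.mono fun x hx => ENNReal.ofReal_le_ofReal hx)
    _ = ENNReal.ofReal (∫ x in Ω, (r x - S x)) := by
        refine (ofReal_integral_eq_lintegral_ofReal (f := fun x => r x - S x)
          (hrint.sub hSint) ?_).symm
        filter_upwards [hPS, hP0] with x h1 h2
        exact h2.trans h1
    _ = ENNReal.ofReal ((∫ x in Ω, r x) + -∫ x in Ω, S x) := by
        rw [integral_sub hrint hSint, sub_eq_add_neg]
    _ ≤ ENNReal.ofReal (∫ x in Ω, r x) + ENNReal.ofReal (-∫ x in Ω, S x) :=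
        ENNReal.ofReal_add_le
    _ ≤ _ := by
        refine add_le_add ?_ ?_
        · rw [ofReal_integral_eq_lintegral_ofReal hrint hr0]
        · have hA : MeasurableSet {z : ℝᴺ × ℝᴺ | m z.1 ≠ w z.1 ∨ m z.2 ≠ w z.2} := by
            have h1 : MeasurableSet {x | m x = w x} := measurableSet_eq_fun hmm hwm
            exact (measurable_fst h1.compl).union (measurable_snd h1.compl)
          rw [← lintegral_indicator hA]
          calc ENNReal.ofReal (-∫ x in Ω, S x)
              ≤ ENNReal.ofReal (∫ z, -I z ∂(volume.prod volume)) := by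
                rw [integral_neg]; exact ENNReal.ofReal_le_ofReal (by linarith)
            _ ≤ ∫⁻ z, ENNReal.ofReal (-I z) ∂(volume.prod volume) :=
                ofReal_integral_le_lintegral hIint.neg
            _ ≤ _ := lintegral_mono fun z => hC z

/-- The comparison inequality for `w = (u - e)⁺`, truncated at the level `M`: `m` has tended to
`min w M`, and what remains of the operators is the energy of `u` above the level `M`. -/
lemma lintegral_source_min_le (hN : 1 ≤ N) (hs0 : 0 < s) (hs1 : s < 1) (hG : IsNFunction G)
    (hg : IsDensity G g) (hH : StructuralConditions N s G g pm pp) {Ω : Set ℝᴺ}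
    (hΩ : IsBoundedLipschitzDomain Ω)
    {α β : ℝ} (hα : 0 < α) (hβ0 : 0 < β) (hβ1 : β < pm - 1) {f k : ℝᴺ → ℝ}
    (hf0 : ∀ᵐ x, x ∈ Ω → 0 ≤ f x) (hk0 : ∀ᵐ x, x ∈ Ω → 0 < k x) (hk : IntegrableOn k Ω)
    {u v : ℝᴺ → ℝ} (hu : IsWeakSubsolution s G g Ω f k α β u)
    (hv : IsWeakSupersolution s G g Ω f k α β v)
    (hum : Measurable u) (hvm : Measurable v) (hupos : ∀ x ∈ Ω, 0 < u x)
    (huz : ∀ x, x ∉ Ω → u x = 0) (hvpos : ∀ x ∈ Ω, 0 < v x) (hvz : ∀ x, x ∉ Ω → v x = 0) :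
    ∃ C : ENNReal, C ≠ ⊤ ∧ ∀ (e : ℝ) (M : ℕ), 0 < e → e ≤ 1 →
      ∫⁻ x in Ω, ENNReal.ofReal (k x * excess pm (min (max (u x - e) 0) M) (v x) *
          (v x ^ β / v x ^ (pm - 1) - max (u x - e) 0 ^ β / max (u x - e) 0 ^ (pm - 1))) ≤
        (∫⁻ x in Ω, ENNReal.ofReal (k x * (min (max (u x - e) 0) M ^ pm /
          max (u x - e) 0 ^ (pm - 1) * (u x ^ β - max (u x - e) 0 ^ β)))) +
        C * ∫⁻ z in {z : ℝᴺ × ℝᴺ | (M : ℝ) < max (u z.1) (u z.2)},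
          energy s G u z ∂(volume.prod volume) := by
  have hp : 1 < pm := by linarith [hH.one_lt]
  obtain ⟨C, hC, hop⟩ := exists_operatorIntegrand_sub_le (N := N) hN hs0 hg hH
  have hu0 : ∀ x, 0 ≤ u x := fun x => by
    by_cases hx : x ∈ Ω
    · exact (hupos x hx).le
    · rw [huz x hx]
  have hv0 : ∀ x, 0 ≤ v x := fun x => by
    by_cases hx : x ∈ Ω
    · exact (hvpos x hx).le
    · rw [hvz x hx]
  have huv : ∀ x, v x = 0 → u x = 0 := fun x hx => huz x fun h => (hvpos x h).ne' hx
  refine ⟨C * 2, ENNReal.mul_ne_top hC ENNReal.ofNat_ne_top, fun e M he0 he1 => ?_⟩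
  set w : ℝᴺ → ℝ := fun x => max (u x - e) 0 with hw
  have hwm : Measurable w := (hum.sub_const e).max measurable_const
  have hw0 : ∀ x, 0 ≤ w x := fun x => le_max_right _ _
  have hwu : ∀ x, w x ≤ u x := fun x => max_le (by linarith) (hu0 x)
  have hwLip : ∀ z : ℝᴺ × ℝᴺ, |w z.1 - w z.2| ≤ |u z.1 - u z.2| := fun z => by
    refine (abs_max_sub_max_le_abs _ _ _).trans (le_of_eq ?_)
    congr 1; ring
  set w' : ℝᴺ → ℝ := fun x => min (w x) M with hw'
  have hw'm : Measurable w' := hwm.min measurable_const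
  have hw'Lip : ∀ z : ℝᴺ × ℝᴺ, |w' z.1 - w' z.2| ≤ |w z.1 - w z.2| := fun z => by
    refine (abs_min_sub_min_le_max _ _ _ _).trans ?_
    rw [sub_self, abs_zero]
    exact max_le le_rfl (abs_nonneg _)
  have hmaxm : Measurable fun z : ℝᴺ × ℝᴺ => max (u z.1) (u z.2) :=
    (hum.comp measurable_fst).max (hum.comp measurable_snd)
  have hlev : MeasurableSet {z : ℝᴺ × ℝᴺ | e ≤ max (u z.1) (u z.2)} :=
    measurableSet_le measurable_const hmaxm
  have hwE : ∫⁻ z, energy s G w z ∂(volume.prod volume) < ⊤ := by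
    have h1 := hu.1.lintegral_energy_level_lt_top hG hg hH hum hupos huz he0
    rw [← lintegral_indicator hlev] at h1
    refine (lintegral_mono fun z => ?_).trans_lt h1
    by_cases hz : e ≤ max (u z.1) (u z.2)
    · rw [indicator_of_mem (by exact hz)]
      exact energy_le_of_abs_le hg (hwLip z)
    · rw [indicator_of_notMem (by exact hz)]
      push Not at hz
      obtain ⟨h2, h3⟩ := max_lt_iff.1 hz
      rw [energy_eq_zero hg]
      simp only [hw]
      rw [max_eq_right (by linarith), max_eq_right (by linarith)]
  have hw'E : ∫⁻ z, energy s G w' z ∂(volume.prod volume) < ⊤ :=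
    (lintegral_mono fun z => energy_le_of_abs_le hg (hw'Lip z)).trans_lt hwE
  have hM : (0 : ℝ) ≤ M := M.cast_nonneg
  obtain ⟨m, hmm, hm0, hmw', hmK, hmev, hmE, hmT⟩ := exists_compact_support_approx hN hs0 hs1 hG hg
    hH hΩ (w := w') (M := M) hw'm (fun x => le_min (hw0 x) hM) (fun x => min_le_right _ _)
    (fun x hx => by
      have : w x = 0 := by simp only [hw]; rw [huz x hx]; exact max_eq_right (by linarith)
      simp only [hw', this]; exact min_eq_left hM) hw'E
  have hmT' := hmT _ (measurable_energy hG hwm) hwE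
  set R : ENNReal := ∫⁻ z in {z : ℝᴺ × ℝᴺ | (M : ℝ) < max (u z.1) (u z.2)},
    energy s G u z ∂(volume.prod volume) with hR
  have hset : ∀ n, ∫⁻ z in {z : ℝᴺ × ℝᴺ | m n z.1 ≠ w z.1 ∨ m n z.2 ≠ w z.2},
      C * (energy s G w z + energy s G (m n) z) ∂(volume.prod volume) ≤
      C * ((∫⁻ z in {z : ℝᴺ × ℝᴺ | m n z.1 ≠ w' z.1 ∨ m n z.2 ≠ w' z.2},
        (energy s G w z + energy s G (m n) z) ∂(volume.prod volume)) + 2 * R) := by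
    intro n
    rw [lintegral_const_mul' _ _ hC]
    gcongr
    have hA : MeasurableSet {z : ℝᴺ × ℝᴺ | m n z.1 ≠ w' z.1 ∨ m n z.2 ≠ w' z.2} := by
      have h1 : MeasurableSet {x | m n x = w' x} := measurableSet_eq_fun (hmm n) hw'm
      exact (measurable_fst h1.compl).union (measurable_snd h1.compl)
    have hB : MeasurableSet {z : ℝᴺ × ℝᴺ | m n z.1 ≠ w z.1 ∨ m n z.2 ≠ w z.2} := by
      have h1 : MeasurableSet {x | m n x = w x} := measurableSet_eq_fun (hmm n) hwm
      exact (measurable_fst h1.compl).union (measurable_snd h1.compl)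
    have hL : MeasurableSet {z : ℝᴺ × ℝᴺ | (M : ℝ) < max (u z.1) (u z.2)} :=
      measurableSet_lt measurable_const hmaxm
    have hEm : Measurable fun z => energy s G w z + energy s G (m n) z :=
      (measurable_energy hG hwm).add (measurable_energy hG (hmm n))
    rw [hR, ← lintegral_indicator hA, ← lintegral_indicator hB, ← lintegral_indicator hL,
      ← lintegral_const_mul' _ _ ENNReal.ofNat_ne_top,
      ← lintegral_add_left (hEm.indicator hA)]
    refine lintegral_mono fun z => ?_
    by_cases hzB : m n z.1 ≠ w z.1 ∨ m n z.2 ≠ w z.2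
    swap
    · rw [indicator_of_notMem (by exact hzB)]; exact zero_le
    rw [indicator_of_mem (by exact hzB)]
    by_cases hzA : m n z.1 ≠ w' z.1 ∨ m n z.2 ≠ w' z.2
    · rw [indicator_of_mem (by exact hzA)]; exact le_self_add
    rw [indicator_of_notMem (by exact hzA), zero_add]
    push Not at hzA
    -- `m n` differs from `w` but not from `min w M`, so the truncation is active
    have hzL : (M : ℝ) < max (u z.1) (u z.2) := by
      have aux : ∀ x, m n x = w' x → m n x ≠ w x → (M : ℝ) < u x := by
        intro x h1 h2
        by_contra hcon
        refine h2 (h1.trans (min_eq_left ?_))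
        exact (hwu x).trans (not_lt.1 hcon)
      rcases hzB with h | h
      · exact lt_max_of_lt_left (aux _ hzA.1 h)
      · exact lt_max_of_lt_right (aux _ hzA.2 h)
    rw [indicator_of_mem (by exact hzL), two_mul]
    refine add_le_add (energy_le_of_abs_le hg (hwLip z)) (energy_le_of_abs_le hg ?_)
    rw [hzA.1, hzA.2]
    exact (hw'Lip z).trans (hwLip z)
  have hlim : Tendsto (fun n => (∫⁻ x in Ω, ENNReal.ofReal (k x * (min (w x) M ^ pm /
      w x ^ (pm - 1) * (u x ^ β - w x ^ β)))) +
      C * ((∫⁻ z in {z : ℝᴺ × ℝᴺ | m n z.1 ≠ w' z.1 ∨ m n z.2 ≠ w' z.2},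
        (energy s G w z + energy s G (m n) z) ∂(volume.prod volume)) + 2 * R)) atTop
      (𝓝 ((∫⁻ x in Ω, ENNReal.ofReal (k x * (min (w x) M ^ pm /
      w x ^ (pm - 1) * (u x ^ β - w x ^ β)))) + C * (0 + 2 * R))) :=
    (ENNReal.Tendsto.const_mul (hmT'.add tendsto_const_nhds) (Or.inr hC)).const_add _
  rw [mul_assoc, ← zero_add (2 * R)]
  refine lintegral_le_of_tendsto_of_le (F := fun n x => ENNReal.ofReal
    (k x * excess pm (m n x) (v x) * (v x ^ β / v x ^ (pm - 1) - w x ^ β / w x ^ (pm - 1))))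
    (fun n => ?_) ?_ (fun n => ?_) hlim
  · refine ENNReal.measurable_ofReal.comp_aemeasurable ?_
    refine (hk.aestronglyMeasurable.aemeasurable.mul
      (measurable_excess (hmm n) hvm).aemeasurable).mul (Measurable.aemeasurable ?_)
    exact ((hvm.pow_const _).div (hvm.pow_const _)).sub ((hwm.pow_const _).div (hwm.pow_const _))
  · refine ae_restrict_of_ae ?_
    filter_upwards [hmev] with x hx
    refine tendsto_const_nhds.congr' ?_
    filter_upwards [hx] with n hn
    rw [hn]
  · refine (lintegral_source_le hN hs0 hs1 hG hg hH hΩ.isOpen hα hβ0 hβ1 hf0 hk0 hk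
      (u := u) (v := v) (m := m n) (e := e) (M := M) (C := C) ?_ hu hv hum hvm hu0 hvpos hv0 he0.le
      he1 hM hwE (hmm n) (hm0 n) (fun x => (hmw' n x).trans (min_le_left _ _))
      (fun x => (hmw' n x).trans (min_le_right _ _)) (hmE n) (hmK n)).trans ?_
    · exact fun z => hop u v (m n) e z hu0 hv0 (hm0 n)
        (fun x => (hmw' n x).trans (min_le_left _ _)) huv he0.le
    · exact add_le_add le_rfl (hset n)

/-- The comparison inequality truncated at the level `M`: `e` has tended to zero. -/
lemma lintegral_source_limit_le (hN : 1 ≤ N) (hs0 : 0 < s) (hs1 : s < 1) (hG : IsNFunction G)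
    (hg : IsDensity G g) (hH : StructuralConditions N s G g pm pp) {Ω : Set ℝᴺ}
    (hΩ : IsBoundedLipschitzDomain Ω)
    {α β : ℝ} (hα : 0 < α) (hβ0 : 0 < β) (hβ1 : β < pm - 1) {f k : ℝᴺ → ℝ}
    (hf0 : ∀ᵐ x, x ∈ Ω → 0 ≤ f x) (hk0 : ∀ᵐ x, x ∈ Ω → 0 < k x) (hk : IntegrableOn k Ω)
    {u v : ℝᴺ → ℝ} (hu : IsWeakSubsolution s G g Ω f k α β u)
    (hv : IsWeakSupersolution s G g Ω f k α β v)
    (hum : Measurable u) (hvm : Measurable v) (hupos : ∀ x ∈ Ω, 0 < u x)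
    (huz : ∀ x, x ∉ Ω → u x = 0) (hvpos : ∀ x ∈ Ω, 0 < v x) (hvz : ∀ x, x ∉ Ω → v x = 0) :
    ∃ C : ENNReal, C ≠ ⊤ ∧ ∀ M : ℕ,
      ∫⁻ x in Ω, ENNReal.ofReal (k x * excess pm (min (u x) M) (v x) *
          (v x ^ β / v x ^ (pm - 1) - u x ^ β / u x ^ (pm - 1))) ≤
        C * ∫⁻ z in {z : ℝᴺ × ℝᴺ | (M : ℝ) < max (u z.1) (u z.2)},
          energy s G u z ∂(volume.prod volume) := by
  have hp : 1 < pm := by linarith [hH.one_lt]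
  obtain ⟨C, hC, hle⟩ := lintegral_source_min_le hN hs0 hs1 hG hg hH hΩ hα hβ0 hβ1 hf0 hk0 hk hu hv
    hum hvm hupos huz hvpos hvz
  refine ⟨C, hC, fun M => ?_⟩
  have hM : (0 : ℝ) ≤ M := M.cast_nonneg
  set e : ℕ → ℝ := fun n => 1 / ((n : ℝ) + 1) with he
  have he0 : ∀ n, 0 < e n := fun n => by positivity
  have he1 : ∀ n, e n ≤ 1 := fun n => by
    rw [he]
    have : (0 : ℝ) ≤ n := n.cast_nonneg
    exact (div_le_one (by positivity)).2 (by linarith)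
  have het : Tendsto e atTop (𝓝 0) := tendsto_one_div_add_atTop_nhds_zero_nat
  set w : ℕ → ℝᴺ → ℝ := fun n x => max (u x - e n) 0 with hw
  have hwm : ∀ n, Measurable (w n) := fun n => (hum.sub_const _).max measurable_const
  have hwt : ∀ x ∈ Ω, Tendsto (fun n => w n x) atTop (𝓝 (u x)) := by
    intro x hx
    have h1 : Tendsto (fun n => u x - e n) atTop (𝓝 (u x - 0)) := het.const_sub _
    have h2 := h1.max (tendsto_const_nhds (x := (0 : ℝ)))
    rwa [sub_zero, max_eq_left (hupos x hx).le] at h2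
  have hpow : ∀ x ∈ Ω, ∀ q : ℝ, Tendsto (fun n => w n x ^ q) atTop (𝓝 (u x ^ q)) :=
    fun x hx q => (hwt x hx).rpow_const (Or.inl (hupos x hx).ne')
  have hmint : ∀ x ∈ Ω, Tendsto (fun n => min (w n x) M ^ pm) atTop (𝓝 (min (u x) M ^ pm)) :=
    fun x hx => ((hwt x hx).min tendsto_const_nhds).rpow_const (Or.inr (by linarith))
  -- the errors vanish by dominated convergence
  have herr : Tendsto (fun n => ∫⁻ x in Ω, ENNReal.ofReal (k x * (min (w n x) M ^ pm /
      w n x ^ (pm - 1) * (u x ^ β - w n x ^ β)))) atTop (𝓝 0) := by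
    rw [show (0 : ENNReal) = ∫⁻ x in Ω, 0 by simp]
    have hb : ∫⁻ x in Ω, ENNReal.ofReal (k x * (2 ^ β * (1 + (M : ℝ) ^ pm))) ≠ ⊤ := by
      have : IntegrableOn (fun x => k x * (2 ^ β * (1 + (M : ℝ) ^ pm))) Ω := hk.mul_const _
      exact this.lintegral_lt_top.ne
    refine tendsto_lintegral_filter_of_dominated_convergence' _
      (Eventually.of_forall fun n => ?_) (Eventually.of_forall fun n => ?_) hb ?_
    · refine ENNReal.measurable_ofReal.comp_aemeasurable
        (hk.aestronglyMeasurable.aemeasurable.mul (Measurable.aemeasurable ?_))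
      exact ((((hwm n).min measurable_const).pow_const _).div ((hwm n).pow_const _)).mul
        ((hum.pow_const _).sub ((hwm n).pow_const _))
    · rw [ae_restrict_iff' hΩ.isOpen.measurableSet]
      filter_upwards [hk0] with x hkx hx
      exact ENNReal.ofReal_le_ofReal (mul_le_mul_of_nonneg_left
        (source_error_le hp hβ0 hβ1 hM (he0 n).le (he1 n) rfl) (hkx hx).le)
    · rw [ae_restrict_iff' hΩ.isOpen.measurableSet]
      refine ae_of_all _ fun x hx => ?_
      have hux := hupos x hx
      have h1 : Tendsto (fun n => k x * (min (w n x) M ^ pm / w n x ^ (pm - 1) *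
          (u x ^ β - w n x ^ β))) atTop (𝓝 (k x * (min (u x) M ^ pm / u x ^ (pm - 1) *
          (u x ^ β - u x ^ β)))) :=
        (((hmint x hx).div (hpow x hx _) (by positivity)).mul
          ((hpow x hx β).const_sub _)).const_mul _
      rw [sub_self, mul_zero, mul_zero] at h1
      simpa using ENNReal.tendsto_ofReal h1
  have hlim := herr.add_const (C * ∫⁻ z in {z : ℝᴺ × ℝᴺ | (M : ℝ) < max (u z.1) (u z.2)},
    energy s G u z ∂(volume.prod volume))
  rw [zero_add] at hlim
  refine lintegral_le_of_tendsto_of_le (F := fun n x => ENNReal.ofReal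
    (k x * excess pm (min (w n x) M) (v x) *
      (v x ^ β / v x ^ (pm - 1) - w n x ^ β / w n x ^ (pm - 1))))
    (fun n => ?_) ?_ (fun n => hle (e n) M (he0 n) (he1 n)) hlim
  · refine ENNReal.measurable_ofReal.comp_aemeasurable ?_
    refine (hk.aestronglyMeasurable.aemeasurable.mul
      (measurable_excess ((hwm n).min measurable_const) hvm).aemeasurable).mul
      (Measurable.aemeasurable ?_)
    exact ((hvm.pow_const _).div (hvm.pow_const _)).sub
      (((hwm n).pow_const _).div ((hwm n).pow_const _))
  · rw [ae_restrict_iff' hΩ.isOpen.measurableSet]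
    refine ae_of_all _ fun x hx => ENNReal.tendsto_ofReal ?_
    have hux := hupos x hx
    refine Tendsto.mul (Tendsto.const_mul _ ?_) (Tendsto.const_sub _ ?_)
    · exact ((hmint x hx).sub_const _).max tendsto_const_nhds
    · exact (hpow x hx β).div (hpow x hx _) (by positivity)

/-- The comparison principle for representatives that are measurable, positive in `Ω` and zero
outside `Ω`. -/
lemma ae_le_of_isWeakSubsolution (hN : 1 ≤ N) (hs0 : 0 < s) (hs1 : s < 1) (hG : IsNFunction G)
    (hg : IsDensity G g) (hH : StructuralConditions N s G g pm pp) {Ω : Set ℝᴺ}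
    (hΩ : IsBoundedLipschitzDomain Ω)
    {α β : ℝ} (hα : 0 < α) (hβ0 : 0 < β) (hβ1 : β < pm - 1) {f k : ℝᴺ → ℝ}
    (hf0 : ∀ᵐ x, x ∈ Ω → 0 ≤ f x) (hk0 : ∀ᵐ x, x ∈ Ω → 0 < k x) (hk : IntegrableOn k Ω)
    {u v : ℝᴺ → ℝ} (hu : IsWeakSubsolution s G g Ω f k α β u)
    (hv : IsWeakSupersolution s G g Ω f k α β v)
    (hum : Measurable u) (hvm : Measurable v) (hupos : ∀ x ∈ Ω, 0 < u x)
    (huz : ∀ x, x ∉ Ω → u x = 0) (hvpos : ∀ x ∈ Ω, 0 < v x) (hvz : ∀ x, x ∉ Ω → v x = 0) :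
    ∀ᵐ x, x ∈ Ω → u x ≤ v x := by
  have hp : 1 < pm := by linarith [hH.one_lt]
  obtain ⟨C, hC, hle⟩ := lintegral_source_limit_le hN hs0 hs1 hG hg hH hΩ hα hβ0 hβ1 hf0 hk0 hk
    hu hv hum hvm hupos huz hvpos hvz
  have htend := ENNReal.Tendsto.const_mul
    (hu.1.tendsto_lintegral_energy_level hG hg hH hum hupos huz) (Or.inr hC)
  rw [mul_zero] at htend
  set P : ℕ → ℝᴺ → ℝ := fun M x => k x * excess pm (min (u x) M) (v x) *
    (v x ^ β / v x ^ (pm - 1) - u x ^ β / u x ^ (pm - 1)) with hP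
  have hPm : ∀ M, AEMeasurable (fun x => ENNReal.ofReal (P M x)) (volume.restrict Ω) := by
    intro M
    refine ENNReal.measurable_ofReal.comp_aemeasurable ?_
    refine (hk.aestronglyMeasurable.aemeasurable.mul
      (measurable_excess (hum.min measurable_const) hvm).aemeasurable).mul
      (Measurable.aemeasurable ?_)
    exact ((hvm.pow_const _).div (hvm.pow_const _)).sub ((hum.pow_const _).div (hum.pow_const _))
  -- The left-hand sides increase with `M` while their bounds tend to zero, so they all vanish.
  have hPmono : ∀ M M' : ℕ, M ≤ M' → ∫⁻ x in Ω, ENNReal.ofReal (P M x) ≤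
      ∫⁻ x in Ω, ENNReal.ofReal (P M' x) := by
    intro M M' hMM
    refine lintegral_mono_ae ?_
    rw [ae_restrict_iff' hΩ.isOpen.measurableSet]
    filter_upwards [hk0] with x hkx hx
    refine ENNReal.ofReal_le_ofReal ?_
    have hMM' : (M : ℝ) ≤ M' := by exact_mod_cast hMM
    rcases le_or_gt (u x) (v x) with h | h
    · have h1 : ∀ M : ℕ, P M x = 0 := fun M => by
        have : excess pm (min (u x) M) (v x) = 0 :=
          excess_eq_zero hp (le_min (hupos x hx).le M.cast_nonneg) ((min_le_left _ _).trans h)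
        simp only [hP, this, mul_zero, zero_mul]
      rw [h1, h1]
    · have h1 : 0 ≤ v x ^ β / v x ^ (pm - 1) - u x ^ β / u x ^ (pm - 1) :=
        sub_nonneg.2 (rpow_div_rpow_le hβ1.le (hvpos x hx) h.le)
      refine mul_le_mul_of_nonneg_right (mul_le_mul_of_nonneg_left ?_ (hkx hx).le) h1
      refine max_le_max_right _ (sub_le_sub_right (Real.rpow_le_rpow
        (le_min (hupos x hx).le M.cast_nonneg) (min_le_min_left _ hMM') (by linarith)) _)
  have hzero : ∀ M, ∫⁻ x in Ω, ENNReal.ofReal (P M x) = 0 := by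
    intro M
    refine le_antisymm (ge_of_tendsto htend ?_) zero_le
    filter_upwards [eventually_ge_atTop M] with M' hM'
    exact (hPmono M M' hM').trans (hle M')
  have hae : ∀ᵐ x, ∀ M : ℕ, x ∈ Ω → ENNReal.ofReal (P M x) = 0 := by
    rw [ae_all_iff]
    intro M
    rw [← ae_restrict_iff' hΩ.isOpen.measurableSet]
    exact (lintegral_eq_zero_iff' (hPm M)).1 (hzero M)
  filter_upwards [hae, hk0] with x hx hkx hxΩ
  by_contra hcon
  push Not at hcon
  obtain ⟨M, hM⟩ := exists_nat_ge (u x)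
  have h1 := ENNReal.ofReal_eq_zero.1 (hx M hxΩ)
  have hv1 := hvpos x hxΩ
  have hu1 := hupos x hxΩ
  have h2 : 0 < P M x := by
    have h3 : 0 < excess pm (min (u x) M) (v x) := by
      rw [min_eq_left hM, excess_of_le hp hv1.le hcon.le, sub_pos]
      exact Real.rpow_lt_rpow hv1.le hcon (by linarith)
    have h4 : u x ^ β / u x ^ (pm - 1) < v x ^ β / v x ^ (pm - 1) := by
      rw [← Real.rpow_sub hu1, ← Real.rpow_sub hv1]
      exact Real.rpow_lt_rpow_of_neg hv1 hcon (by linarith)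
    exact mul_pos (mul_pos (hkx hxΩ) h3) (sub_pos.2 h4)
  linarith

end Limits

end FracOrlicz

theorem theorem1 (N : ℕ) (hN : 1 ≤ N) (s : ℝ) (hs0 : 0 < s) (hs1 : s < 1)
    (Ω : Set (EuclideanSpace ℝ (Fin N))) (hΩ : FracOrlicz.IsBoundedLipschitzDomain Ω)
    (G g : ℝ → ℝ) (pm pp : ℝ)
    (hG : FracOrlicz.IsNFunction G) (hg : FracOrlicz.IsDensity G g)
    (hH : FracOrlicz.StructuralConditions N s G g pm pp)
    (α β : ℝ) (hα : 0 < α) (hβ0 : 0 < β) (hβ1 : β < pm - 1)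
    (f k : EuclideanSpace ℝ (Fin N) → ℝ)
    (hf0 : ∀ᵐ x, x ∈ Ω → 0 ≤ f x) (hf1 : ¬ ∀ᵐ x, x ∈ Ω → f x = 0)
    (hk0 : ∀ᵐ x, x ∈ Ω → 0 < k x)
    (hk : FracOrlicz.MemOrlicz (FracOrlicz.complementary
      fun t => FracOrlicz.sobolevConj N s G (t ^ (1 / (β + 1)))) Ω k)
    (hf : (1 < α ∧ IntegrableOn f Ω) ∨
      (α = 1 ∧ FracOrlicz.MemOrlicz
        (FracOrlicz.complementary (FracOrlicz.sobolevConj N s G)) Ω f) ∨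
      (α < 1 ∧ FracOrlicz.MemOrlicz (FracOrlicz.complementary
        fun t => FracOrlicz.sobolevConj N s G (t ^ (1 / (1 - α)))) Ω f))
    (u v : EuclideanSpace ℝ (Fin N) → ℝ)
    (hu : FracOrlicz.IsWeakSubsolution s G g Ω f k α β u)
    (hv : FracOrlicz.IsWeakSupersolution s G g Ω f k α β v) :
    ∀ᵐ x, x ∈ Ω → u x ≤ v x := by
  obtain ⟨u', huu, hum, hupos, huz⟩ := hu.1.exists_representative hΩ
  obtain ⟨v', hvv, hvm, hvpos, hvz⟩ := hv.1.exists_representative hΩ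
  have hkint : IntegrableOn k Ω := FracOrlicz.integrableOn_of_memOrlicz_complementary hN hs0 hG hg
    hH hβ0 hβ1 hΩ.isBounded hk
  have h := FracOrlicz.ae_le_of_isWeakSubsolution hN hs0 hs1 hG hg hH hΩ hα hβ0 hβ1 hf0 hk0 hkint
    (hu.congr huu) (hv.congr hvv) hum hvm hupos huz hvpos hvz
  filter_upwards [h, huu, hvv] with x h1 h2 h3 hx
  rw [h2, h3]
  exact h1 hx
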